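/- Let $t\neq 0$ be a real or complex number, and fix a square root $t^{1/2}$ and a fourth root $t^{1/4}$. For integers $n\ge c\ge 0$ of the same parity, let $W(n\cdot 1,c,t)$ be the Kauffman bracket skein space: formal linear combinations of planar matchings in a rectangle with $n$ points on the left side and $c$ points on the right side, where matchings with a U-turn on the right side are set to $0$ and a closed loop has the value $-t^{1/2}-t^{-1/2}$. The $i$-th generator of the braid group $B_n$ acts by stacking on the left $t^{1/4}$ times a crossing of the strands $i,i+1$, that is, by $\tau_i=-(1+t^{1/2}U_i)$, where $U_i$ is the diagram with a U-turn on each side at the positions $i,i+1$ and the identity elsewhere. Gluing two skeins at both ends, with a Jones–Wenzl projector at the clasp of $c$ strands, gives a bilinear form on $W(n\cdot 1,c,t)$, and $X(n\cdot 1,c,t)$ is the quotient of $W(n\cdot 1,c,t)$ by the kernel of this form. When $t$ is real, the matchings, multiplied by $t^{1/2}$ when the number of black regions is odd (regions alternately white and black, the top region white), span a real form $X(n\cdot 1,c,t)_{\mathbb R}$ that is preserved by $B_n$. When $|t|=1$, the form becomes a $B_n$-invariant Hermitian form after complex conjugation of the coefficients of matchings in one argument, and $\mathrm{PSU}(X(n\cdot1,c,t))$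 is the image in $\mathrm{PGL}(X(n\cdot 1,c,t))$ of the group of its isometries of determinant $1$. A group acts discretely if its image in the indicated projective group is a discrete subgroup in the analytic topology, and indiscretely otherwise. Below, $(B,X)$ denotes either $B_3$ with $X=X(3\cdot 1,1,t)$ or $B_4$ with $X=X(4\cdot 1,0,t)$; the statements hold for both. In items 1–3, $X$ is 2-dimensional. 1. Let $t\neq 0,-1$ be real. Then $B$ acts discretely in $\mathrm{PGL}(X_{\mathbb R})$ if and only if $t<0$, or $t+t^{-1}\ge 3$, or $t+t^{-1}=1+2\cos(2\pi/m)$ for some integer $m\ge 1$. 2. Let $t=e^{i\theta}$ with $0<|\theta|<2\pi/3$. Then $\mathrm{PSU}(X)$ is compact and contains the image of $B$, and $B$ acts discretely in it if and only if $|\theta|=\pi-2\pi/m$ for some integer $m\ge 1$, or $|\theta|=\pi/5$. 3. Let $t=e^{i\theta}$ with $2\pi/3<|\theta|<\pi$. Then $\mathrm{PSU}(X)$ is not compact and contains the image of $B$, and $B$ acts discretely in it if and only if $|\theta|=\pi-2\pi/m$ for some integer $m\ge 1$. 4. If $t$ is real and $t+t^{-1}=1+2\cos(2\pi/7)$, then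 $B_4$ acts indiscretely in $\mathrm{PGL}(X(4\cdot 1,2,t)_{\mathbb R})$. -/

import Mathlib

noncomputable section

namespace JonesBraid

/-- The relators of Artin's presentation of the braid group on `n` strands, with generators
`0, …, n - 2`. -/
inductive BraidRelator (n : ℕ) : FreeGroup (Fin (n - 1)) → Prop
  | braid (i j : Fin (n - 1)) (h : i.val + 1 = j.val) : BraidRelator n
      (FreeGroup.of i * FreeGroup.of j * FreeGroup.of i *
        (FreeGroup.of j * FreeGroup.of i * FreeGroup.of j)⁻¹)
  | comm (i j : Fin (n - 1)) (h : i.val + 2 ≤ j.val) : BraidRelator n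
      (FreeGroup.of i * FreeGroup.of j * (FreeGroup.of j * FreeGroup.of i)⁻¹)

/-- The braid group `B_n` on `n` strands. -/
abbrev BraidGroup (n : ℕ) : Type := PresentedGroup {w | BraidRelator n w}

/-- The standard generators of the braid group. -/
def BraidGroup.gen {n : ℕ} (i : Fin (n - 1)) : BraidGroup n := PresentedGroup.of i

/-- The upper of the two neighbouring points that the `i`-th generator interchanges. -/
def upper {n : ℕ} (i : Fin (n - 1)) : Fin n := ⟨i.val, by omega⟩

/-- The lower of the two neighbouring points that the `i`-th generator interchanges. -/
def lower {n : ℕ} (i : Fin (n - 1)) : Fin n := ⟨i.val + 1, by omega⟩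

/-- The planar matchings in a rectangle of `n` points on the left side (numbered `0, …, n - 1`
from top to bottom) and `c` points on the right side, without a U-turn on the right side. Such a
matching is recorded by the involution `p` of the left points that exchanges the two ends of each
U-turn on the left and fixes the points that are joined to the right side. The strands that reach
the right side do so in order, since they do not cross. Planarity says that whatever starts
strictly between the two ends of a U-turn is a U-turn that also ends there. -/
abbrev PlanarMatching (n c : ℕ) : Type :=
  {p : Fin n → Fin n // (∀ i, p (p i) = i) ∧
    (∀ i j, i < j → j < p i → i < p j ∧ p j < p i ∧ p j ≠ j) ∧
    Fintype.card {i // p i = i} = c}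

/-- The parity (`0` or `1`) of the number of black regions of a matching, when the regions are
coloured alternately white and black and the top region is white. Every region other than the top
one lies directly below exactly one upper strand end, namely that of the strand separating it from
the top region, and the region directly below the left point `i` is black iff `i` is even. -/
def blackParity {n : ℕ} (p : Fin n → Fin n) : ℕ :=
  Fintype.card {i : Fin n // Even i.val ∧ i ≤ p i} % 2

/-- The left points after composing a matching `p`, on its left side, with the diagram `U` that has
a U-turn joining `a` and `b` on each side and is the identity elsewhere: `a` and `b` are joined, and
so are the former partners of `a` and `b` (if one of these partners was a point on the right, the
other partner is now joined to it). Only used if `p a ≠ b` and `a`, `b` are not both joined to the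
right side. -/
def reconnect {n : ℕ} (p : Fin n → Fin n) (a b j : Fin n) : Fin n :=
  if j = a then b
  else if j = b then a
  else if p j = a then (if p b = b then j else p b)
  else if p j = b then (if p a = a then j else p a)
  else p j

section Skein

variable (F : Type) [Field F]

/-- The skein space `W(n⋅1,c,t)` over `F`. With `s = t ^ (1/2)`, possibly in an extension of `F`,
the basis vector indexed by a matching `p` is the skein `s ^ blackParity p • p`. -/
abbrev W (n c : ℕ) : Type := PlanarMatching n c → F

variable {F}

/-- The matrix of `s U_i`, where `s = t ^ (1/2)` and `U_i` is stacking, on the left, the diagram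
with two U-turns at the neighbouring points `i`, `i + 1`. A closed loop is worth `-s - s⁻¹`, so
it contributes `-(1 + t)`; a U-turn on the right is worth `0`; otherwise a matching becomes a
matching of the opposite parity, and the factor is `s * s = t` or `s * s⁻¹ = 1` in the basis
`s ^ blackParity p • p`. -/
def cupCap (n c : ℕ) (t : F) (i : Fin (n - 1)) :
    Matrix (PlanarMatching n c) (PlanarMatching n c) F :=
  Matrix.of fun q p =>
    if p.1 (upper i) = lower i then (if q = p then -(1 + t) else 0)
    else if p.1 (upper i) = upper i ∧ p.1 (lower i) = lower i then 0
    else if q.1 = reconnect p.1 (upper i) (lower i) then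
      (if blackParity p.1 = 1 then t else 1)
    else 0

/-- The operator of a braid generator on the skein space: `t ^ (1/4)` times the crossing
`-t ^ (-1/4) • 1 - t ^ (1/4) • U_i`. -/
def tau (n c : ℕ) (t : F) (i : Fin (n - 1)) : W F n c →ₗ[F] W F n c :=
  Matrix.toLin' (-(1 + cupCap n c t i))

/-- The graph obtained by gluing two matchings along their left sides. -/
def glue {n : ℕ} (p q : Fin n → Fin n) : SimpleGraph (Fin n) :=
  SimpleGraph.fromRel fun i j => p i = j ∨ q i = j

/-- The number of closed loops that arise when two matchings are glued along their left sides: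
the components that contain no end of a strand going to a right side. -/
def closedLoops {n : ℕ} (p q : Fin n → Fin n) : ℕ :=
  Nat.card {C : (glue p q).ConnectedComponent //
    ∀ i, (glue p q).connectedComponentMk i = C → p i ≠ i ∧ q i ≠ i}

/-- When two matchings are glued along their left sides, no two points on the same right side get
joined. -/
def NoTurnback {n : ℕ} (p q : Fin n → Fin n) : Prop :=
  ∀ i j, (glue p q).Reachable i j →
    ((p i = i ∧ p j = j) ∨ (q i = i ∧ q j = j)) → i = j

open Classical in
/-- The Gram matrix of the bilinear form on the skein space, in the basis `s ^ blackParity p • p`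
and multiplied by the constant `s ^ ((n - c) / 2 + c)`, where `s = t ^ (1/2)`; this constant makes
the entries polynomials in `t`. The form glues two skeins at their left ends, and at their right
ends through a Jones-Wenzl projector of colour `c`. The projector annihilates U-turns; without
U-turns, the result is the closure of the projector, worth
`(-1) ^ c * (s ^ c + s ^ (c - 2) + ⋯ + s ^ (-c))`, together with the closed loops, each worth
`-(s + s⁻¹)`. The halved exponent below is a natural number that is even before halving. -/
def gram (n c : ℕ) (t : F) : Matrix (PlanarMatching n c) (PlanarMatching n c) F :=
  Matrix.of fun p q =>
    if NoTurnback p.1 q.1 then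
      (-1) ^ c * (∑ k ∈ Finset.range (c + 1), t ^ k) * (-(1 + t)) ^ closedLoops p.1 q.1 *
        t ^ ((blackParity p.1 + blackParity q.1 + (n - c) / 2 - closedLoops p.1 q.1) / 2)
    else 0

/-- The kernel of the (symmetric) bilinear form on the skein space. -/
def radical (n c : ℕ) (t : F) : Submodule F (W F n c) := LinearMap.ker (Matrix.toLin' (gram n c t))

/-- The reduced skein space `X(n⋅1,c,t)` over `F`: the quotient of the skein space by the kernel of
its bilinear form. -/
abbrev X (n c : ℕ) (t : F) : Type := W F n c ⧸ radical n c t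

/-- `ρ` is the Jones representation of `B_n` on `X(n⋅1,c,t)`: every braid generator acts as induced
by its action on skeins. -/
def IsJonesRep {n c : ℕ} {t : F} (ρ : BraidGroup n →* LinearMap.GeneralLinearGroup F (X n c t)) :
    Prop :=
  ∀ (i : Fin (n - 1)) (w : W F n c),
    (ρ (BraidGroup.gen i) : Module.End F (X n c t)) ((radical n c t).mkQ w) =
      (radical n c t).mkQ (tau n c t i w)

end Skein

section Projective

variable (F V : Type) [Field F] [AddCommGroup V] [Module F V]

/-- The projective general linear group `PGL(V)`. -/
def PGL : Type :=
  LinearMap.GeneralLinearGroup F V ⧸ Subgroup.center (LinearMap.GeneralLinearGroup F V)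

instance : Group (PGL F V) := inferInstanceAs
  (Group (LinearMap.GeneralLinearGroup F V ⧸ Subgroup.center (LinearMap.GeneralLinearGroup F V)))

/-- The analytic topology on `PGL(V)`, for a finite-dimensional space `V` over `ℝ` or `ℂ`: the
endomorphisms of `V` have the standard topology of a finite-dimensional vector space, the group of
units has the topology of a group of units, and `PGL(V)` has the quotient topology. -/
instance [TopologicalSpace F] : TopologicalSpace (PGL F V) :=
  letI : TopologicalSpace (Module.End F V) := moduleTopology F (Module.End F V)
  inferInstanceAs (TopologicalSpace
    ((Module.End F V)ˣ ⧸ Subgroup.center (LinearMap.GeneralLinearGroup F V)))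

/-- The projection from `GL(V)` to `PGL(V)`. -/
def toPGL : LinearMap.GeneralLinearGroup F V →* PGL F V :=
  QuotientGroup.mk' (Subgroup.center (LinearMap.GeneralLinearGroup F V))

variable {F V}

/-- The image in `PGL(V)` of a group acting linearly on `V`. -/
def projImage {G : Type} [Group G] (ρ : G →* LinearMap.GeneralLinearGroup F V) :
    Subgroup (PGL F V) :=
  ((toPGL F V).comp ρ).range

end Projective

section Unitary

/-- For `|t| = 1`, the invariant form `⟨A̅, B⟩` on the skein space, where `A ↦ A̅` is the
conjugate-linear map that fixes the matchings; it sends the basis vector `s ^ blackParity p • p`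
to `t ^ (-blackParity p)` times itself. Since the Gram matrix carries a constant factor,
this is a unimodular constant times a Hermitian form, which has the same isometries. -/
def skeinForm (n c : ℕ) (t : ℂ) (x y : W ℂ n c) : ℂ :=
  ∑ p, ∑ q, (starRingEnd ℂ (x p) * (t ^ blackParity p.1)⁻¹) * gram n c t p q * y q

/-- The form induced on `X(n⋅1,c,t)`, computed on representatives. For `|t| = 1` the form on skeins
vanishes if one argument is in the kernel, so the choice of the representatives does not matter. -/
def reducedForm (n c : ℕ) (t : ℂ) (x y : X n c t) : ℂ :=
  skeinForm n c t (Function.surjInv (radical n c t).mkQ_surjective x)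
    (Function.surjInv (radical n c t).mkQ_surjective y)

/-- The group `SU(X(n⋅1,c,t))` of the isometries of determinant `1`, for `|t| = 1`. -/
def SU (n c : ℕ) (t : ℂ) : Subgroup (LinearMap.GeneralLinearGroup ℂ (X n c t)) where
  carrier := {g | LinearMap.det (g : Module.End ℂ (X n c t)) = 1 ∧
    ∀ x y, reducedForm n c t ((g : Module.End ℂ (X n c t)) x) ((g : Module.End ℂ (X n c t)) y) =
      reducedForm n c t x y}
  one_mem' := by simp
  mul_mem' := by
    rintro g h ⟨hg, hg'⟩ ⟨hh, hh'⟩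
    refine ⟨by simp [hg, hh], fun x y => ?_⟩
    simp only [Units.val_mul, Module.End.mul_apply, hg', hh']
  inv_mem' := by
    rintro g ⟨hg, hg'⟩
    have key : ∀ x, (g : Module.End ℂ (X n c t)) ((g⁻¹ : (Module.End ℂ (X n c t))ˣ).1 x) = x := by
      intro x
      rw [← Module.End.mul_apply, Units.mul_inv, Module.End.one_apply]
    refine ⟨?_, fun x y => ?_⟩
    · have h1 : LinearMap.det (g : Module.End ℂ (X n c t)) *
          LinearMap.det ((g⁻¹ : (Module.End ℂ (X n c t))ˣ) : Module.End ℂ (X n c t)) = 1 := by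
        rw [← map_mul, Units.mul_inv, map_one]
      rwa [hg, one_mul] at h1
    · rw [← hg', key, key]

/-- The group `PSU(X(n⋅1,c,t))`, for `|t| = 1`, as a subgroup of `PGL(X(n⋅1,c,t))`. -/
def PSU (n c : ℕ) (t : ℂ) : Subgroup (PGL ℂ (X n c t)) := (SU n c t).map (toPGL ℂ (X n c t))

end Unitary

end JonesBraid

end

namespace JonesBraid

open CoxeterSystem
open scoped Matrix

/-! Both two-dimensional skein spaces carry the reduced Burau representation of B₃ (B₄ acts through
B₃, with σ₃ acting as σ₁), so `burauGroup` decides the first three items. In PGL₂ the element σ₁σ₂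
has order three and σ₁σ₂σ₁ has order two, so the image is a quotient of the modular group: a group
of triangle type (2, 3, ·), and the question is when it is a genuine triangle group.

Discreteness. Under conjugation a traceless 2×2 matrix acts on the traceless matrices as minus a
reflection, since anticommutators of traceless matrices are scalar (`adjointRel_cartanReflection`).
A suitable frame of three traceless matrices has, up to scale, the Gram matrix of the normals of a
triangle with angles π/2, π/3 and a third angle of cosine q/2, and the Burau group acts by elements
of the reflection group of that triangle, up to sign. Here q² = 2 - t - t⁻¹ if the generators
preserve orientation (|t| = 1 or t < 0), and q² = 1 + t + t⁻¹ if t > 0. For q = 2 cos(π/m) or q ≥ 2,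
Tits' positivity argument (`eq_one_of_diag_pos`) isolates the identity, whatever the signature of
the form. The angle |θ| = π/5 leads to the finite group (2, 3, 5/2), which permutes a finite set of
roots; at t = 1, where the frame degenerates, the action is integral.

Indiscreteness. For all other parameters the group contains an elliptic f. If f has infinite order
in PGL₂, commutators with its powers accumulate at 1. If its order is finite, a power of f rotates
by the smallest possible angle 2π/d, and this violates an inequality of Jørgensen type: repeated
conjugation of f produces infinitely many elements converging to f (`accumulatesAtOne_of_angle`).
The arithmetic of which fractions escape yields the listed parameters.

Compactness. The invariant Hermitian form is definite for |θ| < 2π/3, which bounds its isometries.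
Beyond 2π/3 the element σ₁σ₂⁻¹ has real trace greater than 2, so its powers are unbounded.

The last item. A particular braid acts on the three-dimensional space as a rotation by φ, where 2
cos φ has a Galois conjugate greater than 2. Hence φ is not a rational multiple of 2π
(`cos_nat_mul_ne_one`), and powers of the braid accumulate at 1. -/

/-- The sequence `0, 1, q, q ^ 2 - 1, …` with `u (k + 2) = q * u (k + 1) - u k`; for `q = 2 cos φ`
its terms are `sin (k φ) / sin φ`. -/
def quantumInt (q : ℝ) : ℕ → ℝ
  | 0 => 0
  | 1 => 1
  | k + 2 => q * quantumInt q (k + 1) - quantumInt q k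

/-! ### Tits' positivity argument for reflection representations of Coxeter groups. -/

section Tits

variable {B : Type} [Fintype B] [DecidableEq B] (c : B → B → ℝ)

/-- The linear map that sends `v` to `v + (∑ j, c i j * v j) • e i`. -/
def cartanReflection (i : B) : Matrix B B ℝ :=
  Matrix.of fun k j => (1 : Matrix B B ℝ) k j + if k = i then c i j else 0

theorem cartanReflection_mulVec (i : B) (v : B → ℝ) :
    cartanReflection c i *ᵥ v = v + Pi.single i (∑ j, c i j * v j) := by
  ext k
  simp only [cartanReflection, Matrix.mulVec, dotProduct, Matrix.of_apply, add_mul,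
    Finset.sum_add_distrib, Pi.add_apply, Matrix.one_apply, ite_mul, one_mul, zero_mul,
    Finset.sum_ite_eq, Finset.mem_univ, if_true]
  by_cases h : k = i
  · subst h; simp
  · simp [h]

theorem cartanReflection_mulVec_single (i j : B) :
    cartanReflection c i *ᵥ Pi.single j 1 = Pi.single j 1 + c i j • Pi.single i 1 := by
  rw [cartanReflection_mulVec]
  congr 1
  ext k
  simp [Pi.single_apply]

variable {c}

theorem cartanReflection_mul_self (hc : ∀ i, c i i = -2) (i : B) :
    cartanReflection c i * cartanReflection c i = 1 := by
  refine Matrix.ext_of_mulVec_single fun j => ?_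
  rw [← Matrix.mulVec_mulVec, cartanReflection_mulVec_single, Matrix.mulVec_add,
    Matrix.mulVec_smul, cartanReflection_mulVec_single, cartanReflection_mulVec_single, hc,
    Matrix.one_mulVec]
  module

variable {M : CoxeterMatrix B} {W : Type} [Group W] (cs : CoxeterSystem M W)
  (π : W →* Matrix B B ℝ)

/-- The orbit of a simple root under a dihedral subgroup has consecutive terms of `quantumInt` as
coordinates, so positivity of roots in rank two becomes positivity of sines of multiples of an
angle. -/
theorem alternatingWord_mulVec (hπ : ∀ i, π (cs.simple i) = cartanReflection c i)
    (hc : ∀ i, c i i = -2) {i j : B} (hij : c i j = c j i) (k : ℕ) :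
    π (cs.wordProd (alternatingWord i j k)) *ᵥ Pi.single i 1 =
      if Even k then quantumInt (c i j) (k + 1) • Pi.single i 1 +
        quantumInt (c i j) k • Pi.single j 1
      else quantumInt (c i j) k • Pi.single i 1 +
        quantumInt (c i j) (k + 1) • Pi.single j 1 := by
  induction k with
  | zero => simp [alternatingWord, quantumInt, -Matrix.mulVec_single]
  | succ k ih =>
    rw [alternatingWord_succ', wordProd_cons, map_mul, ← Matrix.mulVec_mulVec, ih, hπ]
    by_cases h : Even k
    · have h' : ¬ Even (k + 1) := by simpa [Nat.even_add_one] using h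
      simp only [h, h', if_true, if_false, Matrix.mulVec_add, Matrix.mulVec_smul,
        cartanReflection_mulVec_single, hc, ← hij]
      rw [quantumInt]
      module
    · have h' : Even (k + 1) := by simpa [Nat.even_add_one] using h
      simp only [h, h', if_true, if_false, Matrix.mulVec_add, Matrix.mulVec_smul,
        cartanReflection_mulVec_single, hc]
      rw [quantumInt]
      module

theorem nonneg_of_length_lt (hπ : ∀ i, π (cs.simple i) = cartanReflection c i)
    (hc : ∀ i, c i i = -2) (hsymm : ∀ i j, c i j = c j i)
    (hpos : ∀ i j, i ≠ j → ∀ k, (M i j = 0 ∨ k ≤ M i j) → 0 ≤ quantumInt (c i j) k)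
    (n : ℕ) : ∀ (w : W) (i : B), cs.length w = n → cs.length w < cs.length (w * cs.simple i) →
      0 ≤ π w *ᵥ Pi.single i 1 := by
  induction n using Nat.strong_induction_on with
  | _ n ih =>
  intro w i hwn hlt
  by_cases hw : w = 1
  · subst hw
    simp only [map_one, Matrix.one_mulVec, Pi.single_nonneg]
    exact zero_le_one
  obtain ⟨j, hj⟩ := cs.exists_rightDescent_of_ne_one hw
  have hji : i ≠ j := by
    rintro rfl
    exact absurd hj (by unfold IsRightDescent; omega)
  -- Split off from the right end of `w` the longest alternating word in i and j that ends in j,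
  -- with lengths adding up. The remaining factor `v` is shorter than `w` and has neither i nor j as
  -- a right descent, so the induction hypothesis applies to both simple roots.
  let P : ℕ → Prop := fun k => ∃ v : W, w = v * cs.wordProd (alternatingWord i j k) ∧
    cs.length v + k = cs.length w
  have hP1 : P 1 := ⟨w * cs.simple j, by simp [alternatingWord, wordProd], by
    rcases cs.length_mul_simple w j with h | h
    · unfold IsRightDescent at hj; omega
    · omega⟩
  have hbd : ∀ k, P k → k ≤ cs.length w := by
    rintro k ⟨v, -, h⟩; omega
  classical
  obtain ⟨k, hk1, ⟨v, hv, hvl⟩, hmax⟩ : ∃ k, 1 ≤ k ∧ P k ∧ ¬ P (k + 1) := by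
    refine ⟨Nat.findGreatest P (cs.length w),
      Nat.le_findGreatest (hbd 1 hP1) hP1, Nat.findGreatest_spec (hbd 1 hP1) hP1, fun h => ?_⟩
    have := Nat.le_findGreatest (hbd _ h) h
    omega
  have hfront : cs.length v < cs.length (v * cs.simple (if Even k then j else i)) := by
    by_contra hcon
    have hd : cs.length (v * cs.simple (if Even k then j else i)) + 1 = cs.length v := by
      rcases cs.length_mul_simple v (if Even k then j else i) with h | h <;> omega
    refine hmax ⟨v * cs.simple (if Even k then j else i), ?_, by omega⟩
    rw [alternatingWord_succ', wordProd_cons, ← mul_assoc, simple_mul_simple_cancel_right]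
    exact hv
  have hback : cs.length v < cs.length (v * cs.simple (if Even k then i else j)) := by
    by_contra hcon
    have hd : cs.length (v * cs.simple (if Even k then i else j)) + 1 = cs.length v := by
      rcases cs.length_mul_simple v (if Even k then i else j) with h | h <;> omega
    obtain ⟨k, rfl⟩ : ∃ l, k = l + 1 := ⟨k - 1, by omega⟩
    have hx : (if Even (k + 1) then i else j) = (if Even k then j else i) := by
      by_cases h : Even k <;> simp [h, Nat.even_add_one]
    rw [hx] at hd
    rw [alternatingWord_succ', wordProd_cons, ← mul_assoc] at hv
    have h1 := cs.length_mul_le (v * cs.simple (if Even k then j else i))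
      (cs.wordProd (alternatingWord i j k))
    have h2 := cs.length_wordProd_le (alternatingWord i j k)
    rw [length_alternatingWord] at h2
    rw [← hv] at h1
    omega
  have hboth : 0 ≤ π v *ᵥ Pi.single i 1 ∧ 0 ≤ π v *ᵥ Pi.single j 1 := by
    have hvn : cs.length v < n := by omega
    by_cases h : Even k
    · simp only [h, if_true] at hfront hback
      exact ⟨ih _ hvn v i rfl hback, ih _ hvn v j rfl hfront⟩
    · simp only [h, if_false] at hfront hback
      exact ⟨ih _ hvn v i rfl hfront, ih _ hvn v j rfl hback⟩
  -- If the alternating word had length at least `M i j`, the braid relation would rewrite its tail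
  -- to end in i, making i a right descent of `w`.
  have hkm : M i j = 0 ∨ k + 1 ≤ M i j := by
    by_contra! hcon
    obtain ⟨hm0, hmk⟩ := hcon
    obtain ⟨m, hm⟩ : ∃ m, M i j = m + 1 := ⟨M i j - 1, by omega⟩
    have hsplit : ∀ l, ∃ ω : List B, alternatingWord i j (l + M i j) =
        ω ++ alternatingWord i j (M i j) ∧ ω.length = l := by
      intro l
      induction l with
      | zero => exact ⟨[], by simp, rfl⟩
      | succ l ihl =>
        obtain ⟨ω, h1, h2⟩ := ihl
        refine ⟨(if Even (l + M i j) then j else i) :: ω, ?_, by simp [h2]⟩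
        rw [show l + 1 + M i j = (l + M i j) + 1 by ring, alternatingWord_succ', h1,
          List.cons_append]
    obtain ⟨ω, hω, hωl⟩ := hsplit (k - M i j)
    rw [Nat.sub_add_cancel (by omega)] at hω
    have hbraid := cs.wordProd_braidWord_eq i j
    rw [braidWord, braidWord, M.symmetric j i, hm, alternatingWord_succ j i] at hbraid
    rw [hω, wordProd_append, hm, hbraid, wordProd_concat, ← mul_assoc, ← mul_assoc] at hv
    rw [show w * cs.simple i = v * cs.wordProd ω * cs.wordProd (alternatingWord i j m) by
      rw [hv, simple_mul_simple_cancel_right]] at hlt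
    have h1 := cs.length_mul_le (v * cs.wordProd ω) (cs.wordProd (alternatingWord i j m))
    have h2 := cs.length_mul_le v (cs.wordProd ω)
    have h3 := cs.length_wordProd_le ω
    have h4 := cs.length_wordProd_le (alternatingWord i j m)
    rw [length_alternatingWord] at h4
    omega
  have hS1 := hpos i j hji (k + 1) hkm
  have hS0 := hpos i j hji k (hkm.imp id (by omega))
  rw [hv, map_mul, ← Matrix.mulVec_mulVec, alternatingWord_mulVec cs π hπ hc (hsymm i j)]
  split_ifs
  · rw [Matrix.mulVec_add, Matrix.mulVec_smul, Matrix.mulVec_smul]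
    exact add_nonneg (smul_nonneg hS1 hboth.1) (smul_nonneg hS0 hboth.2)
  · rw [Matrix.mulVec_add, Matrix.mulVec_smul, Matrix.mulVec_smul]
    exact add_nonneg (smul_nonneg hS0 hboth.1) (smul_nonneg hS1 hboth.2)

/-- If `i` is a right descent of `w`, positivity applied to w sᵢ and sᵢ eᵢ = -eᵢ show that w eᵢ ≤ 0,
so the i-th diagonal entry is not positive. Thus an open condition on the matrix singles out the
identity; no faithfulness or definiteness enters. -/
theorem eq_one_of_diag_pos (hπ : ∀ i, π (cs.simple i) = cartanReflection c i)
    (hc : ∀ i, c i i = -2) (hsymm : ∀ i j, c i j = c j i)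
    (hpos : ∀ i j, i ≠ j → ∀ k, (M i j = 0 ∨ k ≤ M i j) → 0 ≤ quantumInt (c i j) k)
    (w : W) (hw : ∀ i, 0 < π w i i) : w = 1 := by
  by_contra hne
  obtain ⟨i, hi⟩ := cs.exists_rightDescent_of_ne_one hne
  have h := nonneg_of_length_lt cs π hπ hc hsymm hpos _ (w * cs.simple i) i rfl (by
    rw [simple_mul_simple_cancel_right]; exact hi) i
  rw [map_mul, ← Matrix.mulVec_mulVec, hπ, cartanReflection_mulVec_single, hc,
    Matrix.mulVec_add, Matrix.mulVec_smul] at h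
  simp at h
  linarith [hw i]

end Tits

end JonesBraid

namespace JonesBraid

/-! ### Dihedral relations and the triangle groups (2, 3, m). -/

open CoxeterSystem Polynomial
open scoped Matrix

theorem quantumInt_two_cos (φ : ℝ) (k : ℕ) :
    quantumInt (2 * Real.cos φ) k * Real.sin φ = Real.sin (k * φ) := by
  induction k using Nat.twoStepInduction with
  | zero => simp [quantumInt]
  | one => simp [quantumInt]
  | more k h0 h1 =>
    rw [quantumInt, sub_mul, mul_assoc, h1, h0]
    have e1 : ((k + 2 : ℕ) : ℝ) * φ = (k + 1 : ℕ) * φ + φ := by push_cast; ring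
    have e2 : (k : ℝ) * φ = (k + 1 : ℕ) * φ - φ := by push_cast; ring
    rw [e1, e2, Real.sin_add, Real.sin_sub]
    ring

theorem quantumInt_nonneg_of_two_le {q : ℝ} (hq : 2 ≤ q) (k : ℕ) : 0 ≤ quantumInt q k := by
  have h : 0 ≤ quantumInt q k ∧ quantumInt q k ≤ quantumInt q (k + 1) := by
    induction k with
    | zero => simp [quantumInt]
    | succ k ih =>
      refine ⟨ih.1.trans ih.2, ?_⟩
      rw [quantumInt]
      nlinarith
  exact h.1

/-- Modulo X² - eX + 1 the power X^(n+1) is linear, with coefficients from `quantumInt`. The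
polynomial (X - 1)(X + 1 - e) is 0 modulo X - 1 and e - 2 modulo X² - eX + 1, hence e - 2 times the
Chinese remainder idempotent. The cubic modulus is the characteristic polynomial of a rotation of
three-space. -/
theorem dvd_pow_succ_sub_one (e : ℝ) (n : ℕ) :
    (Polynomial.X - 1) * (Polynomial.X ^ 2 - C e * Polynomial.X + 1) ∣ C (e - 2) * (Polynomial.X ^ (n + 1) - 1) -
      (C (quantumInt e (n + 1)) * Polynomial.X - C (quantumInt e n + 1)) * ((Polynomial.X - 1) * (Polynomial.X + 1 - C e)) := by
  have h1 : (Polynomial.X ^ 2 - C e * Polynomial.X + 1) ∣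
      Polynomial.X ^ (n + 1) - (C (quantumInt e (n + 1)) * Polynomial.X - C (quantumInt e n)) := by
    induction n with
    | zero => simp [quantumInt]
    | succ n ih =>
      obtain ⟨r, hr⟩ := ih
      refine ⟨Polynomial.X * r + C (quantumInt e (n + 1)), ?_⟩
      rw [quantumInt]
      simp only [C_sub, C_mul] at hr ⊢
      linear_combination Polynomial.X * hr
  obtain ⟨r, hr⟩ := h1
  obtain ⟨r', hr'⟩ : (Polynomial.X - 1 : ℝ[X]) ∣ Polynomial.X ^ (n + 1) - 1 := sub_one_dvd_pow_sub_one _ _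
  refine ⟨(Polynomial.X + 1 - C e) * r - r', ?_⟩
  simp only [C_sub, C_add, map_one, map_ofNat]
  linear_combination (Polynomial.X - 1) * (Polynomial.X + 1 - C e) * hr - (Polynomial.X ^ 2 - C e * Polynomial.X + 1) * hr'

theorem smul_pow_succ_sub_one {A : Type} [Ring A] [Algebra ℝ A] {T : A} {e : ℝ}
    (hT : (T - 1) * (T ^ 2 - e • T + 1) = 0) (n : ℕ) :
    (e - 2) • (T ^ (n + 1) - 1) = (quantumInt e (n + 1) • T - (quantumInt e n + 1) • 1) *
      ((T - 1) * (T + 1 - e • 1)) := by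
  obtain ⟨r, hr⟩ := dvd_pow_succ_sub_one e n
  have h := congrArg (aeval T) hr
  simp only [map_sub, map_mul, map_add, map_pow, aeval_X, aeval_C, map_one,
    Algebra.algebraMap_eq_smul_one] at h
  simp only [smul_mul_assoc, one_mul, sub_smul, add_smul, one_smul] at h hT ⊢
  rw [hT, zero_mul, sub_eq_zero] at h
  convert h using 1
  rw [sub_mul, smul_mul_assoc, smul_mul_assoc, one_mul]

/-- For e = 2 cos(2π/m) the m-th term of `quantumInt` is 0 and the previous one is -1, so both
coefficients in the formula for T^m - 1 vanish. The bound m ≥ 3 keeps e - 2 and the sine nonzero. -/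
theorem pow_eq_one_of_cos {A : Type} [Ring A] [Algebra ℝ A] {T : A} {m : ℕ} (hm : 3 ≤ m)
    (hT : (T - 1) * (T ^ 2 - (2 * Real.cos (2 * Real.pi / m)) • T + 1) = 0) : T ^ m = 1 := by
  obtain ⟨n, rfl⟩ : ∃ n, m = n + 1 := ⟨m - 1, by omega⟩
  set φ := 2 * Real.pi / (n + 1 : ℕ) with hφ
  have hpi := Real.pi_pos
  have hm0 : (3 : ℝ) ≤ (n + 1 : ℕ) := by exact_mod_cast hm
  have hmφ : (n + 1 : ℕ) * φ = 2 * Real.pi := by rw [hφ]; field_simp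
  have hφ0 : 0 < φ := by positivity
  have hφpi : φ < Real.pi := by nlinarith
  have hs : Real.sin φ ≠ 0 := (Real.sin_pos_of_pos_of_lt_pi hφ0 hφpi).ne'
  have h1 : quantumInt (2 * Real.cos φ) (n + 1) = 0 := by
    have := quantumInt_two_cos φ (n + 1)
    rw [hmφ, Real.sin_two_pi] at this
    simpa [hs] using this
  have h2 : quantumInt (2 * Real.cos φ) n = -1 := by
    have := quantumInt_two_cos φ n
    rw [show (n : ℝ) * φ = 2 * Real.pi - φ by rw [← hmφ]; push_cast; ring,
      Real.sin_two_pi_sub] at this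
    exact mul_right_cancel₀ hs (by linarith)
  have h := smul_pow_succ_sub_one hT n
  rw [h1, h2] at h
  simp only [zero_smul, neg_add_cancel, sub_zero, zero_mul] at h
  have hc : 2 * Real.cos φ - 2 ≠ 0 := by
    have : Real.cos φ < 1 := by
      rw [← Real.cos_zero]
      exact Real.cos_lt_cos_of_nonneg_of_le_pi le_rfl hφpi.le hφ0
    linarith
  exact sub_eq_zero.1 ((smul_eq_zero.1 h).resolve_left hc)

/-- The negated double Gram matrix of the three unit normals of a triangle with two angles `π / 2`,
`π / 3` and a third angle of cosine `q / 2`. -/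
def triangleCartan (q : ℝ) : Fin 3 → Fin 3 → ℝ := ![![-2, 1, 0], ![1, -2, q], ![0, q, -2]]

/-- The group generated by the reflections in the sides of a triangle with two angles `π / 2`,
`π / 3` and a third angle of cosine `q / 2`, acting on the coordinates with respect to the
normals. -/
def triangleGroup (q : ℝ) : Submonoid (Matrix (Fin 3) (Fin 3) ℝ) :=
  Submonoid.closure (Set.range (cartanReflection (triangleCartan q)))

/-- The identity is isolated in a set of matrices. -/
def IsolatedOne (Γ : Set (Matrix (Fin 3) (Fin 3) ℝ)) : Prop :=
  ∃ ε > 0, ∀ w ∈ Γ, (∀ j k, |w j k - (1 : Matrix (Fin 3) (Fin 3) ℝ) j k| < ε) → w = 1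

theorem triangleCartan_self (q : ℝ) (i : Fin 3) : triangleCartan q i i = -2 := by
  fin_cases i <;> rfl

theorem triangleCartan_symm (q : ℝ) (i j : Fin 3) : triangleCartan q i j = triangleCartan q j i := by
  fin_cases i <;> fin_cases j <;> rfl

/-- The Coxeter matrix of the triangle group `(2, 3, m)`. -/
def triangleCoxeterMatrix (m : ℕ) (hm : m ≠ 1) : CoxeterMatrix (Fin 3) where
  M := !![1, 3, 2; 3, 1, m; 2, m, 1]
  isSymm := by ext i j; fin_cases i <;> fin_cases j <;> rfl
  diagonal i := by fin_cases i <;> rfl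
  off_diagonal i j h := by fin_cases i <;> fin_cases j <;> simp_all

theorem mul_pow_eq_one_swap {A : Type} [Monoid A] {a b : A} (ha : a * a = 1) {m : ℕ}
    (h : (a * b) ^ m = 1) : (b * a) ^ m = 1 := by
  have key : ∀ k, (b * a) ^ k = a * (a * b) ^ k * a := by
    intro k
    induction k with
    | zero => simp [ha]
    | succ k ih =>
      rw [pow_succ, ih, pow_succ]
      simp only [mul_assoc]
  rw [key, h, mul_one, ha]

theorem cartanReflection_triangle_zero (q : ℝ) :
    cartanReflection (triangleCartan q) 0 = !![-1, 1, 0; 0, 1, 0; 0, 0, 1] := by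
  ext i j; fin_cases i <;> fin_cases j <;> simp [cartanReflection, triangleCartan]
  all_goals norm_num

theorem cartanReflection_triangle_one (q : ℝ) :
    cartanReflection (triangleCartan q) 1 = !![1, 0, 0; 1, -1, q; 0, 0, 1] := by
  ext i j; fin_cases i <;> fin_cases j <;> simp [cartanReflection, triangleCartan]
  all_goals norm_num

theorem cartanReflection_triangle_two (q : ℝ) :
    cartanReflection (triangleCartan q) 2 = !![1, 0, 0; 0, 1, 0; 0, q, -1] := by
  ext i j; fin_cases i <;> fin_cases j <;> simp [cartanReflection, triangleCartan]
  all_goals norm_num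

/-- The product of the reflections 1 and 2 satisfies the cubic of a rotation by 2π/m. The value m =
0 encodes infinite order and imposes no relation. -/
theorem triangle_isLiftable {q : ℝ} {m : ℕ} (hm : m ≠ 1)
    (h : m = 0 ∨ (3 ≤ m ∧ q = 2 * Real.cos (Real.pi / m))) :
    (triangleCoxeterMatrix m hm).IsLiftable (cartanReflection (triangleCartan q)) := by
  have hsq := cartanReflection_mul_self (triangleCartan_self q)
  have h01 : (cartanReflection (triangleCartan q) 0 * cartanReflection (triangleCartan q) 1) ^ 3
      = 1 := by
    rw [cartanReflection_triangle_zero, cartanReflection_triangle_one, pow_three]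
    ext i j
    fin_cases i <;> fin_cases j <;>
      simp [Matrix.mul_apply, Fin.sum_univ_three]
  have h02 : (cartanReflection (triangleCartan q) 0 * cartanReflection (triangleCartan q) 2) ^ 2
      = 1 := by
    rw [cartanReflection_triangle_zero, cartanReflection_triangle_two, sq]
    ext i j
    fin_cases i <;> fin_cases j <;>
      simp [Matrix.mul_apply, Fin.sum_univ_three]
  have h12 : (cartanReflection (triangleCartan q) 1 * cartanReflection (triangleCartan q) 2) ^ m
      = 1 := by
    rcases h with rfl | ⟨hm3, rfl⟩
    · rfl
    · apply pow_eq_one_of_cos hm3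
      have : 2 * Real.cos (2 * Real.pi / m) = (2 * Real.cos (Real.pi / m)) ^ 2 - 2 := by
        rw [mul_div_assoc, Real.cos_two_mul]; ring
      rw [this, cartanReflection_triangle_one, cartanReflection_triangle_two]
      generalize 2 * Real.cos (Real.pi / m) = q
      ext i j
      fin_cases i <;> fin_cases j <;>
        simp [Matrix.mul_apply, Fin.sum_univ_three, sq, Matrix.one_apply] <;> ring
  intro i j
  fin_cases i <;> fin_cases j
  · exact (pow_one _).trans (hsq 0)
  · exact h01
  · exact h02
  · exact mul_pow_eq_one_swap (hsq 0) h01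
  · exact (pow_one _).trans (hsq 1)
  · exact h12
  · exact mul_pow_eq_one_swap (hsq 0) h02
  · exact mul_pow_eq_one_swap (hsq 1) h12
  · exact (pow_one _).trans (hsq 2)

theorem quantumInt_nonneg_of_le {m : ℕ} (hm : 2 ≤ m) {k : ℕ} (hk : k ≤ m) :
    0 ≤ quantumInt (2 * Real.cos (Real.pi / m)) k := by
  have hpi := Real.pi_pos
  have hm0 : (2 : ℝ) ≤ m := by exact_mod_cast hm
  have hk0 : (k : ℝ) ≤ m := by exact_mod_cast hk
  have h1 : 0 < Real.sin (Real.pi / m) :=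
    Real.sin_pos_of_pos_of_lt_pi (by positivity) (by rw [div_lt_iff₀ (by linarith)]; nlinarith)
  have h2 : 0 ≤ Real.sin (k * (Real.pi / m)) := by
    apply Real.sin_nonneg_of_nonneg_of_le_pi (by positivity)
    rw [mul_div_assoc', div_le_iff₀ (by linarith)]
    nlinarith
  rw [← quantumInt_two_cos] at h2
  exact nonneg_of_mul_nonneg_left h2 h1

/-- The radius 1 suffices, since a diagonal entry within distance 1 of 1 is positive. The case m =
0, q ≥ 2 is that of two sides without a common corner. -/
theorem isolatedOne_triangleGroup {q : ℝ} {m : ℕ}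
    (h : (m = 0 ∧ 2 ≤ q) ∨ (3 ≤ m ∧ q = 2 * Real.cos (Real.pi / m))) :
    IsolatedOne (triangleGroup q) := by
  have hm : m ≠ 1 := by omega
  have hlift := triangle_isLiftable (q := q) hm (h.imp And.left id)
  set M := triangleCoxeterMatrix m hm
  set cs := M.toCoxeterSystem
  set π := cs.lift ⟨_, hlift⟩
  have hπ : ∀ i, π (cs.simple i) = cartanReflection (triangleCartan q) i :=
    cs.lift_apply_simple hlift
  have h01 : ∀ k ≤ 3, 0 ≤ quantumInt 1 k := by
    intro k hk
    interval_cases k <;> norm_num [quantumInt]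
  have h02 : ∀ k ≤ 2, 0 ≤ quantumInt 0 k := by
    intro k hk
    interval_cases k <;> norm_num [quantumInt]
  have h12 : ∀ k, (m = 0 ∨ k ≤ m) → 0 ≤ quantumInt q k := by
    rintro k hk
    rcases h with ⟨rfl, hq⟩ | ⟨hm3, rfl⟩
    · exact quantumInt_nonneg_of_two_le hq k
    · exact quantumInt_nonneg_of_le (by omega) (by omega)
  have hle : triangleGroup q ≤ MonoidHom.mrange π := by
    rw [triangleGroup, Submonoid.closure_le]
    rintro _ ⟨i, rfl⟩
    exact ⟨_, hπ i⟩
  refine ⟨1, one_pos, fun w hw hw1 => ?_⟩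
  obtain ⟨g, rfl⟩ := hle hw
  rw [eq_one_of_diag_pos cs π hπ (triangleCartan_self q) (triangleCartan_symm q) ?_ g ?_, map_one]
  · intro i j hij k hk
    fin_cases i <;> fin_cases j
    · exact absurd rfl hij
    · exact h01 k (hk.resolve_left (by simp [M, triangleCoxeterMatrix]))
    · exact h02 k (hk.resolve_left (by simp [M, triangleCoxeterMatrix]))
    · exact h01 k (hk.resolve_left (by simp [M, triangleCoxeterMatrix]))
    · exact absurd rfl hij
    · exact h12 k hk
    · exact h02 k (hk.resolve_left (by simp [M, triangleCoxeterMatrix]))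
    · exact h12 k hk
    · exact absurd rfl hij
  · intro i
    have := hw1 i i
    rw [Matrix.one_apply_eq, abs_lt] at this
    linarith

/-! ### The finite triangle group (2, 3, 5/2). -/

section Finite

/-- The elements `a + b ψ` with `ψ = 2 cos (2π/5)` are represented by pairs of integers. The roots
of the triangle group `(2, 3, 5/2)`. -/
def pentagramRoots : List (ℤ × ℤ × ℤ × ℤ × ℤ × ℤ) :=
  [(-1, 0, -1, 0, 0, -1), (-1, 0, -1, 0, 0, 0), (-1, 0, -1, 1, 0, -1), (-1, 0, -1, 1, 1, -1),
    (-1, 0, 0, 0, 0, 0), (0, -1, 0, -2, -1, 1), (0, -1, 0, -1, -1, 0), (0, -1, 0, -1, 0, 1),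
    (0, -1, 1, -1, -1, 1), (0, -1, 1, -1, 0, 1), (0, 0, -1, 0, 0, -1), (0, 0, -1, 0, 0, 0),
    (0, 0, 0, -1, -1, 0), (0, 0, 0, -1, 0, 1), (0, 0, 0, 0, -1, 0), (0, 0, 0, 0, 1, 0),
    (0, 0, 0, 1, 0, -1), (0, 0, 0, 1, 1, 0), (0, 0, 1, 0, 0, 0), (0, 0, 1, 0, 0, 1),
    (0, 1, -1, 1, 0, -1), (0, 1, -1, 1, 1, -1), (0, 1, 0, 1, 0, -1), (0, 1, 0, 1, 1, 0),
    (0, 1, 0, 2, 1, -1), (1, 0, 0, 0, 0, 0), (1, 0, 1, -1, -1, 1), (1, 0, 1, -1, 0, 1),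
    (1, 0, 1, 0, 0, 0), (1, 0, 1, 0, 0, 1)]

/-- The three reflections of the triangle group `(2, 3, 5/2)` in integral coordinates. -/
def pentagramReflection (i : Fin 3) : ℤ × ℤ × ℤ × ℤ × ℤ × ℤ → ℤ × ℤ × ℤ × ℤ × ℤ × ℤ :=
  fun (a, a', b, b', c, c') => match i with
    | 0 => (b - a, b' - a', b, b', c, c')
    | 1 => (a, a', a - b + c', a' - b' + c - c', c, c')
    | 2 => (a, a', b, b', b' - c, b - b' - c')

/-- The vector over `ℝ` with given integral coordinates. -/
def pentagramVec (q : ℝ) : ℤ × ℤ × ℤ × ℤ × ℤ × ℤ → Fin 3 → ℝ :=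
  fun (a, a', b, b', c, c') => ![a + a' * q, b + b' * q, c + c' * q]

theorem pentagramReflection_mem :
    ∀ v ∈ pentagramRoots, ∀ i, pentagramReflection i v ∈ pentagramRoots := by
  decide +kernel

theorem cartanReflection_mulVec_pentagramVec {q : ℝ} (hq : q ^ 2 = 1 - q) (i : Fin 3)
    (v : ℤ × ℤ × ℤ × ℤ × ℤ × ℤ) : cartanReflection (triangleCartan q) i *ᵥ pentagramVec q v =
      pentagramVec q (pentagramReflection i v) := by
  obtain ⟨a, a', b, b', c, c'⟩ := v
  fin_cases i <;> ext j <;> fin_cases j <;>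
    simp [cartanReflection_triangle_zero, cartanReflection_triangle_one,
      cartanReflection_triangle_two, pentagramVec, pentagramReflection, Matrix.mulVec, dotProduct,
      Fin.sum_univ_three] <;> grind

theorem isolatedOne_of_finite {Γ : Set (Matrix (Fin 3) (Fin 3) ℝ)} {T : Set ℝ} (hT : T.Finite)
    (h : ∀ w ∈ Γ, ∀ j k, w j k ∈ T) : IsolatedOne Γ := by
  have key : ∀ y : ℝ, ∃ ε > 0, ∀ x ∈ T, |x - y| < ε → x = y := by
    intro y
    have hcl : IsOpen (T \ {y})ᶜ := (hT.subset Set.sdiff_subset).isClosed.isOpen_compl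
    obtain ⟨ε, hε, hb⟩ := Metric.isOpen_iff.1 hcl y (by simp)
    refine ⟨ε, hε, fun x hx hxy => ?_⟩
    by_contra hne
    exact hb (by simpa [Real.dist_eq] using hxy) ⟨hx, hne⟩
  obtain ⟨ε₀, h₀, H₀⟩ := key 0
  obtain ⟨ε₁, h₁, H₁⟩ := key 1
  refine ⟨min ε₀ ε₁, lt_min h₀ h₁, fun w hw hw1 => ?_⟩
  ext j k
  have := hw1 j k
  rw [Matrix.one_apply] at this ⊢
  split_ifs at this ⊢
  · exact H₁ _ (h w hw j k) (this.trans_le (min_le_right _ _))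
  · exact H₀ _ (h w hw j k) (this.trans_le (min_le_left _ _))

/-- Here q = 2 cos(2π/5) is too small for Tits' argument. Instead the group permutes thirty roots,
among them the basis vectors (a Galois conjugate of the icosahedral root system), so matrix entries
take finitely many values. -/
theorem isolatedOne_triangleGroup_pentagram :
    IsolatedOne (triangleGroup (2 * Real.cos (2 * Real.pi / 5))) := by
  have hq : (2 * Real.cos (2 * Real.pi / 5)) ^ 2 = 1 - 2 * Real.cos (2 * Real.pi / 5) := by
    have h := Real.cos_pi_div_five
    rw [mul_div_assoc, Real.cos_two_mul, h]
    have h5 : √5 ^ 2 = (5 : ℝ) := Real.sq_sqrt (by norm_num)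
    grind
  generalize 2 * Real.cos (2 * Real.pi / 5) = q at hq
  have hst : ∀ w ∈ triangleGroup q, ∀ v ∈ pentagramRoots, ∃ v' ∈ pentagramRoots,
      w *ᵥ pentagramVec q v = pentagramVec q v' := by
    intro w hw
    induction hw using Submonoid.closure_induction with
    | mem x hx =>
      obtain ⟨i, rfl⟩ := hx
      exact fun v hv => ⟨_, pentagramReflection_mem v hv i,
        cartanReflection_mulVec_pentagramVec hq i v⟩
    | one => exact fun v hv => ⟨v, hv, Matrix.one_mulVec _⟩
    | mul x y _ _ hx hy =>
      intro v hv
      obtain ⟨v', hv', h'⟩ := hy v hv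
      obtain ⟨v'', hv'', h''⟩ := hx v' hv'
      exact ⟨v'', hv'', by rw [← Matrix.mulVec_mulVec, h', h'']⟩
  have hbasis : ∀ k : Fin 3, ∃ v ∈ pentagramRoots, pentagramVec q v = Pi.single k 1 := by
    intro k
    fin_cases k
    · exact ⟨(1, 0, 0, 0, 0, 0), by decide, by
        ext j; fin_cases j <;> simp [pentagramVec]⟩
    · exact ⟨(0, 0, 1, 0, 0, 0), by decide, by
        ext j; fin_cases j <;> simp [pentagramVec]⟩
    · exact ⟨(0, 0, 0, 0, 1, 0), by decide, by
        ext j; fin_cases j <;> simp [pentagramVec]⟩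
  refine isolatedOne_of_finite (T := (fun p : (ℤ × ℤ × ℤ × ℤ × ℤ × ℤ) × Fin 3 =>
    pentagramVec q p.1 p.2) '' ({v | v ∈ pentagramRoots} ×ˢ Set.univ))
    (((List.finite_toSet _).prod Set.finite_univ).image _) fun w hw j k => ?_
  obtain ⟨v, hv, hvk⟩ := hbasis k
  obtain ⟨v', hv', h'⟩ := hst w hw v hv
  refine ⟨(v', j), ⟨hv', trivial⟩, ?_⟩
  rw [hvk] at h'
  simp [← h']

end Finite

end JonesBraid

noncomputable section

namespace JonesBraid

open scoped Matrix MatrixGroups Topology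
open Matrix Filter

/-! ### Discreteness in PGL expressed by matrices. -/

section Topology

variable {F V ι : Type} [Field F] [AddCommGroup V] [Module F V] [Fintype ι] [DecidableEq ι]

/-- Invertible matrices as automorphisms of a space with a basis. -/
def glEquiv (b : Module.Basis ι F V) : GL ι F ≃* LinearMap.GeneralLinearGroup F V :=
  Units.mapEquiv (Matrix.toLinAlgEquiv b).toMulEquiv

theorem glEquiv_val (b : Module.Basis ι F V) (g : GL ι F) :
    (glEquiv b g : Module.End F V) = Matrix.toLin b b g.1 := rfl

/-- The projective automorphism of a space with a basis that is given by a matrix. -/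
def matrixToPGL (b : Module.Basis ι F V) : GL ι F →* PGL F V :=
  (toPGL F V).comp (glEquiv b).toMonoidHom

theorem mem_center_of_mulEquiv {G H : Type} [Group G] [Group H] (e : G ≃* H) (g : G) :
    e g ∈ Subgroup.center H ↔ g ∈ Subgroup.center G := by
  simp only [Subgroup.mem_center_iff]
  constructor
  · intro h k
    apply e.injective
    rw [map_mul, map_mul, h]
  · intro h k
    obtain ⟨k, rfl⟩ := e.surjective k
    rw [← map_mul, ← map_mul, h]

theorem matrixToPGL_eq_one_iff (b : Module.Basis ι F V) (g : GL ι F) :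
    matrixToPGL b g = 1 ↔ g ∈ Subgroup.center (GL ι F) := by
  rw [← mem_center_of_mulEquiv (glEquiv b)]
  exact QuotientGroup.eq_one_iff _

theorem matrixToPGL_surjective (b : Module.Basis ι F V) : Function.Surjective (matrixToPGL b) :=
  (QuotientGroup.mk'_surjective _).comp (glEquiv b).surjective

variable [TopologicalSpace F] [IsTopologicalRing F]

theorem continuous_matrixToPGL (b : Module.Basis ι F V) : Continuous (matrixToPGL b) := by
  let _ : TopologicalSpace (Module.End F V) := moduleTopology F (Module.End F V)
  have : IsModuleTopology F (Module.End F V) := ⟨rfl⟩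
  have : IsModuleTopology F (Matrix ι ι F) := inferInstanceAs (IsModuleTopology F (ι → ι → F))
  have := IsModuleTopology.toContinuousAdd F (Module.End F V)
  have h1 : Continuous (Matrix.toLinAlgEquiv b) :=
    IsModuleTopology.continuous_of_linearMap (Matrix.toLinAlgEquiv b).toLinearMap
  have h2 : Continuous (glEquiv b) :=
    Continuous.units_map (Matrix.toLinAlgEquiv b).toMulEquiv.toMonoidHom h1
  refine ⟨fun U hU => ?_⟩
  have h3 := (isOpen_coinduced.1 hU).preimage h2
  exact h3

/-- The saturation of an open set is the union of its translates by scalar matrices, hence open. -/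
theorem isOpenMap_matrixToPGL (b : Module.Basis ι F V) : IsOpenMap (matrixToPGL b) := by
  let _ : TopologicalSpace (Module.End F V) := moduleTopology F (Module.End F V)
  have : IsModuleTopology F (Module.End F V) := ⟨rfl⟩
  have : IsModuleTopology F (Matrix ι ι F) := inferInstanceAs (IsModuleTopology F (ι → ι → F))
  have h1 : Continuous (Matrix.toLinAlgEquiv b).symm :=
    IsModuleTopology.continuous_of_linearMap (Matrix.toLinAlgEquiv b).symm.toLinearMap
  have h2 : Continuous (glEquiv b).symm :=
    Continuous.units_map (Matrix.toLinAlgEquiv b).symm.toMulEquiv.toMonoidHom h1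
  intro U hU
  have h3 : IsOpen (⋃ z ∈ Subgroup.center (GL ι F), (fun g => g * z) ⁻¹' U) :=
    isOpen_biUnion fun z _ => hU.preimage (continuous_mul_const z)
  have h4 : (QuotientGroup.mk : (Module.End F V)ˣ → (Module.End F V)ˣ ⧸ Subgroup.center
      (LinearMap.GeneralLinearGroup F V)) ⁻¹' (matrixToPGL b '' U) = (glEquiv b).symm ⁻¹'
      (⋃ z ∈ Subgroup.center (GL ι F), (fun g => g * z) ⁻¹' U) := by
    ext g
    obtain ⟨g, rfl⟩ := (glEquiv b).surjective g
    simp only [Set.mem_preimage, MulEquiv.symm_apply_apply, Set.mem_iUnion,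
      exists_prop]
    constructor
    · rintro ⟨u, hu, h⟩
      refine ⟨g⁻¹ * u, ?_, by simpa using hu⟩
      rw [← matrixToPGL_eq_one_iff b, map_mul, map_inv, inv_mul_eq_one]
      exact h.symm
    · rintro ⟨z, hz, h⟩
      refine ⟨_, h, ?_⟩
      rw [map_mul, (matrixToPGL_eq_one_iff b z).2 hz, mul_one]
      rfl
  exact isOpen_coinduced.2 (by
    have := h3.preimage h2
    rw [← h4] at this
    exact this)

/-- A group of matrices acts discretely on the projective space. -/
def ActsDiscretely (Γ : Subgroup (GL ι F)) : Prop :=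
  ∃ U ∈ 𝓝 (1 : GL ι F), ∀ g ∈ U, ∀ γ ∈ Γ, ∀ z ∈ Subgroup.center (GL ι F), g = γ * z →
    γ ∈ Subgroup.center (GL ι F)

/-- A group of matrices contains nonscalar unimodular matrices close to the identity. -/
def AccumulatesAtOne (Γ : Subgroup (GL ι F)) : Prop :=
  ∃ h : ℕ → GL ι F, (∀ n, h n ∈ Γ ∧ (h n).1.det = 1 ∧ h n ∉ Subgroup.center (GL ι F)) ∧
    Tendsto (fun n => (h n).1) atTop (𝓝 1)

theorem discreteTopology_of_actsDiscretely (b : Module.Basis ι F V) {Γ : Subgroup (GL ι F)}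
    (h : ActsDiscretely Γ) : DiscreteTopology (Γ.map (matrixToPGL b)) := by
  obtain ⟨U, hU, H⟩ := h
  obtain ⟨O, hOU, hO, h1⟩ := mem_nhds_iff.1 hU
  rw [discreteTopology_iff_isOpen_singleton]
  rintro ⟨_, γ₀, hγ₀, rfl⟩
  refine isOpen_induced_iff.2 ⟨matrixToPGL b '' ((fun g => γ₀⁻¹ * g) ⁻¹' O),
    isOpenMap_matrixToPGL b _ (hO.preimage (continuous_const_mul _)), ?_⟩
  ext ⟨_, γ, hγ, rfl⟩
  simp only [Set.mem_preimage, Set.mem_image, Set.mem_singleton_iff]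
  constructor
  · rintro ⟨g, hg, hgγ⟩
    have hz : g⁻¹ * γ ∈ Subgroup.center (GL ι F) := by
      rw [← matrixToPGL_eq_one_iff b, map_mul, map_inv, hgγ, inv_mul_cancel]
    have := H _ (hOU hg) (γ₀⁻¹ * γ) (Γ.mul_mem (Γ.inv_mem hγ₀) hγ) _ (Subgroup.inv_mem _ hz)
      (by group)
    rw [← matrixToPGL_eq_one_iff b, map_mul, map_inv, inv_mul_eq_one] at this
    exact Subtype.ext this.symm
  · intro h
    exact ⟨γ₀, by simpa using h1, (congrArg Subtype.val h).symm⟩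

/-- The topology of units also controls inverses. In determinant one the inverse is the adjugate, so
convergence of entries is enough; this is why `AccumulatesAtOne` asks for determinant one. -/
theorem tendsto_of_val_of_det {h : ℕ → GL ι F} (hdet : ∀ n, (h n).1.det = 1)
    (hlim : Tendsto (fun n => (h n).1) atTop (𝓝 1)) : Tendsto h atTop (𝓝 1) := by
  let s : ℕ → SpecialLinearGroup ι F := fun n => ⟨(h n).1, hdet n⟩
  have hs : Tendsto s atTop (𝓝 1) := tendsto_subtype_rng.2 hlim
  have := (SpecialLinearGroup.continuous_toGL (n := ι) (R := F)).continuousAt.tendsto.comp hs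
  rw [map_one] at this
  refine this.congr fun n => ?_
  ext i j
  rfl

theorem not_discreteTopology_of_accumulatesAtOne (b : Module.Basis ι F V) {Γ : Subgroup (GL ι F)}
    (h : AccumulatesAtOne Γ) : ¬ DiscreteTopology (Γ.map (matrixToPGL b)) := by
  obtain ⟨h, hΓ, hlim⟩ := h
  intro hd
  have h1 := tendsto_of_val_of_det (fun n => (hΓ n).2.1) hlim
  have h2 := (continuous_matrixToPGL b).continuousAt.tendsto.comp h1
  rw [map_one] at h2
  let s : ℕ → Γ.map (matrixToPGL b) := fun n => ⟨matrixToPGL b (h n), _, (hΓ n).1, rfl⟩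
  have hs : Tendsto s atTop (𝓝 1) := tendsto_subtype_rng.2 h2
  rw [nhds_discrete, tendsto_pure] at hs
  obtain ⟨n, hn⟩ := hs.exists
  exact (hΓ n).2.2 ((matrixToPGL_eq_one_iff b _).1 (congrArg Subtype.val hn))

end Topology

/-! ### Matrices of the Jones representation in the basis of matchings. -/

section Model

variable {F : Type} [Field F] {n c k : ℕ} {t : F} (e : Fin k ≃ PlanarMatching n c)

theorem radical_eq_bot (h : ((gram n c t).submatrix e e).det ≠ 0) : radical n c t = ⊥ := by
  rw [Matrix.det_submatrix_equiv_self] at h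
  rw [radical, LinearMap.ker_eq_bot']
  intro w hw
  exact Matrix.eq_zero_of_mulVec_eq_zero h (by rwa [Matrix.toLin'_apply] at hw)

/-- The basis of the reduced skein space given by an enumeration of the matchings, if the bilinear
form is nondegenerate. -/
def skeinBasis (hrad : radical n c t = ⊥) : Module.Basis (Fin k) F (X n c t) :=
  ((Pi.basisFun F _).reindex e.symm).map (Submodule.quotEquivOfEqBot _ hrad).symm

theorem skeinBasis_apply (hrad : radical n c t = ⊥) (i : Fin k) :
    skeinBasis e hrad i = (radical n c t).mkQ (Pi.single (e i) 1) := by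
  simp [skeinBasis]

theorem toLin_skeinBasis_mkQ (hrad : radical n c t = ⊥)
    (N : Matrix (PlanarMatching n c) (PlanarMatching n c) F) (w : W F n c) :
    Matrix.toLin (skeinBasis e hrad) (skeinBasis e hrad) (N.submatrix e e)
      ((radical n c t).mkQ w) = (radical n c t).mkQ (Matrix.toLin' N w) := by
  suffices h : Matrix.toLin (skeinBasis e hrad) (skeinBasis e hrad) (N.submatrix e e) ∘ₗ
      (radical n c t).mkQ = (radical n c t).mkQ ∘ₗ Matrix.toLin' N from LinearMap.congr_fun h w
  refine (Pi.basisFun F (PlanarMatching n c)).ext fun p => ?_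
  obtain ⟨i, rfl⟩ := e.surjective p
  have h1 : Matrix.toLin' N (Pi.single (e i) 1) = ∑ j, N (e j) (e i) • Pi.single (e j) (1 : F) := by
    ext p
    obtain ⟨l, rfl⟩ := e.surjective p
    simp [Finset.sum_apply, Pi.single_apply]
  simp only [LinearMap.comp_apply, Pi.basisFun_apply]
  rw [← skeinBasis_apply e hrad, Matrix.toLin_self, h1, map_sum]
  refine Finset.sum_congr rfl fun j _ => ?_
  rw [map_smul, skeinBasis_apply, Matrix.submatrix_apply]

variable {G : Type} [Group G]

theorem braidRelator_lift (T : Fin (n - 1) → G)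
    (hbraid : ∀ i j : Fin (n - 1), i.val + 1 = j.val → T i * T j * T i = T j * T i * T j)
    (hcomm : ∀ i j : Fin (n - 1), i.val + 2 ≤ j.val → T i * T j = T j * T i)
    (r : FreeGroup (Fin (n - 1))) (hr : r ∈ {w | BraidRelator n w}) :
    FreeGroup.lift T r = 1 := by
  rcases hr with ⟨i, j, h⟩ | ⟨i, j, h⟩
  · simpa only [map_mul, map_inv, FreeGroup.lift_apply_of, mul_inv_eq_one] using hbraid i j h
  · simpa only [map_mul, map_inv, FreeGroup.lift_apply_of, mul_inv_eq_one] using hcomm i j h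

/-- The homomorphism from the braid group given by elements that satisfy Artin's relations. -/
def braidLift (T : Fin (n - 1) → G)
    (hbraid : ∀ i j : Fin (n - 1), i.val + 1 = j.val → T i * T j * T i = T j * T i * T j)
    (hcomm : ∀ i j : Fin (n - 1), i.val + 2 ≤ j.val → T i * T j = T j * T i) :
    BraidGroup n →* G := PresentedGroup.toGroup (braidRelator_lift T hbraid hcomm)

theorem braidLift_gen (T : Fin (n - 1) → G)
    (hbraid : ∀ i j : Fin (n - 1), i.val + 1 = j.val → T i * T j * T i = T j * T i * T j)
    (hcomm : ∀ i j : Fin (n - 1), i.val + 2 ≤ j.val → T i * T j = T j * T i)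
    (i : Fin (n - 1)) : braidLift T hbraid hcomm (BraidGroup.gen i) = T i :=
  PresentedGroup.toGroup.of _

theorem braidLift_range (T : Fin (n - 1) → G)
    (hbraid : ∀ i j : Fin (n - 1), i.val + 1 = j.val → T i * T j * T i = T j * T i * T j)
    (hcomm : ∀ i j : Fin (n - 1), i.val + 2 ≤ j.val → T i * T j = T j * T i) :
    (braidLift T hbraid hcomm).range = Subgroup.closure (Set.range T) := by
  rw [MonoidHom.range_eq_map, ← PresentedGroup.closure_range_of, MonoidHom.map_closure,
    ← Set.range_comp]
  congr 2
  ext i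
  exact braidLift_gen T hbraid hcomm i

theorem exists_isJonesRep (hrad : radical n c t = ⊥) (T : Fin (n - 1) → GL (Fin k) F)
    (hT : ∀ i, (T i).1 = (-(1 + cupCap n c t i)).submatrix e e)
    (hbraid : ∀ i j : Fin (n - 1), i.val + 1 = j.val → T i * T j * T i = T j * T i * T j)
    (hcomm : ∀ i j : Fin (n - 1), i.val + 2 ≤ j.val → T i * T j = T j * T i) :
    ∃ ρ : BraidGroup n →* LinearMap.GeneralLinearGroup F (X n c t), IsJonesRep ρ ∧
      projImage ρ = (Subgroup.closure (Set.range T)).map (matrixToPGL (skeinBasis e hrad)) := by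
  refine ⟨(glEquiv (skeinBasis e hrad)).toMonoidHom.comp (braidLift T hbraid hcomm), ?_, ?_⟩
  · intro i w
    rw [MonoidHom.comp_apply, braidLift_gen]
    change Matrix.toLin _ _ (T i).1 _ = _
    rw [hT, toLin_skeinBasis_mkQ]
    rfl
  · rw [← braidLift_range T hbraid hcomm, ← MonoidHom.range_comp]
    rfl

end Model

/-! ### Counting the components of two glued matchings. -/

section Glue

/-- `r` chooses a representative in every component of the glueing of `p` and `q`, at distance at
most two. -/
abbrev IsGlueLabel {n : ℕ} (p q r : Fin n → Fin n) : Prop :=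
  (∀ i, r (p i) = r i ∧ r (q i) = r i) ∧
    ∀ i, r i = i ∨ r i = p i ∨ r i = q i ∨ r i = p (q i) ∨ r i = q (p i)

variable {n : ℕ} {p q r : Fin n → Fin n}

theorem glue_reachable_left (i : Fin n) : (glue p q).Reachable i (p i) := by
  by_cases h : i = p i
  · rw [← h]
  · exact SimpleGraph.Adj.reachable (by simp [glue, h])

theorem glue_reachable_right (i : Fin n) : (glue p q).Reachable i (q i) := by
  by_cases h : i = q i
  · rw [← h]
  · exact SimpleGraph.Adj.reachable (by simp [glue, h])

theorem IsGlueLabel.reachable (h : IsGlueLabel p q r) (i : Fin n) :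
    (glue p q).Reachable i (r i) := by
  rcases h.2 i with h | h | h | h | h <;> rw [h]
  · exact glue_reachable_left i
  · exact glue_reachable_right i
  · exact (glue_reachable_right i).trans (glue_reachable_left _)
  · exact (glue_reachable_left i).trans (glue_reachable_right _)

theorem IsGlueLabel.reachable_iff (h : IsGlueLabel p q r) (i j : Fin n) :
    (glue p q).Reachable i j ↔ r i = r j := by
  constructor
  · rintro ⟨w⟩
    induction w with
    | nil => rfl
    | cons hadj _ ih =>
      rw [← ih]
      rw [glue, SimpleGraph.fromRel_adj] at hadj
      rcases hadj.2 with (rfl | rfl) | (rfl | rfl)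
      · exact (h.1 _).1.symm
      · exact (h.1 _).2.symm
      · exact (h.1 _).1
      · exact (h.1 _).2
  · intro hr
    exact (h.reachable i).trans (hr ▸ (h.reachable j).symm)

theorem IsGlueLabel.noTurnback_iff (h : IsGlueLabel p q r) : NoTurnback p q ↔
    ∀ i j, r i = r j → ((p i = i ∧ p j = j) ∨ (q i = i ∧ q j = j)) → i = j := by
  simp only [NoTurnback, h.reachable_iff]

/-- A labelling is idempotent and its fixed points correspond to the components, which turns a count
of components into a finite decidable one. -/
theorem IsGlueLabel.closedLoops_eq (h : IsGlueLabel p q r) : closedLoops p q =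
    (Finset.univ.filter fun x => r x = x ∧ ∀ i, r i = x → p i ≠ i ∧ q i ≠ i).card := by
  rw [closedLoops, ← Fintype.card_subtype, ← Nat.card_eq_fintype_card]
  have hidem : ∀ i, r (r i) = r i := fun i => ((h.reachable_iff _ _).1 (h.reachable i)).symm
  symm
  refine Nat.card_congr (Equiv.ofBijective
    (fun x => ⟨(glue p q).connectedComponentMk x.1, fun i hi => x.2.2 i ?_⟩) ⟨?_, ?_⟩)
  · rw [SimpleGraph.ConnectedComponent.eq, h.reachable_iff, x.2.1] at hi
    exact hi
  · rintro ⟨x, hx, _⟩ ⟨y, hy, _⟩ hxy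
    rw [Subtype.mk.injEq, SimpleGraph.ConnectedComponent.eq, h.reachable_iff, hx, hy] at hxy
    exact Subtype.ext hxy
  · rintro ⟨C, hC⟩
    obtain ⟨i, rfl⟩ := C.exists_rep
    have hi : (glue p q).connectedComponentMk (r i) = (glue p q).connectedComponentMk i :=
      SimpleGraph.ConnectedComponent.eq.2 (h.reachable i).symm
    refine ⟨⟨r i, hidem i, fun j hj => hC j ?_⟩, Subtype.ext hi⟩
    exact SimpleGraph.ConnectedComponent.eq.2 ((h.reachable_iff _ _).2 (by rw [hj]))

end Glue

/-! ### Gram matrices and cup-cap operators on three and four strands. -/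

section Enumeration

/-- The two matchings of three points with one strand to the right. -/
def matching31 : Fin 2 ≃ PlanarMatching 3 1 :=
  Equiv.ofBijective ![⟨![1, 0, 2], by decide⟩, ⟨![0, 2, 1], by decide⟩] (by
    constructor
    · decide
    · decide +kernel)

/-- The two matchings of four points without a strand to the right. -/
def matching40 : Fin 2 ≃ PlanarMatching 4 0 :=
  Equiv.ofBijective ![⟨![1, 0, 3, 2], by decide⟩, ⟨![3, 2, 1, 0], by decide⟩] (by
    constructor
    · decide
    · decide +kernel)

/-- The three matchings of four points with two strands to the right. -/
def matching42 : Fin 3 ≃ PlanarMatching 4 2 :=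
  Equiv.ofBijective ![⟨![1, 0, 2, 3], by decide⟩, ⟨![0, 2, 1, 3], by decide⟩,
    ⟨![0, 1, 3, 2], by decide⟩] (by
    constructor
    · decide
    · decide +kernel)

end Enumeration

theorem gram_apply_of_label {F : Type} [Field F] {n c : ℕ} (t : F) (p q : PlanarMatching n c)
    {r : Fin n → Fin n} (h : IsGlueLabel p.1 q.1 r)
    (hN : ∀ i j, r i = r j → ((p.1 i = i ∧ p.1 j = j) ∨ (q.1 i = i ∧ q.1 j = j)) → i = j)
    {d e : ℕ}
    (hd : (Finset.univ.filter fun x => r x = x ∧ ∀ i, r i = x → p.1 i ≠ i ∧ q.1 i ≠ i).card = d)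
    (he : (blackParity p.1 + blackParity q.1 + (n - c) / 2 - d) / 2 = e) :
    gram n c t p q = (-1) ^ c * (∑ k ∈ Finset.range (c + 1), t ^ k) * (-(1 + t)) ^ d * t ^ e := by
  rw [gram, Matrix.of_apply, if_pos (h.noTurnback_iff.2 hN), h.closedLoops_eq, hd, he]

theorem gram_apply_eq_zero {F : Type} [Field F] {n c : ℕ} (t : F) (p q : PlanarMatching n c)
    {r : Fin n → Fin n} (h : IsGlueLabel p.1 q.1 r)
    (hN : ¬ ∀ i j, r i = r j → ((p.1 i = i ∧ p.1 j = j) ∨ (q.1 i = i ∧ q.1 j = j)) → i = j) :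
    gram n c t p q = 0 := by
  rw [gram, Matrix.of_apply, if_neg (mt h.noTurnback_iff.1 hN)]

/-- The Gram matrix of the two-dimensional skein spaces. -/
def gram2 {F : Type} [Field F] (t : F) : Matrix (Fin 2) (Fin 2) F :=
  !![(1 + t) ^ 2, -(1 + t) * t; -(1 + t) * t, (1 + t) ^ 2 * t]

/-- The two cup-cap operators on the two-dimensional skein spaces. -/
def cupCap2 {F : Type} [Field F] (t : F) : Fin 2 → Matrix (Fin 2) (Fin 2) F :=
  ![!![-(1 + t), t; 0, 0], !![0, 0; 1, -(1 + t)]]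

theorem blackParity_matching31 (i : Fin 2) : blackParity (matching31 i).1 = i := by
  fin_cases i <;> decide

theorem blackParity_matching40 (i : Fin 2) : blackParity (matching40 i).1 = i := by
  fin_cases i <;> decide

theorem gram_matching31 {F : Type} [Field F] (t : F) :
    (gram 3 1 t).submatrix matching31 matching31 = gram2 t := by
  ext i j
  fin_cases i <;> fin_cases j
  · exact (gram_apply_of_label t (matching31 0) (matching31 0) (r := ![0, 0, 2]) (d := 1) (e := 0)
      (by decide) (by decide) (by decide) (by decide)).trans (by
        simp [gram2, Finset.sum_range_succ]; ring)
  · exact (gram_apply_of_label t (matching31 0) (matching31 1) (r := ![1, 1, 1]) (d := 0) (e := 1)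
      (by decide) (by decide) (by decide) (by decide)).trans (by
        simp [gram2, Finset.sum_range_succ])
  · exact (gram_apply_of_label t (matching31 1) (matching31 0) (r := ![1, 1, 1]) (d := 0) (e := 1)
      (by decide) (by decide) (by decide) (by decide)).trans (by
        simp [gram2, Finset.sum_range_succ])
  · exact (gram_apply_of_label t (matching31 1) (matching31 1) (r := ![0, 1, 1]) (d := 1) (e := 1)
      (by decide) (by decide) (by decide) (by decide)).trans (by
        simp [gram2, Finset.sum_range_succ]; grind)

theorem gram_matching40 {F : Type} [Field F] (t : F) :
    (gram 4 0 t).submatrix matching40 matching40 = gram2 t := by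
  ext i j
  fin_cases i <;> fin_cases j
  · exact (gram_apply_of_label t (matching40 0) (matching40 0) (r := ![0, 0, 2, 2]) (d := 2)
      (e := 0) (by decide) (by decide) (by decide) (by decide)).trans (by
        simp [gram2]; ring)
  · exact (gram_apply_of_label t (matching40 0) (matching40 1) (r := ![0, 0, 0, 0]) (d := 1)
      (e := 1) (by decide) (by decide) (by decide) (by decide)).trans (by
        simp [gram2])
  · exact (gram_apply_of_label t (matching40 1) (matching40 0) (r := ![0, 0, 0, 0]) (d := 1)
      (e := 1) (by decide) (by decide) (by decide) (by decide)).trans (by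
        simp [gram2])
  · exact (gram_apply_of_label t (matching40 1) (matching40 1) (r := ![0, 1, 1, 0]) (d := 2)
      (e := 1) (by decide) (by decide) (by decide) (by decide)).trans (by
        simp [gram2]; grind)

/-- The Gram matrix of the three-dimensional skein space. -/
def gram3 {F : Type} [Field F] (t : F) : Matrix (Fin 3) (Fin 3) F :=
  (1 + t + t ^ 2) • !![-(1 + t), t, 0; t, -(1 + t) * t, t; 0, t, -(1 + t)]

theorem gram_matching42 {F : Type} [Field F] (t : F) :
    (gram 4 2 t).submatrix matching42 matching42 = gram3 t := by
  ext i j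
  fin_cases i <;> fin_cases j
  · exact (gram_apply_of_label t (matching42 0) (matching42 0) (r := ![0, 0, 2, 3]) (d := 1)
      (e := 0) (by decide) (by decide) (by decide) (by decide)).trans (by
        simp [gram3, Finset.sum_range_succ])
  · exact (gram_apply_of_label t (matching42 0) (matching42 1) (r := ![1, 1, 1, 3]) (d := 0)
      (e := 1) (by decide) (by decide) (by decide) (by decide)).trans (by
        simp [gram3, Finset.sum_range_succ])
  · exact (gram_apply_eq_zero t (matching42 0) (matching42 2) (r := ![0, 0, 2, 2])
      (by decide) (by decide)).trans (by simp [gram3])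
  · exact (gram_apply_of_label t (matching42 1) (matching42 0) (r := ![1, 1, 1, 3]) (d := 0)
      (e := 1) (by decide) (by decide) (by decide) (by decide)).trans (by
        simp [gram3, Finset.sum_range_succ])
  · exact (gram_apply_of_label t (matching42 1) (matching42 1) (r := ![0, 1, 1, 3]) (d := 1)
      (e := 1) (by decide) (by decide) (by decide) (by decide)).trans (by
        simp [gram3, Finset.sum_range_succ]; ring)
  · exact (gram_apply_of_label t (matching42 1) (matching42 2) (r := ![0, 2, 2, 2]) (d := 0)
      (e := 1) (by decide) (by decide) (by decide) (by decide)).trans (by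
        simp [gram3, Finset.sum_range_succ])
  · exact (gram_apply_eq_zero t (matching42 2) (matching42 0) (r := ![0, 0, 2, 2])
      (by decide) (by decide)).trans (by simp [gram3])
  · exact (gram_apply_of_label t (matching42 2) (matching42 1) (r := ![0, 2, 2, 2]) (d := 0)
      (e := 1) (by decide) (by decide) (by decide) (by decide)).trans (by
        simp [gram3, Finset.sum_range_succ])
  · exact (gram_apply_of_label t (matching42 2) (matching42 2) (r := ![0, 1, 2, 2]) (d := 1)
      (e := 0) (by decide) (by decide) (by decide) (by decide)).trans (by
        simp [gram3, Finset.sum_range_succ])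

section CupCap

/-- The index of the entry of `cupCap` in the list `0, -(1 + t), 1, t`. -/
def cupCapIndex {n c : ℕ} (i : Fin (n - 1)) (q p : PlanarMatching n c) : Fin 4 :=
  if p.1 (upper i) = lower i then (if q = p then 1 else 0)
  else if p.1 (upper i) = upper i ∧ p.1 (lower i) = lower i then 0
  else if q.1 = reconnect p.1 (upper i) (lower i) then (if blackParity p.1 = 1 then 3 else 2)
  else 0

theorem cupCap_apply {F : Type} [Field F] {n c : ℕ} (t : F) (i : Fin (n - 1))
    (q p : PlanarMatching n c) :
    cupCap n c t i q p = ![0, -(1 + t), 1, t] (cupCapIndex i q p) := by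
  rw [cupCap, Matrix.of_apply, cupCapIndex]
  split_ifs <;> rfl

/-- Recording only which of four values an entry takes separates the combinatorics, which is decided
by evaluation, from the arbitrary field. -/
theorem cupCap_submatrix {F : Type} [Field F] {n c k : ℕ} (t : F) (e : Fin k ≃ PlanarMatching n c)
    (i : Fin (n - 1)) {D : Fin k → Fin k → Fin 4} (h : ∀ j l, cupCapIndex i (e j) (e l) = D j l) :
    (cupCap n c t i).submatrix e e = Matrix.of fun j l => ![0, -(1 + t), 1, t] (D j l) := by
  ext j l
  rw [Matrix.submatrix_apply, cupCap_apply, h, Matrix.of_apply]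

theorem cupCap_matching31 {F : Type} [Field F] (t : F) (i : Fin 2) :
    (cupCap 3 1 t i).submatrix matching31 matching31 = cupCap2 t i := by
  fin_cases i
  · refine (cupCap_submatrix t matching31 (0 : Fin 2) (D := ![![1, 3], ![0, 0]])
      (by decide)).trans ?_
    ext j l
    fin_cases j <;> fin_cases l <;> rfl
  · refine (cupCap_submatrix t matching31 (1 : Fin 2) (D := ![![0, 0], ![2, 1]])
      (by decide)).trans ?_
    ext j l
    fin_cases j <;> fin_cases l <;> rfl

theorem cupCap_matching40 {F : Type} [Field F] (t : F) (i : Fin 3) :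
    (cupCap 4 0 t i).submatrix matching40 matching40 = ![cupCap2 t 0, cupCap2 t 1, cupCap2 t 0] i := by
  fin_cases i
  · refine (cupCap_submatrix t matching40 (0 : Fin 3) (D := ![![1, 3], ![0, 0]])
      (by decide)).trans ?_
    ext j l
    fin_cases j <;> fin_cases l <;> rfl
  · refine (cupCap_submatrix t matching40 (1 : Fin 3) (D := ![![0, 0], ![2, 1]])
      (by decide)).trans ?_
    ext j l
    fin_cases j <;> fin_cases l <;> rfl
  · refine (cupCap_submatrix t matching40 (2 : Fin 3) (D := ![![1, 3], ![0, 0]])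
      (by decide)).trans ?_
    ext j l
    fin_cases j <;> fin_cases l <;> rfl

/-- The three cup-cap operators on the three-dimensional skein space. -/
def cupCap3 {F : Type} [Field F] (t : F) : Fin 3 → Matrix (Fin 3) (Fin 3) F :=
  ![!![-(1 + t), t, 0; 0, 0, 0; 0, 0, 0], !![0, 0, 0; 1, -(1 + t), 1; 0, 0, 0],
    !![0, 0, 0; 0, 0, 0; 0, t, -(1 + t)]]

theorem cupCap_matching42 {F : Type} [Field F] (t : F) (i : Fin 3) :
    (cupCap 4 2 t i).submatrix matching42 matching42 = cupCap3 t i := by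
  fin_cases i
  · refine (cupCap_submatrix t matching42 (0 : Fin 3) (D := ![![1, 3, 0], ![0, 0, 0], ![0, 0, 0]])
      (by decide)).trans ?_
    ext j l
    fin_cases j <;> fin_cases l <;> rfl
  · refine (cupCap_submatrix t matching42 (1 : Fin 3) (D := ![![0, 0, 0], ![2, 1, 2], ![0, 0, 0]])
      (by decide)).trans ?_
    ext j l
    fin_cases j <;> fin_cases l <;> rfl
  · refine (cupCap_submatrix t matching42 (2 : Fin 3) (D := ![![0, 0, 0], ![0, 0, 0], ![0, 3, 1]])
      (by decide)).trans ?_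
    ext j l
    fin_cases j <;> fin_cases l <;> rfl

end CupCap

/-! ### The reduced Burau representation and its two skein models. -/

section Burau

variable {F : Type} [Field F] {t : F}

/-- The matrices of the reduced Burau representation of `B_3`. -/
def burau (ht : t ≠ 0) : Fin 2 → GL (Fin 2) F :=
  ![GeneralLinearGroup.mkOfDetNeZero !![t, -t; 0, -1] (by simpa [det_fin_two]),
    GeneralLinearGroup.mkOfDetNeZero !![-1, 0; -1, t] (by simpa [det_fin_two])]

theorem burau_zero_val (ht : t ≠ 0) : (burau ht 0).1 = !![t, -t; 0, -1] := rfl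

theorem burau_one_val (ht : t ≠ 0) : (burau ht 1).1 = !![-1, 0; -1, t] := rfl

theorem burau_val (ht : t ≠ 0) (i : Fin 2) : (burau ht i).1 = -(1 + cupCap2 t i) := by
  fin_cases i
  · ext j k; fin_cases j <;> fin_cases k <;> simp [burau_zero_val, cupCap2]
  · ext j k; fin_cases j <;> fin_cases k <;> simp [burau_one_val, cupCap2]

theorem burau_braid (ht : t ≠ 0) :
    burau ht 0 * burau ht 1 * burau ht 0 = burau ht 1 * burau ht 0 * burau ht 1 := by
  apply Units.ext
  simp only [Units.val_mul, burau_zero_val, burau_one_val]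
  ext j k; fin_cases j <;> fin_cases k <;> simp

/-- The image of the reduced Burau representation of `B_3`. -/
def burauGroup (ht : t ≠ 0) : Subgroup (GL (Fin 2) F) := Subgroup.closure (Set.range (burau ht))

theorem burau_mem (ht : t ≠ 0) (i : Fin 2) : burau ht i ∈ burauGroup ht :=
  Subgroup.subset_closure ⟨i, rfl⟩

end Burau

/-- An identification of a skein space with the space of the reduced Burau representation of
`B_3`. -/
structure BurauModel (n c : ℕ) where
  /-- The enumeration of the matchings. -/
  e : Fin 2 ≃ PlanarMatching n c
  /-- The strand exchange of `B_3` that corresponds to a generator of `B_n`. -/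
  s : Fin (n - 1) → Fin 2
  parity : ∀ i, blackParity (e i).1 = i
  gram_eq : ∀ {F : Type} [Field F] (t : F), (gram n c t).submatrix e e = gram2 t
  cupCap_eq : ∀ {F : Type} [Field F] (t : F) (i : Fin (n - 1)),
    (cupCap n c t i).submatrix e e = cupCap2 t (s i)
  surj : Function.Surjective s
  braid : ∀ i j : Fin (n - 1), i.val + 1 = j.val → s i ≠ s j
  comm : ∀ i j : Fin (n - 1), i.val + 2 ≤ j.val → s i = s j

/-- The identification for three strands. -/
def burauModel31 : BurauModel 3 1 where
  e := matching31
  s := id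
  parity := blackParity_matching31
  gram_eq := gram_matching31
  cupCap_eq := cupCap_matching31
  surj := Function.surjective_id
  braid := by decide
  comm := by decide

/-- The identification for four strands. -/
def burauModel40 : BurauModel 4 0 where
  e := matching40
  s := ![0, 1, 0]
  parity := blackParity_matching40
  gram_eq := gram_matching40
  cupCap_eq t i := (cupCap_matching40 t i).trans (by
    have : i = (0 : Fin 3) ∨ i = (1 : Fin 3) ∨ i = (2 : Fin 3) := by revert i; decide
    rcases this with rfl | rfl | rfl <;> rfl)
  surj := by decide
  braid := by decide
  comm := by decide

theorem nonempty_burauModel {n c : ℕ} (h : (n = 3 ∧ c = 1) ∨ (n = 4 ∧ c = 0)) :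
    Nonempty (BurauModel n c) := by
  rcases h with ⟨rfl, rfl⟩ | ⟨rfl, rfl⟩
  · exact ⟨burauModel31⟩
  · exact ⟨burauModel40⟩

namespace BurauModel

variable {F : Type} [Field F] {t : F} {n c : ℕ}

/-- The Gram determinant is (1 + t)² t (t² + t + 1). Its zeros on the unit circle are -1 and the
primitive cube roots of unity, which is why |θ| = 2π/3 is excluded. -/
theorem radical_eq_bot (m : BurauModel n c) (ht : t ≠ 0) (h1 : 1 + t ≠ 0) (hD : t ^ 2 + t + 1 ≠ 0) :
    radical n c t = ⊥ := by
  apply JonesBraid.radical_eq_bot m.e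
  rw [m.gram_eq, gram2, det_fin_two_of]
  have : (1 + t) ^ 2 * ((1 + t) ^ 2 * t) - -(1 + t) * t * (-(1 + t) * t) =
      (1 + t) ^ 2 * t * (t ^ 2 + t + 1) := by ring
  rw [this]
  exact mul_ne_zero (mul_ne_zero (pow_ne_zero _ h1) ht) hD

theorem finrank_eq (m : BurauModel n c) (hrad : radical n c t = ⊥) : Module.finrank F (X n c t) = 2 := by
  rw [Module.finrank_eq_card_basis (skeinBasis m.e hrad), Fintype.card_fin]

theorem exists_rep (m : BurauModel n c) (ht : t ≠ 0) (hrad : radical n c t = ⊥) :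
    ∃ ρ : BraidGroup n →* LinearMap.GeneralLinearGroup F (X n c t), IsJonesRep ρ ∧
      projImage ρ = (burauGroup ht).map (matrixToPGL (skeinBasis m.e hrad)) := by
  have hb : ∀ i j : Fin 2, i ≠ j → burau ht i * burau ht j * burau ht i =
      burau ht j * burau ht i * burau ht j := by
    intro i j hij
    fin_cases i <;> fin_cases j
    · exact absurd rfl hij
    · exact burau_braid ht
    · exact (burau_braid ht).symm
    · exact absurd rfl hij
  obtain ⟨ρ, hρ, him⟩ := exists_isJonesRep m.e hrad (fun i => burau ht (m.s i))
    (fun i => by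
      rw [burau_val, ← m.cupCap_eq]
      ext j k
      simp [Matrix.one_apply])
    (fun i j h => hb _ _ (m.braid i j h)) (fun i j h => by rw [m.comm i j h])
  refine ⟨ρ, hρ, ?_⟩
  rw [him, burauGroup]
  congr 2
  exact m.surj.range_comp _

end BurauModel

/-! ### The adjoint action on traceless matrices. -/

section Adjoint

variable {F : Type} [RCLike F]

/-- The coordinates of a traceless matrix. -/
def tracelessCoord (M : Matrix (Fin 2) (Fin 2) F) : Fin 3 → F := ![M 0 0, M 0 1, M 1 0]

/-- The matrix whose columns are the coordinates of three traceless matrices. -/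
def tracelessMatrix (N : Fin 3 → Matrix (Fin 2) (Fin 2) F) : Matrix (Fin 3) (Fin 3) F :=
  Matrix.of fun r k => tracelessCoord (N k) r

/-- Up to the factor `s`, conjugation by `g` acts on the span of the matrices `N k` by the real
matrix `w`. -/
def AdjointRel (N : Fin 3 → Matrix (Fin 2) (Fin 2) F) (g : Matrix (Fin 2) (Fin 2) F)
    (w : Matrix (Fin 3) (Fin 3) ℝ) (s : F) : Prop :=
  ∀ k, g * N k = (s • ∑ j, (w j k : F) • N j) * g

variable {N : Fin 3 → Matrix (Fin 2) (Fin 2) F} {g g' : Matrix (Fin 2) (Fin 2) F}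
  {w w' : Matrix (Fin 3) (Fin 3) ℝ} {s s' : F}

theorem AdjointRel.sum (h : AdjointRel N g w s) (v : Fin 3 → F) :
    g * (∑ k, v k • N k) = (s • ∑ j, (∑ k, (w j k : F) * v k) • N j) * g := by
  rw [Finset.mul_sum]
  simp_rw [mul_smul_comm, h _, ← smul_mul_assoc]
  rw [← Finset.sum_mul]
  congr 1
  simp_rw [Finset.smul_sum, Finset.sum_smul, Finset.smul_sum]
  rw [Finset.sum_comm]
  refine Finset.sum_congr rfl fun j _ => Finset.sum_congr rfl fun k _ => ?_
  simp only [smul_smul]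
  congr 1
  ring

theorem AdjointRel.mul (h : AdjointRel N g w s) (h' : AdjointRel N g' w' s') :
    AdjointRel N (g * g') (w * w') (s * s') := by
  intro k
  have h1 : ∑ j, (∑ l, (w j l : F) * (w' l k : F)) • N j = ∑ j, ((w * w') j k : F) • N j := by
    refine Finset.sum_congr rfl fun j _ => ?_
    rw [Matrix.mul_apply]
    push_cast
    rfl
  rw [mul_assoc, h' k, ← mul_assoc, mul_smul_comm, h.sum, h1, ← smul_mul_assoc,
    smul_smul, mul_comm s' s, mul_assoc]

theorem AdjointRel.smul (h : AdjointRel N g w s) (a : F) : AdjointRel N (a • g) w s := by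
  intro k
  rw [smul_mul_assoc, h k, mul_smul_comm]

theorem AdjointRel.one : AdjointRel N 1 1 1 := fun k => by simp [Matrix.one_apply]

theorem AdjointRel.inv {g : GL (Fin 2) F} (h : AdjointRel N g.1 w s) (hw : w * w' = 1) (hs : s * s' = 1) :
    AdjointRel N g⁻¹.1 w' s' := by
  intro k
  have h1 := h.sum (fun j => (w' j k : F))
  have h2 : ∀ j, ∑ l, (w j l : F) * (w' l k : F) = (1 : Matrix (Fin 3) (Fin 3) F) j k := by
    intro j
    have := congrFun (congrFun hw j) k
    rw [Matrix.mul_apply] at this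
    rw [Matrix.one_apply] at this ⊢
    have h3 := congrArg (fun x : ℝ => (x : F)) this
    push_cast at h3
    rw [h3]
    split_ifs <;> simp
  simp_rw [h2] at h1
  have h4 : ∑ j, (1 : Matrix (Fin 3) (Fin 3) F) j k • N j = N k := by
    simp [Matrix.one_apply]
  rw [h4] at h1
  have h5 : g.1 * (s' • ∑ j, (w' j k : F) • N j) = N k * g.1 := by
    rw [mul_smul_comm, h1, smul_mul_assoc, smul_smul, mul_comm s' s, hs, one_smul]
  calc g⁻¹.1 * N k = g⁻¹.1 * (N k * g.1) * g⁻¹.1 := by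
        rw [mul_assoc, mul_assoc, Units.mul_inv, mul_one]
    _ = _ := by rw [← h5, ← mul_assoc, Units.inv_mul, one_mul]

theorem tracelessCoord_sum (v : Fin 3 → F) :
    tracelessCoord (∑ k, v k • N k) = tracelessMatrix N *ᵥ v := by
  ext r
  fin_cases r <;>
    simp [tracelessCoord, tracelessMatrix, Matrix.mulVec, dotProduct, Fin.sum_univ_three,
      Matrix.add_apply] <;> ring

theorem eq_sum_of_traceless (hN : ∀ k, N k 1 1 = -N k 0 0) (hZ : (tracelessMatrix N).det ≠ 0)
    {M : Matrix (Fin 2) (Fin 2) F} (hM : M 1 1 = -M 0 0) :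
    M = ∑ k, ((tracelessMatrix N)⁻¹ *ᵥ tracelessCoord M) k • N k := by
  have h := tracelessCoord_sum (N := N) ((tracelessMatrix N)⁻¹ *ᵥ tracelessCoord M)
  rw [Matrix.mulVec_mulVec, Matrix.mul_nonsing_inv _ (Ne.isUnit hZ), Matrix.one_mulVec] at h
  generalize (tracelessMatrix N)⁻¹ *ᵥ tracelessCoord M = v at h ⊢
  have h0 := congrFun h 0
  have h1 := congrFun h 1
  have h2 := congrFun h 2
  simp only [tracelessCoord] at h0 h1 h2
  ext i j
  fin_cases i <;> fin_cases j
  · exact h0.symm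
  · exact h1.symm
  · exact h2.symm
  · change M 1 1 = _
    rw [hM]
    simp only [Matrix.cons_val_zero] at h0
    rw [← h0]
    simp [Fin.sum_univ_three, Matrix.add_apply, hN]
    ring

/-- The `N k` span the traceless matrices, and commuting with the two off-diagonal matrix units
already forces a scalar. -/
theorem mem_center_of_commute {g : GL (Fin 2) F} (hN : ∀ k, N k 1 1 = -N k 0 0) (hZ : (tracelessMatrix N).det ≠ 0)
    (h : ∀ k, g.1 * N k = N k * g.1) : g ∈ Subgroup.center (GL (Fin 2) F) := by
  have key : ∀ M : Matrix (Fin 2) (Fin 2) F, M 1 1 = -M 0 0 → g.1 * M = M * g.1 := by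
    intro M hM
    rw [eq_sum_of_traceless hN hZ hM, Finset.mul_sum, Finset.sum_mul]
    refine Finset.sum_congr rfl fun k _ => ?_
    rw [mul_smul_comm, h, smul_mul_assoc]
  have h1 := key !![0, 1; 0, 0] (by simp)
  have h2 := key !![0, 0; 1, 0] (by simp)
  have a := congrFun (congrFun h1 0) 0
  have b := congrFun (congrFun h1 0) 1
  have c := congrFun (congrFun h2 0) 0
  simp [Matrix.mul_apply, Fin.sum_univ_two] at a b c
  refine GeneralLinearGroup.mem_center_iff_val_mem_range_scalar.2 ⟨g.1 0 0, ?_⟩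
  ext i j
  fin_cases i <;> fin_cases j
  · rfl
  · exact c.symm
  · exact a
  · exact b

/-- The group of all matrices that act by conjugation on the span of the matrices `N k` as an
element of `Γ`, up to a factor given by `χ`. -/
def adjointSubgroup (N : Fin 3 → Matrix (Fin 2) (Fin 2) F)
    {Γ : Submonoid (Matrix (Fin 3) (Fin 3) ℝ)} (hinv : ∀ w ∈ Γ, ∃ w' ∈ Γ, w * w' = 1)
    (χ : GL (Fin 2) F →* F) : Subgroup (GL (Fin 2) F) where
  carrier := {g | ∃ w ∈ Γ, AdjointRel N g.1 w (χ g)}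
  one_mem' := ⟨1, Γ.one_mem, by rw [map_one]; exact AdjointRel.one⟩
  mul_mem' := by
    rintro x y ⟨w, hw, h⟩ ⟨w', hw', h'⟩
    exact ⟨w * w', Γ.mul_mem hw hw', by rw [map_mul]; exact h.mul h'⟩
  inv_mem' := by
    rintro x ⟨w, hw, h⟩
    obtain ⟨w', hw', h'⟩ := hinv w hw
    exact ⟨w', hw', h.inv h' (by rw [← map_mul, mul_inv_cancel, map_one])⟩

/-- The coordinates of g Nₖ g⁻¹ depend continuously on g and ignore scalar factors. For an element
that is near 1 up to a scalar, the factor `χ` is 1 and the real matrix `w` is near 1. By isolation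
`w` is 1, so the element commutes with every `N k` and is scalar. -/
theorem actsDiscretely_of_le_adjointSubgroup (hN : ∀ k, N k 1 1 = -N k 0 0)
    (hZ : (tracelessMatrix N).det ≠ 0) {χ : GL (Fin 2) F →* F}
    (hχ : ∀ᶠ g in 𝓝 1, χ g = 1) (hχz : ∀ z ∈ Subgroup.center (GL (Fin 2) F), χ z = 1)
    {Γ : Submonoid (Matrix (Fin 3) (Fin 3) ℝ)} (hinv : ∀ w ∈ Γ, ∃ w' ∈ Γ, w * w' = 1)
    (hΓ : IsolatedOne Γ) {K : Subgroup (GL (Fin 2) F)} (hK : K ≤ adjointSubgroup N hinv χ) :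
    ActsDiscretely K := by
  obtain ⟨ε, hε, hiso⟩ := hΓ
  let f : Fin 3 → Fin 3 → GL (Fin 2) F → F := fun j k g =>
    ((tracelessMatrix N)⁻¹ *ᵥ tracelessCoord (g.1 * N k * g⁻¹.1)) j
  have hf : ∀ j k, Continuous (f j k) := by
    intro j k
    have h1 : Continuous fun g : GL (Fin 2) F => g.1 * N k * g⁻¹.1 :=
      (Units.continuous_val.mul continuous_const).mul (Units.continuous_val.comp continuous_inv)
    have h2 : Continuous (tracelessCoord : Matrix (Fin 2) (Fin 2) F → Fin 3 → F) := by
      refine continuous_pi fun r => ?_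
      fin_cases r
      · exact continuous_id.matrix_elem 0 0
      · exact continuous_id.matrix_elem 0 1
      · exact continuous_id.matrix_elem 1 0
    exact (continuous_apply j).comp ((continuous_const.matrix_mulVec continuous_id).comp
      (h2.comp h1))
  have hfrel : ∀ (g : GL (Fin 2) F) w s, AdjointRel N g.1 w s → ∀ j k, f j k g = s * (w j k : F) := by
    intro g w s h j k
    have h1 : g.1 * N k * g⁻¹.1 = ∑ j, (s * (w j k : F)) • N j := by
      rw [h k, mul_assoc, Units.mul_inv, mul_one, Finset.smul_sum]
      simp_rw [smul_smul]
    simp only [f]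
    rw [h1, tracelessCoord_sum, Matrix.mulVec_mulVec, Matrix.nonsing_inv_mul _ (Ne.isUnit hZ),
      Matrix.one_mulVec]
  have hf1 : ∀ j k, f j k 1 = (1 : Matrix (Fin 3) (Fin 3) F) j k := by
    intro j k
    rw [hfrel 1 1 1 AdjointRel.one]
    simp [Matrix.one_apply]
  refine ⟨_, hχ.and (eventually_all.2 fun j => eventually_all.2 fun k =>
    (hf j k).continuousAt.eventually (Metric.ball_mem_nhds _ hε)), ?_⟩
  rintro g ⟨hg, hgf⟩ γ hγ z hz rfl
  rw [map_mul, hχz z hz, mul_one] at hg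
  obtain ⟨w, hw, h⟩ := hK hγ
  have hfz : ∀ j k, f j k (γ * z) = f j k γ := by
    intro j k
    obtain ⟨a, ha⟩ := GeneralLinearGroup.mem_center_iff_val_mem_range_scalar.1 hz
    have h1 : z.1 * N k = N k * z.1 := by
      rw [← ha]
      exact Matrix.scalar_commute _ (fun r => Commute.all _ _) _
    have h2 : (γ * z).1 * N k * (γ * z)⁻¹.1 = γ.1 * N k * γ⁻¹.1 := by
      rw [_root_.mul_inv_rev, Units.val_mul, Units.val_mul, mul_assoc γ.1, h1]
      simp only [mul_assoc]
      rw [← mul_assoc z.1, Units.mul_inv, one_mul]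
    simp only [f]
    rw [h2]
  have hw1 : w = 1 := by
    refine hiso w hw fun j k => ?_
    have h1 := hgf j k
    rw [hf1, hfz, hfrel γ w _ h, hg, one_mul, dist_eq_norm] at h1
    have h2 : ((w j k - (1 : Matrix (Fin 3) (Fin 3) ℝ) j k : ℝ) : F) =
        (w j k : F) - (1 : Matrix (Fin 3) (Fin 3) F) j k := by
      push_cast
      rw [Matrix.one_apply, Matrix.one_apply]
      split_ifs <;> simp
    rw [← RCLike.norm_ofReal (K := F), h2]
    exact h1
  subst hw1
  refine mem_center_of_commute hN hZ fun k => ?_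
  rw [h k, hg, one_smul]
  simp [Matrix.one_apply]

end Adjoint

theorem exists_mul_eq_one_of_mem_closure {ι A : Type} [Monoid A] {r : ι → A}
    (hr : ∀ i, r i * r i = 1) : ∀ w ∈ Submonoid.closure (Set.range r),
      ∃ w' ∈ Submonoid.closure (Set.range r), w * w' = 1 := by
  intro w hw
  induction hw using Submonoid.closure_induction with
  | mem x hx =>
    obtain ⟨i, rfl⟩ := hx
    exact ⟨r i, Submonoid.subset_closure ⟨i, rfl⟩, hr i⟩
  | one => exact ⟨1, Submonoid.one_mem _, one_mul 1⟩
  | mul x y _ _ hx hy =>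
    obtain ⟨x', hx', h⟩ := hx
    obtain ⟨y', hy', h'⟩ := hy
    exact ⟨y' * x', Submonoid.mul_mem _ hy' hx', by
      rw [mul_assoc, ← mul_assoc y, h', one_mul, h]⟩

theorem exists_mul_eq_one_of_mem_triangleGroup (q : ℝ) :
    ∀ w ∈ triangleGroup q, ∃ w' ∈ triangleGroup q, w * w' = 1 :=
  exists_mul_eq_one_of_mem_closure (cartanReflection_mul_self (triangleCartan_self q))

theorem cartanReflection_mem_triangleGroup (q : ℝ) (i : Fin 3) :
    cartanReflection (triangleCartan q) i ∈ triangleGroup q := Submonoid.subset_closure ⟨i, rfl⟩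

/-! ### Braid generators as products of reflections of a triangle. -/

section Clifford

variable {F : Type} [RCLike F]

/-- This is the Clifford relation: Nᵢ² is scalar, and moving Nᵢ past Nₖ costs a sign and a scalar,
so conjugation by Nᵢ is minus a reflection. -/
theorem adjointRel_cartanReflection {N : Fin 3 → Matrix (Fin 2) (Fin 2) F}
    {c : Fin 3 → Fin 3 → ℝ} {d : F} {i : Fin 3} (hc : c i i = -2)
    (h : ∀ k, N i * N k + N k * N i = -((c i k : F) * d) • (1 : Matrix (Fin 2) (Fin 2) F)) :
    AdjointRel N (N i) (cartanReflection c i) (-1) := by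
  have hsq : N i * N i = d • (1 : Matrix (Fin 2) (Fin 2) F) := by
    have h2 := h i
    rw [hc, ← two_smul F, show -((((-2 : ℝ) : F)) * d) = 2 * d by push_cast; ring, mul_smul] at h2
    exact (smul_right_injective _ (two_ne_zero (α := F))) h2
  intro k
  have h1 : ∑ j, (cartanReflection c i j k : F) • N j = N k + (c i k : F) • N i := by
    have : ∀ j, (cartanReflection c i j k : F) • N j =
        (if j = k then N j else 0) + (if j = i then (c i k : F) • N j else 0) := by
      intro j
      simp only [cartanReflection, Matrix.of_apply, Matrix.one_apply]
      split_ifs <;> simp [add_smul]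
    simp_rw [this, Finset.sum_add_distrib]
    simp
  rw [h1, neg_smul, one_smul, neg_mul, add_mul, smul_mul_assoc, hsq, smul_smul,
    eq_sub_of_add_eq (h k), neg_smul]
  abel

variable {t : F}

theorem burau_zero_mul_one_val (ht : t ≠ 0) :
    (burau ht 0 * burau ht 1).1 = !![0, -t ^ 2; 1, -t] := by
  rw [Units.val_mul, burau_zero_val, burau_one_val]
  ext i j; fin_cases i <;> fin_cases j <;> simp [sq]

theorem burauGroup_le {ht : t ≠ 0} {K : Subgroup (GL (Fin 2) F)} (h0 : burau ht 0 ∈ K)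
    (h01 : burau ht 0 * burau ht 1 ∈ K) : burauGroup ht ≤ K := by
  rw [burauGroup, Subgroup.closure_le]
  rintro _ ⟨i, rfl⟩
  fin_cases i
  · exact h0
  · simpa using K.mul_mem (K.inv_mem h0) h01

/-- The traceless matrices with given coordinates. -/
def tracelessFrame (v : Fin 3 → Fin 3 → F) (k : Fin 3) : Matrix (Fin 2) (Fin 2) F :=
  !![v k 0, v k 1; v k 2, -v k 0]

theorem tracelessFrame_trace (v : Fin 3 → Fin 3 → F) (k : Fin 3) :
    tracelessFrame v k 1 1 = -tracelessFrame v k 0 0 := rfl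

theorem tracelessMatrix_frame (v : Fin 3 → Fin 3 → F) :
    tracelessMatrix (tracelessFrame v) = (Matrix.of v)ᵀ := by
  ext r k
  fin_cases r <;> rfl

theorem tracelessFrame_anticomm (v : Fin 3 → Fin 3 → F) (i k : Fin 3) :
    tracelessFrame v i * tracelessFrame v k + tracelessFrame v k * tracelessFrame v i =
      (2 * v i 0 * v k 0 + v i 1 * v k 2 + v i 2 * v k 1) •
        (1 : Matrix (Fin 2) (Fin 2) F) := by
  ext a b
  fin_cases a <;> fin_cases b <;> simp [tracelessFrame] <;> ring

/-- A frame of traceless matrices is related to a triangle if their anticommutators are given by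
the Gram matrix of the normals. -/
theorem adjointRel_tracelessFrame {v : Fin 3 → Fin 3 → F} {q : ℝ} {d : F}
    (h00 : 2 * v 0 0 * v 0 0 + v 0 1 * v 0 2 + v 0 2 * v 0 1 = 2 * d)
    (h11 : 2 * v 1 0 * v 1 0 + v 1 1 * v 1 2 + v 1 2 * v 1 1 = 2 * d)
    (h22 : 2 * v 2 0 * v 2 0 + v 2 1 * v 2 2 + v 2 2 * v 2 1 = 2 * d)
    (h01 : 2 * v 0 0 * v 1 0 + v 0 1 * v 1 2 + v 0 2 * v 1 1 = -d)
    (h02 : 2 * v 0 0 * v 2 0 + v 0 1 * v 2 2 + v 0 2 * v 2 1 = 0)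
    (h12 : 2 * v 1 0 * v 2 0 + v 1 1 * v 2 2 + v 1 2 * v 2 1 = -(q * d)) (i : Fin 3) :
    AdjointRel (tracelessFrame v) (tracelessFrame v i) (cartanReflection (triangleCartan q) i)
      (-1) := by
  refine adjointRel_cartanReflection (d := d) (triangleCartan_self q i) fun k => ?_
  rw [tracelessFrame_anticomm]
  congr 1
  have h2 : ((2 : ℝ) : F) = 2 := map_ofNat _ 2
  fin_cases i <;> fin_cases k <;> simp [triangleCartan, h2]
  · linear_combination h00
  · linear_combination h01
  · linear_combination h02
  · linear_combination h01
  · linear_combination h11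
  · linear_combination h12
  · linear_combination h02
  · linear_combination h12
  · linear_combination h22

/-- Projectively σ₁ is the product of the reflections 1 and 2, and σ₁σ₂, of order three, is that of
0 and 1; the two signs cancel, so `χ` is trivial. The eigenvalue ratio of σ₁ is -t, whence q² = 2 -
t - t⁻¹. -/
theorem actsDiscretely_burauGroup_elliptic (ht : t ≠ 0) (ht1 : t - 1 ≠ 0)
    (hD : t ^ 2 + t + 1 ≠ 0) {q : ℝ} (hq : t * (q : F) ^ 2 = -(t - 1) ^ 2)
    (hiso : IsolatedOne (triangleGroup q)) : ActsDiscretely (burauGroup ht) := by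
  obtain ⟨r, hr⟩ : ∃ r : F, (q : F) = r * (t - 1) := ⟨q / (t - 1), by field_simp⟩
  have htr : t * r ^ 2 = -1 := by
    apply mul_right_cancel₀ (pow_ne_zero 2 ht1)
    rw [hr] at hq
    linear_combination hq
  have hr0 : r ≠ 0 := by
    rintro rfl
    simp at htr
  -- Row 1 is orthogonal to the traceless parts of both σ₁ and σ₁σ₂. The prescribed products then
  -- determine rows 0 and 2 up to scale. All three matrices are scaled to have square t² + t + 1.
  set v : Fin 3 → Fin 3 → F := ![![t + 1, -t, 1], ![-1, -t ^ 2, -(t + 1) / t],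
    ![r * t, -(r * t * (t + 1)), r * (t + 1)]] with hv
  have hrefl := adjointRel_tracelessFrame (v := v) (q := q) (d := t ^ 2 + t + 1)
    (by simp [hv]; ring) (by simp [hv]; field_simp; ring)
    (by simp [hv]; linear_combination (-2 * (t ^ 2 + t + 1)) * htr)
    (by simp [hv]; field_simp; ring) (by simp [hv]; ring) (by simp [hv, hr]; field_simp; ring)
  refine actsDiscretely_of_le_adjointSubgroup (N := tracelessFrame v) (χ := 1)
    (tracelessFrame_trace v) ?_ ?_ ?_
    (exists_mul_eq_one_of_mem_triangleGroup q) hiso (burauGroup_le ?_ ?_)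
  · have : (Matrix.of v).det = -(r * (t ^ 2 + t + 1) ^ 2) := by
      simp [hv, Matrix.det_fin_three]
      field_simp
      ring
    rw [tracelessMatrix_frame, det_transpose, this]
    exact neg_ne_zero.2 (mul_ne_zero hr0 (pow_ne_zero _ hD))
  · exact Eventually.of_forall fun _ => rfl
  · exact fun _ _ => rfl
  · refine ⟨_, Submonoid.mul_mem _ (cartanReflection_mem_triangleGroup q 1)
      (cartanReflection_mem_triangleGroup q 2), ?_⟩
    have h := ((hrefl 1).mul (hrefl 2)).smul (-1 / (r * (t ^ 2 + t + 1)))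
    have h12 : tracelessFrame v 1 * tracelessFrame v 2 =
        (-(r * (t ^ 2 + t + 1))) • (burau ht 0).1 := by
      rw [burau_zero_val]
      ext i j
      fin_cases i <;> fin_cases j <;> simp [tracelessFrame, hv] <;> field_simp <;> ring
    rw [h12, smul_smul, show -1 / (r * (t ^ 2 + t + 1)) * -(r * (t ^ 2 + t + 1)) = 1 by
      rw [neg_div, neg_mul_neg, one_div, inv_mul_cancel₀ (mul_ne_zero hr0 hD)], one_smul,
      neg_one_mul, neg_neg] at h
    exact h
  · refine ⟨_, Submonoid.mul_mem _ (cartanReflection_mem_triangleGroup q 0)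
      (cartanReflection_mem_triangleGroup q 1), ?_⟩
    have h := ((hrefl 0).mul (hrefl 1)).smul (t / (t ^ 2 + t + 1))
    have h01 : tracelessFrame v 0 * tracelessFrame v 1 =
        ((t ^ 2 + t + 1) / t) • (burau ht 0 * burau ht 1).1 := by
      rw [burau_zero_mul_one_val]
      ext i j
      fin_cases i <;> fin_cases j <;> simp [tracelessFrame, hv] <;> field_simp <;> ring
    rw [h01, smul_smul, show t / (t ^ 2 + t + 1) * ((t ^ 2 + t + 1) / t) = 1 by
      rw [div_mul_div_comm, mul_comm t, div_self (mul_ne_zero hD ht)], one_smul,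
      neg_one_mul, neg_neg] at h
    exact h

/-- The sign of the determinant. -/
def detSign : GL (Fin 2) ℝ →* ℝ where
  toFun g := g.1.det / |g.1.det|
  map_one' := by simp
  map_mul' g h := by rw [Units.val_mul, det_mul, abs_mul, mul_div_mul_comm]

theorem detSign_of_pos {g : GL (Fin 2) ℝ} (h : 0 < g.1.det) : detSign g = 1 := by
  change g.1.det / |g.1.det| = 1
  rw [abs_of_pos h, div_self h.ne']

theorem detSign_of_neg {g : GL (Fin 2) ℝ} (h : g.1.det < 0) : detSign g = -1 := by
  change g.1.det / |g.1.det| = -1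
  rw [abs_of_neg h, div_neg, div_self h.ne]

theorem eventually_detSign : ∀ᶠ g in 𝓝 (1 : GL (Fin 2) ℝ), detSign g = 1 := by
  have h : Continuous fun g : GL (Fin 2) ℝ => g.1.det :=
    Continuous.matrix_det Units.continuous_val
  filter_upwards [h.continuousAt.eventually (lt_mem_nhds (a := 0) (by simp))] with g hg
  exact detSign_of_pos hg

theorem detSign_of_mem_center {z : GL (Fin 2) ℝ} (hz : z ∈ Subgroup.center (GL (Fin 2) ℝ)) :
    detSign z = 1 := by
  apply detSign_of_pos
  have h0 := z.det_ne_zero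
  obtain ⟨a, ha⟩ := GeneralLinearGroup.mem_center_iff_val_mem_range_scalar.1 hz
  rw [← ha] at h0 ⊢
  simp at h0 ⊢
  positivity

/-- For t > 0 the generators have negative determinant and reverse orientation. Now σ₁σ₂σ₁ is
traceless itself and acts as minus the reflection 2, while σ₁σ₂ is still the product of the
reflections 0 and 1. The leftover sign is the sign of the determinant, which is 1 near the identity.
-/
theorem actsDiscretely_burauGroup_reflective {t : ℝ} (ht : 0 < t) (ht1 : t - 1 ≠ 0)
    {q : ℝ} (hq : t * q ^ 2 = t ^ 2 + t + 1)
    (hiso : IsolatedOne (triangleGroup q)) : ActsDiscretely (burauGroup ht.ne') := by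
  have hD : 0 < t ^ 2 + t + 1 := by positivity
  have hq0 : q ≠ 0 := by
    rintro rfl
    simp at hq
    linarith
  set v : Fin 3 → Fin 3 → ℝ := ![![t + 1, -t, 1], ![-1, -t ^ 2, -(t + 1) / t],
    ![0, q * t, q]] with hv
  have hrefl := adjointRel_tracelessFrame (v := v) (q := q) (d := t ^ 2 + t + 1)
    (by simp [hv]; ring) (by simp [hv]; field_simp; ring)
    (by simp [hv]; linear_combination 2 * hq)
    (by simp [hv]; field_simp; ring) (by simp [hv]; ring) (by simp [hv]; field_simp; ring)
  set K := adjointSubgroup (tracelessFrame v) (exists_mul_eq_one_of_mem_triangleGroup q) detSign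
  have h01 : burau ht.ne' 0 * burau ht.ne' 1 ∈ K := by
    refine ⟨_, Submonoid.mul_mem _ (cartanReflection_mem_triangleGroup q 0)
      (cartanReflection_mem_triangleGroup q 1), ?_⟩
    have h := ((hrefl 0).mul (hrefl 1)).smul (t / (t ^ 2 + t + 1))
    have h01 : tracelessFrame v 0 * tracelessFrame v 1 =
        ((t ^ 2 + t + 1) / t) • (burau ht.ne' 0 * burau ht.ne' 1).1 := by
      rw [burau_zero_mul_one_val]
      ext i j
      fin_cases i <;> fin_cases j <;> simp [tracelessFrame, hv] <;> field_simp <;> ring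
    rw [h01, smul_smul, show t / (t ^ 2 + t + 1) * ((t ^ 2 + t + 1) / t) = 1 by
      field_simp, one_smul, neg_one_mul, neg_neg] at h
    rw [detSign_of_pos]
    · exact h
    · rw [burau_zero_mul_one_val, det_fin_two_of]
      simp
      positivity
  have hval : (burau ht.ne' 0 * burau ht.ne' 1 * burau ht.ne' 0).1 = !![0, t ^ 2; t, 0] := by
    rw [Units.val_mul, burau_zero_mul_one_val, burau_zero_val]
    ext i j; fin_cases i <;> fin_cases j <;> simp
  have h010 : burau ht.ne' 0 * burau ht.ne' 1 * burau ht.ne' 0 ∈ K := by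
    refine ⟨_, cartanReflection_mem_triangleGroup q 2, ?_⟩
    rw [detSign_of_neg, hval]
    · have h := (hrefl 2).smul (t / q)
      convert h using 1
      ext i j
      fin_cases i <;> fin_cases j <;> simp [tracelessFrame, hv] <;> field_simp
    · rw [hval, det_fin_two_of]
      have : 0 < t ^ 2 * t := by positivity
      linarith
  refine actsDiscretely_of_le_adjointSubgroup (N := tracelessFrame v) (χ := detSign)
    (tracelessFrame_trace v) ?_ eventually_detSign (fun z hz => detSign_of_mem_center hz)
    (exists_mul_eq_one_of_mem_triangleGroup q) hiso (burauGroup_le ?_ h01)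
  · have : (Matrix.of v).det = -(q * (t - 1) * (t ^ 2 + t + 1)) := by
      simp [hv, Matrix.det_fin_three]
      field_simp
      ring
    rw [tracelessMatrix_frame, det_transpose, this]
    exact neg_ne_zero.2 (mul_ne_zero (mul_ne_zero hq0 ht1) hD.ne')
  · have h := K.mul_mem (K.inv_mem h01) h010
    rwa [inv_mul_cancel_left] at h

/-- At t = 1 the determinant of the reflective frame vanishes. In the standard coordinates
conjugation is given by integral matrices, for which the identity is isolated. -/
theorem actsDiscretely_burauGroup_one : ActsDiscretely (burauGroup (one_ne_zero (α := ℝ))) := by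
  set N : Fin 3 → Matrix (Fin 2) (Fin 2) ℝ := tracelessFrame ![![1, 0, 0], ![0, 1, 0], ![0, 0, 1]]
    with hN
  set r : Fin 2 → Matrix (Fin 3) (Fin 3) ℤ :=
    ![!![1, 0, -1; -2, -1, 1; 0, 0, -1], !![1, 1, 0; 0, -1, 0; 2, 1, -1]] with hr
  set φ := (Int.castRingHom ℝ).mapMatrix (m := Fin 3) with hφ
  have hinv := exists_mul_eq_one_of_mem_closure (r := fun i => φ (r i)) (fun i => by
    rw [← map_mul, ← map_one φ]
    congr 1
    revert i
    decide)
  have hadj : ∀ i, AdjointRel N (burau (one_ne_zero (α := ℝ)) i).1 (φ (r i)) 1 := by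
    intro i k
    fin_cases i <;> fin_cases k <;> ext a b <;> fin_cases a <;> fin_cases b <;>
      simp [burau_zero_val, burau_one_val, hN, tracelessFrame, hφ, hr, Fin.sum_univ_three] <;>
      norm_num
  refine actsDiscretely_of_le_adjointSubgroup (N := N) (χ := 1)
    (tracelessFrame_trace _) ?_ ?_ ?_ hinv ?_ ?_
  · rw [hN, tracelessMatrix_frame, det_transpose, Matrix.det_fin_three]
    simp
  · exact Eventually.of_forall fun _ => rfl
  · exact fun _ _ => rfl
  · refine ⟨1, one_pos, fun w hw h => ?_⟩
    have hle : Submonoid.closure (Set.range fun i => φ (r i)) ≤ MonoidHom.mrange φ.toMonoidHom := by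
      rw [Submonoid.closure_le]
      rintro _ ⟨i, rfl⟩
      exact ⟨r i, rfl⟩
    obtain ⟨M, rfl⟩ := hle hw
    ext j k
    have h1 := h j k
    change |((M j k : ℤ) : ℝ) - _| < 1 at h1
    change ((M j k : ℤ) : ℝ) = _
    have h2 : (1 : Matrix (Fin 3) (Fin 3) ℝ) j k = ((1 : Matrix (Fin 3) (Fin 3) ℤ) j k : ℤ) := by
      rw [Matrix.one_apply, Matrix.one_apply]
      split_ifs <;> simp
    rw [h2] at h1 ⊢
    norm_cast at h1 ⊢
    exact sub_eq_zero.1 (Int.abs_lt_one_iff.1 h1)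
  · rw [burauGroup, Subgroup.closure_le]
    rintro _ ⟨i, rfl⟩
    exact ⟨_, Submonoid.subset_closure ⟨i, rfl⟩, hadj i⟩

end Clifford

/-! ### Elements accumulating at the identity. -/

theorem not_mem_center_of_apply_ne_zero {F : Type} [Field F] {g : GL (Fin 2) F}
    (h : g.1 0 1 ≠ 0) : g ∉ Subgroup.center (GL (Fin 2) F) := by
  intro hg
  obtain ⟨a, ha⟩ := GeneralLinearGroup.mem_center_iff_val_mem_range_scalar.1 hg
  rw [← ha] at h
  simp at h

theorem exists_pow_near_one {z : ℂ} (hz : ‖z‖ = 1) {ε : ℝ} (hε : 0 < ε) :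
    ∃ k : ℕ, 0 < k ∧ ‖z ^ k - 1‖ < ε := by
  obtain ⟨a, -, φ, hφ, hlim⟩ := (isCompact_sphere (0 : ℂ) 1).tendsto_subseq
    (x := fun n : ℕ => z ^ n) (fun n => by simp [hz])
  obtain ⟨N, hN⟩ := Metric.cauchySeq_iff'.1 hlim.cauchySeq ε hε
  have h := hN (N + 1) (Nat.le_succ N)
  have hlt : φ N < φ (N + 1) := hφ (Nat.lt_succ_self N)
  refine ⟨φ (N + 1) - φ N, Nat.sub_pos_of_lt hlt, ?_⟩
  rw [dist_eq_norm] at h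
  simp only [Function.comp_apply] at h
  have h1 : z ^ φ (N + 1) - z ^ φ N = z ^ φ N * (z ^ (φ (N + 1) - φ N) - 1) := by
    rw [mul_sub, ← pow_add, Nat.add_sub_cancel' hlt.le, mul_one]
  rwa [h1, norm_mul, norm_pow, hz, one_pow, one_mul] at h

theorem conj_diagonal_val {u v : ℂ} {f : GL (Fin 2) ℂ} (hf : f.1 = !![u, 0; 0, v])
    (g : GL (Fin 2) ℂ) : (g * f * g⁻¹).1 = g.1.det⁻¹ •
      !![g.1 0 0 * g.1 1 1 * u - g.1 0 1 * g.1 1 0 * v, -(g.1 0 0 * g.1 0 1 * (u - v));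
        g.1 1 0 * g.1 1 1 * (u - v), g.1 0 0 * g.1 1 1 * v - g.1 0 1 * g.1 1 0 * u] := by
  rw [Units.val_mul, Units.val_mul, coe_units_inv, hf, Matrix.inv_def, Ring.inverse_eq_inv,
    adjugate_fin_two, mul_smul_comm]
  congr 1
  rw [eta_fin_two g.1]
  ext i j
  fin_cases i <;> fin_cases j <;> simp [Matrix.mul_apply, Fin.sum_univ_two] <;> ring

/-- Some powers of the unimodular ratio v/u tend to 1 without reaching it, so the commutators of `g`
with these powers of `f` tend to 1. Their upper right entry is a nonzero multiple of g₀₀ g₀₁ (1 -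
z⁻¹), so they are not scalar. -/
theorem accumulatesAtOne_of_pow_ne {Γ : Subgroup (GL (Fin 2) ℂ)} {f g : GL (Fin 2) ℂ}
    (hfΓ : f ∈ Γ) (hgΓ : g ∈ Γ) {u v : ℂ} (hf : f.1 = !![u, 0; 0, v]) (hu : ‖u‖ = 1)
    (hv : ‖v‖ = 1) (hne : ∀ k : ℕ, 0 < k → u ^ k ≠ v ^ k) (ha : g.1 0 0 ≠ 0) (hb : g.1 0 1 ≠ 0) :
    AccumulatesAtOne Γ := by
  have hu0 : u ≠ 0 := by rintro rfl; simp at hu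
  have hv0 : v ≠ 0 := by rintro rfl; simp at hv
  have hz : ‖v / u‖ = 1 := by rw [norm_div, hu, hv, div_one]
  choose k hk hkn using fun n : ℕ => exists_pow_near_one hz
    (ε := 1 / ((n : ℝ) + 1)) (by positivity)
  set z : ℕ → ℂ := fun n => (v / u) ^ k n with hzdef
  have hz0 : ∀ n, z n ≠ 0 := fun n => pow_ne_zero _ (div_ne_zero hv0 hu0)
  have hzlim : Tendsto z atTop (𝓝 1) := by
    rw [tendsto_iff_norm_sub_tendsto_zero]
    exact squeeze_zero (fun n => norm_nonneg _) (fun n => (hkn n).le)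
      tendsto_one_div_add_atTop_nhds_zero_nat
  have hz1 : ∀ n, z n ≠ 1 := by
    intro n h
    rw [hzdef] at h
    simp only [div_pow] at h
    exact hne _ (hk n) ((div_eq_one_iff_eq (pow_ne_zero _ hu0)).1 h).symm
  have hfk : ∀ n : ℕ, (f ^ n).1 = !![u ^ n, 0; 0, v ^ n] := by
    intro n
    rw [Units.val_pow_eq_pow_val, hf]
    induction n with
    | zero => ext i j; fin_cases i <;> fin_cases j <;> simp
    | succ n ih =>
      rw [pow_succ, ih]
      ext i j; fin_cases i <;> fin_cases j <;> simp [pow_succ]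
  have hdet := g.det_ne_zero
  have hval : ∀ n, (g * f ^ k n * g⁻¹ * (f ^ k n)⁻¹).1 = g.1.det⁻¹ •
      !![g.1 0 0 * g.1 1 1 - g.1 0 1 * g.1 1 0 * z n, g.1 0 0 * g.1 0 1 * (1 - (z n)⁻¹);
        g.1 1 0 * g.1 1 1 * (1 - z n), g.1 0 0 * g.1 1 1 - g.1 0 1 * g.1 1 0 * (z n)⁻¹] := by
    intro n
    rw [Units.val_mul, conj_diagonal_val (hfk _), coe_units_inv, hfk, Matrix.inv_def,
      Ring.inverse_eq_inv, adjugate_fin_two_of, smul_mul_smul_comm, det_fin_two_of, mul_smul]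
    congr 1
    have hun := pow_ne_zero (k n) hu0
    have hvn := pow_ne_zero (k n) hv0
    ext i j
    fin_cases i <;> fin_cases j <;> simp [hzdef, div_pow] <;> field_simp <;> ring
  refine ⟨fun n => g * f ^ k n * g⁻¹ * (f ^ k n)⁻¹, fun n => ⟨?_, ?_, ?_⟩, ?_⟩
  · exact Γ.mul_mem (Γ.mul_mem (Γ.mul_mem hgΓ (Γ.pow_mem hfΓ _)) (Γ.inv_mem hgΓ))
      (Γ.inv_mem (Γ.pow_mem hfΓ _))
  · have : GeneralLinearGroup.det (g * f ^ k n * g⁻¹ * (f ^ k n)⁻¹) = 1 := by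
      simp only [map_mul, map_inv, map_pow]
      rw [mul_right_comm, mul_inv_cancel_right, mul_inv_cancel]
    exact congrArg Units.val this
  · apply not_mem_center_of_apply_ne_zero
    rw [hval]
    have : 1 - (z n)⁻¹ ≠ 0 := by
      rw [sub_ne_zero, ne_eq, eq_comm, inv_eq_one]
      exact hz1 n
    simpa [hdet] using ⟨⟨ha, hb⟩, this⟩
  · simp_rw [hval]
    have hzi : Tendsto (fun n => (z n)⁻¹) atTop (𝓝 1) := by
      simpa using hzlim.inv₀ one_ne_zero
    have hlim : Tendsto (fun n => g.1.det⁻¹ •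
      !![g.1 0 0 * g.1 1 1 - g.1 0 1 * g.1 1 0 * z n, g.1 0 0 * g.1 0 1 * (1 - (z n)⁻¹);
        g.1 1 0 * g.1 1 1 * (1 - z n), g.1 0 0 * g.1 1 1 - g.1 0 1 * g.1 1 0 * (z n)⁻¹]) atTop
      (𝓝 (g.1.det⁻¹ • !![g.1 0 0 * g.1 1 1 - g.1 0 1 * g.1 1 0 * 1,
        g.1 0 0 * g.1 0 1 * (1 - 1);
        g.1 1 0 * g.1 1 1 * (1 - 1), g.1 0 0 * g.1 1 1 - g.1 0 1 * g.1 1 0 * 1])) := by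
      refine tendsto_pi_nhds.2 fun i => tendsto_pi_nhds.2 fun j => ?_
      refine Tendsto.const_mul _ ?_
      fin_cases i <;> fin_cases j
      · exact tendsto_const_nhds.sub (tendsto_const_nhds.mul hzlim)
      · exact tendsto_const_nhds.mul (tendsto_const_nhds.sub hzi)
      · exact tendsto_const_nhds.mul (tendsto_const_nhds.sub hzlim)
      · exact tendsto_const_nhds.sub (tendsto_const_nhds.mul hzi)
    convert hlim using 2
    rw [mul_one, ← det_fin_two, sub_self, mul_zero, mul_zero]
    ext i j
    fin_cases i <;> fin_cases j <;> simp [hdet]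

/-- Repeated conjugation of an elliptic element, as in Jørgensen's inequality. -/
theorem accumulatesAtOne_of_jorgensen {Γ : Subgroup (GL (Fin 2) ℂ)} {f g : GL (Fin 2) ℂ}
    (hfΓ : f ∈ Γ) (hgΓ : g ∈ Γ) {u v : ℂ} (hf : f.1 = !![u, 0; 0, v]) (hu : ‖u‖ = 1)
    (hv : ‖v‖ = 1) {s x : ℝ} (hs : (u - v) ^ 2 = -s * (u * v)) (hs0 : 0 < s) (hs1 : s < 1)
    (hx : g.1 0 1 * g.1 1 0 = x * g.1.det) (hx0 : x ≠ 0) (hx1 : -1 < x) (hsx : s * (1 + x) < 1) :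
    AccumulatesAtOne Γ := by
  have hu0 : u ≠ 0 := by rintro rfl; simp at hu
  have hv0 : v ≠ 0 := by rintro rfl; simp at hv
  have huv : u * v ≠ 0 := mul_ne_zero hu0 hv0
  obtain ⟨G, hG0, hG⟩ : ∃ G : ℕ → GL (Fin 2) ℂ, G 0 = g ∧ ∀ n, G (n + 1) = G n * f * (G n)⁻¹ :=
    ⟨fun n => Nat.rec g (fun _ h => h * f * h⁻¹) n, rfl, fun _ => rfl⟩
  -- `y n` is the product of the off-diagonal entries of `G n` divided by its determinant.
  -- Conjugating `f` turns it into s(1 + y)y, which contracts to 0 because s·max(1, 1 + x) < 1.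
  obtain ⟨y, hy0, hy⟩ : ∃ y : ℕ → ℝ, y 0 = x ∧ ∀ n, y (n + 1) = s * (1 + y n) * y n :=
    ⟨fun n => Nat.rec x (fun _ y => s * (1 + y) * y) n, rfl, fun _ => rfl⟩
  have hdetf : f.1.det = u * v := by rw [hf, det_fin_two_of]; ring
  have hdet : ∀ n, (G (n + 1)).1.det = u * v := by
    intro n
    rw [hG, ← hdetf]
    have : GeneralLinearGroup.det (G n * f * (G n)⁻¹) = GeneralLinearGroup.det f := by
      simp only [map_mul, map_inv]
      rw [mul_inv_cancel_comm]
    exact congrArg Units.val this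
  have hxy : ∀ n, (G n).1 0 1 * (G n).1 1 0 = y n * (G n).1.det := by
    intro n
    induction n with
    | zero => rw [hG0, hy0]; exact hx
    | succ n ih =>
      have hD := (G n).det_ne_zero
      rw [hdet, hG, conj_diagonal_val hf, hy]
      have had : (G n).1 0 0 * (G n).1 1 1 = (1 + y n) * (G n).1.det := by
        rw [add_mul, ← ih, det_fin_two]; ring
      simp only [Matrix.smul_apply, smul_eq_mul, of_apply, cons_val', cons_val_zero, cons_val_one,
        cons_val_fin_one]
      have : (G n).1.det⁻¹ * -((G n).1 0 0 * (G n).1 0 1 * (u - v)) *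
          ((G n).1.det⁻¹ * ((G n).1 1 0 * (G n).1 1 1 * (u - v))) =
          -((G n).1 0 0 * (G n).1 1 1 * (G n).1.det⁻¹) * ((G n).1 0 1 * (G n).1 1 0 *
            (G n).1.det⁻¹) * (u - v) ^ 2 := by ring
      rw [this, had, ih, hs, mul_inv_cancel_right₀ hD, mul_inv_cancel_right₀ hD]
      push_cast
      ring
  set M := max 1 (1 + x) with hM
  have hM1 : 1 ≤ M := le_max_left _ _
  have hr : s * M < 1 := by
    rcases max_choice 1 (1 + x) with h | h <;> rw [hM, h]
    · linarith
    · exact hsx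
  have hinv : ∀ n, y n ≠ 0 ∧ -1 < y n ∧ 1 + y n ≤ M := by
    intro n
    induction n with
    | zero => rw [hy0]; exact ⟨hx0, hx1, le_max_right _ _⟩
    | succ n ih =>
      obtain ⟨h0, h1, h2⟩ := ih
      have h3 : 0 < s * (1 + y n) := mul_pos hs0 (by linarith)
      have h4 : s * (1 + y n) < 1 := lt_of_le_of_lt (by nlinarith) hr
      rw [hy]
      refine ⟨mul_ne_zero h3.ne' h0, ?_, ?_⟩
      · rcases lt_or_gt_of_ne h0 with h | h <;> nlinarith
      · rcases lt_or_gt_of_ne h0 with h | h <;> nlinarith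
  have hylim : Tendsto y atTop (𝓝 0) := by
    have h1 : ∀ n, |y n| ≤ |x| * (s * M) ^ n := by
      intro n
      induction n with
      | zero => simp [hy0]
      | succ n ih =>
        obtain ⟨h0, h1, h2⟩ := hinv n
        rw [hy, abs_mul, abs_of_pos (mul_pos hs0 (by linarith : 0 < 1 + y n)), pow_succ]
        have h3 : s * (1 + y n) ≤ s * M := by nlinarith
        have h4 := abs_nonneg (y n)
        have h5 : 0 < s * M := by positivity
        calc s * (1 + y n) * |y n| ≤ s * M * (|x| * (s * M) ^ n) := by gcongr
          _ = |x| * ((s * M) ^ n * (s * M)) := by ring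
    refine squeeze_zero_norm h1 ?_
    have := (tendsto_pow_atTop_nhds_zero_of_lt_one (by positivity) hr).const_mul |x|
    simpa using this
  have hylimC : Tendsto (fun n => (y n : ℂ)) atTop (𝓝 0) := by
    exact_mod_cast (Complex.continuous_ofReal.tendsto 0).comp hylim
  have hentry : ∀ n, (G (n + 1)).1 0 0 = (1 + y n) * u - y n * v ∧
      (G (n + 1)).1 1 1 = (1 + y n) * v - y n * u := by
    intro n
    have hD := (G n).det_ne_zero
    have had : (G n).1 0 0 * (G n).1 1 1 = (1 + y n) * (G n).1.det := by
      rw [add_mul, ← hxy, det_fin_two]; ring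
    rw [hG, conj_diagonal_val hf]
    simp only [Matrix.smul_apply, smul_eq_mul, of_apply, cons_val', cons_val_zero, cons_val_one,
      cons_val_fin_one]
    rw [had, hxy]
    constructor <;> field_simp
  have ha : Tendsto (fun n => (G (n + 1)).1 0 0) atTop (𝓝 u) := by
    simp_rw [(hentry _).1]
    have := ((hylimC.const_add 1).mul_const u).sub (hylimC.mul_const v)
    simpa using this
  have hd : Tendsto (fun n => (G (n + 1)).1 1 1) atTop (𝓝 v) := by
    simp_rw [(hentry _).2]
    have := ((hylimC.const_add 1).mul_const v).sub (hylimC.mul_const u)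
    simpa using this
  have huvn : ‖u * v‖ = 1 := by rw [norm_mul, hu, hv, one_mul]
  have hnorm : ‖u - v‖ < 1 := by
    have h1 : ‖u - v‖ ^ 2 = s := by
      rw [← norm_pow, hs, norm_mul, huvn, mul_one, norm_neg, Complex.norm_real,
        Real.norm_of_nonneg hs0.le]
    have h2 := norm_nonneg (u - v)
    nlinarith
  -- That the product of the off-diagonal entries tends to 0 is not enough. Each entry tends to 0
  -- separately, since the ratio of consecutive absolute values tends to ‖u - v‖ = √s < 1 once the
  -- diagonal entries converge.
  have hoff : ∀ (b : ℕ → ℂ) (a : ℕ → ℂ) (w : ℂ), ‖w‖ = 1 → Tendsto a atTop (𝓝 w) →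
      (∀ n, ‖b (n + 1)‖ = ‖a n‖ * ‖b n‖ * ‖u - v‖) → Tendsto b atTop (𝓝 0) := by
    intro b a w hw haw hb
    obtain ⟨ρ, h1, h2⟩ := exists_between hnorm
    have h3 : Tendsto (fun n => ‖a n‖ * ‖u - v‖) atTop (𝓝 (‖u - v‖)) := by
      have := haw.norm.mul_const ‖u - v‖
      rwa [hw, one_mul] at this
    refine (summable_of_ratio_norm_eventually_le h2 ?_).tendsto_atTop_zero
    filter_upwards [h3.eventually (gt_mem_nhds h1)] with n hn
    rw [hb, mul_right_comm]
    exact mul_le_mul_of_nonneg_right hn.le (norm_nonneg _)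
  have hb : Tendsto (fun n => (G (n + 1)).1 0 1) atTop (𝓝 0) := by
    refine hoff _ _ u hu ha fun n => ?_
    rw [hG (n + 1), conj_diagonal_val hf, hdet]
    simp [hu, hv]
  have hc : Tendsto (fun n => (G (n + 1)).1 1 0) atTop (𝓝 0) := by
    refine hoff _ _ v hv hd fun n => ?_
    rw [hG (n + 1), conj_diagonal_val hf, hdet]
    simp [hu, hv]
    exact Or.inl (mul_comm _ _)
  have hGlim : Tendsto (fun n => (G (n + 1)).1) atTop (𝓝 f.1) := by
    rw [hf]
    refine tendsto_pi_nhds.2 fun i => tendsto_pi_nhds.2 fun j => ?_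
    fin_cases i <;> fin_cases j
    · exact ha
    · exact hb
    · exact hc
    · exact hd
  have hGΓ : ∀ n, G n ∈ Γ := by
    intro n
    induction n with
    | zero => rwa [hG0]
    | succ n ih => rw [hG]; exact Γ.mul_mem (Γ.mul_mem ih hfΓ) (Γ.inv_mem ih)
  refine ⟨fun n => G (n + 1) * f⁻¹, fun n => ⟨Γ.mul_mem (hGΓ _) (Γ.inv_mem hfΓ), ?_, ?_⟩, ?_⟩
  · rw [Units.val_mul, det_mul, hdet, ← hdetf, ← det_mul, Units.mul_inv, det_one]
  · apply not_mem_center_of_apply_ne_zero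
    have h1 : (G (n + 1)).1 0 1 ≠ 0 := by
      intro h
      have := hxy (n + 1)
      rw [h, zero_mul, hdet] at this
      exact mul_ne_zero (Complex.ofReal_ne_zero.2 (hinv (n + 1)).1) huv this.symm
    rw [Units.val_mul, coe_units_inv, hf, Matrix.inv_def, Ring.inverse_eq_inv,
      adjugate_fin_two_of, det_fin_two_of]
    simp [Matrix.mul_apply, Fin.sum_univ_two, h1, hu0, hv0]
  · have := hGlim.mul_const f⁻¹.1
    rwa [Units.mul_inv] at this

theorem AccumulatesAtOne.of_conj {F ι : Type} [Field F] [Fintype ι] [DecidableEq ι]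
    [TopologicalSpace F] [IsTopologicalRing F] {Γ : Subgroup (GL ι F)} (P : GL ι F)
    (h : AccumulatesAtOne (Γ.map (MulAut.conj P⁻¹).toMonoidHom)) : AccumulatesAtOne Γ := by
  obtain ⟨h, hΓ, hlim⟩ := h
  have hmem : ∀ n, P * h n * P⁻¹ ∈ Γ := by
    intro n
    obtain ⟨γ, hγ, he⟩ := (hΓ n).1
    have : P * h n * P⁻¹ = γ := by
      rw [← he]
      simp [mul_assoc]
    rwa [this]
  refine ⟨fun n => P * h n * P⁻¹, fun n => ⟨hmem n, ?_, fun hc => (hΓ n).2.2 ?_⟩, ?_⟩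
  · have : GeneralLinearGroup.det (P * h n * P⁻¹) = GeneralLinearGroup.det (h n) := by
      rw [map_mul, map_mul, map_inv, mul_inv_cancel_comm]
    exact (congrArg Units.val this).trans (hΓ n).2.1
  · have := (inferInstance : (Subgroup.center (GL ι F)).Normal).conj_mem _ hc P⁻¹
    simpa [mul_assoc] using this
  · have := (hlim.const_mul P.1).mul_const P⁻¹.1
    rwa [mul_one, Units.mul_inv] at this

theorem AccumulatesAtOne.of_complex {ι : Type} [Fintype ι] [DecidableEq ι] {Γ : Subgroup (GL ι ℝ)}
    (h : AccumulatesAtOne (Γ.map (GeneralLinearGroup.map Complex.ofRealHom))) :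
    AccumulatesAtOne Γ := by
  obtain ⟨h, hΓ, hlim⟩ := h
  choose γ hγ he using fun n => (hΓ n).1
  have hval : ∀ n i j, (h n).1 i j = ((γ n).1 i j : ℂ) := by
    intro n i j
    rw [← he]
    rfl
  refine ⟨γ, fun n => ⟨hγ n, ?_, fun hc => (hΓ n).2.2 ?_⟩, ?_⟩
  · have h1 := (hΓ n).2.1
    rw [← he] at h1
    have h2 : ((γ n).1.map Complex.ofRealHom).det = 1 := h1
    rw [← RingHom.mapMatrix_apply, ← RingHom.map_det] at h2
    exact Complex.ofReal_injective h2
  · obtain ⟨a, ha⟩ := GeneralLinearGroup.mem_center_iff_val_mem_range_scalar.1 hc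
    refine GeneralLinearGroup.mem_center_iff_val_mem_range_scalar.2 ⟨a, ?_⟩
    ext i j
    rw [hval, ← ha]
    by_cases hij : i = j
    · subst hij; simp
    · simp [hij]
  · refine tendsto_pi_nhds.2 fun i => tendsto_pi_nhds.2 fun j => ?_
    have h1 := tendsto_pi_nhds.1 (tendsto_pi_nhds.1 hlim i) j
    have h2 := (Complex.continuous_re.tendsto _).comp h1
    refine (h2.congr fun n => ?_).trans (le_of_eq ?_)
    · simp [hval]
    · by_cases hij : i = j
      · subst hij; simp
      · simp [hij]

/-- If a, d are the diagonal entries of `g` in an eigenbasis of `f`, then tr(fg) - v tr g = a(u - v)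
and u tr g - tr(fg) = d(u - v). So `Y` is ad/det g, read off from traces alone, and the off-diagonal
product over det g is Y - 1. The conditions Y ≠ 0, 1 keep the entries needed nonzero. -/
theorem accumulatesAtOne_of_elliptic {Γ : Subgroup (GL (Fin 2) ℂ)} {f g : GL (Fin 2) ℂ}
    (hfΓ : f ∈ Γ) (hgΓ : g ∈ Γ) {u v : ℂ} (hf0 : f.1 1 0 ≠ 0) (htr : f.1 0 0 + f.1 1 1 = u + v)
    (hdet : f.1.det = u * v) (huv : u ≠ v) (hu : ‖u‖ = 1) (hv : ‖v‖ = 1) {Y : ℝ}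
    (hY : ((f.1 * g.1).trace - v * g.1.trace) * (u * g.1.trace - (f.1 * g.1).trace) =
      Y * (u - v) ^ 2 * g.1.det) (hY0 : 0 < Y) (hY1 : Y ≠ 1)
    (H : (∀ k : ℕ, 0 < k → u ^ k ≠ v ^ k) ∨ ∃ (k : ℕ) (s : ℝ), (u ^ k - v ^ k) ^ 2 =
      -s * (u ^ k * v ^ k) ∧ 0 < s ∧ s < 1 ∧ s * Y < 1) : AccumulatesAtOne Γ := by
  have huv' := sub_ne_zero.2 huv
  have hdetP : (!![u - f.1 1 1, v - f.1 1 1; f.1 1 0, f.1 1 0]).det ≠ 0 := by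
    rw [det_fin_two_of, show (u - f.1 1 1) * f.1 1 0 - (v - f.1 1 1) * f.1 1 0 =
      (u - v) * f.1 1 0 by ring]
    exact mul_ne_zero huv' hf0
  let P : GL (Fin 2) ℂ := GeneralLinearGroup.mkOfDetNeZero _ hdetP
  have hP : P.1 = !![u - f.1 1 1, v - f.1 1 1; f.1 1 0, f.1 1 0] := rfl
  have hmemc : ∀ x ∈ Γ, P⁻¹ * x * P ∈ Γ.map (MulAut.conj P⁻¹).toMonoidHom := by
    intro x hx
    exact ⟨x, hx, by simp⟩
  have hf' : (P⁻¹ * f * P).1 = !![u, 0; 0, v] := by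
    have h1 : f.1 * P.1 = P.1 * !![u, 0; 0, v] := by
      rw [det_fin_two] at hdet
      rw [hP]
      nth_rewrite 1 [eta_fin_two f.1]
      ext i j
      fin_cases i <;> fin_cases j <;> simp
      · linear_combination u * htr - hdet
      · linear_combination v * htr - hdet
      · ring
      · ring
    rw [Units.val_mul, Units.val_mul, mul_assoc, h1, ← mul_assoc, Units.inv_mul, one_mul]
  have hfk : ∀ k : ℕ, ((P⁻¹ * f * P) ^ k).1 = !![u ^ k, 0; 0, v ^ k] := by
    intro n
    rw [Units.val_pow_eq_pow_val, hf']
    induction n with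
    | zero => ext i j; fin_cases i <;> fin_cases j <;> simp
    | succ n ih =>
      rw [pow_succ, ih]
      ext i j; fin_cases i <;> fin_cases j <;> simp [pow_succ]
  have htrg : (P⁻¹ * g * P).1.trace = g.1.trace := by
    rw [Units.val_mul, Units.val_mul, trace_units_conj']
  have htrfg : ((P⁻¹ * f * P).1 * (P⁻¹ * g * P).1).trace = (f.1 * g.1).trace := by
    rw [← Units.val_mul, show P⁻¹ * f * P * (P⁻¹ * g * P) = P⁻¹ * (f * g) * P by group,
      Units.val_mul, Units.val_mul, trace_units_conj', Units.val_mul]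
  have hdetg : (P⁻¹ * g * P).1.det = g.1.det := by
    rw [Units.val_mul, Units.val_mul, det_units_conj']
  have hgd := g.det_ne_zero
  have hfmem := hmemc f hfΓ
  have hgmem := hmemc g hgΓ
  generalize P⁻¹ * g * P = g' at *
  generalize P⁻¹ * f * P = f' at *
  rw [hf', trace_fin_two] at htrfg
  rw [trace_fin_two] at htrg
  simp [Matrix.mul_apply, Fin.sum_univ_two] at htrfg
  have had : g'.1 0 0 * g'.1 1 1 = Y * g.1.det := by
    apply mul_right_cancel₀ (pow_ne_zero 2 huv')
    rw [← htrg, ← htrfg] at hY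
    linear_combination hY
  have hbc : g'.1 0 1 * g'.1 1 0 = ((Y - 1 : ℝ) : ℂ) * g'.1.det := by
    rw [hdetg]
    rw [det_fin_two] at hdetg
    push_cast
    linear_combination had - hdetg
  have ha : g'.1 0 0 ≠ 0 := by
    intro h
    rw [h, zero_mul] at had
    exact mul_ne_zero (Complex.ofReal_ne_zero.2 hY0.ne') hgd had.symm
  have hb : g'.1 0 1 ≠ 0 := by
    intro h
    rw [h, zero_mul, hdetg] at hbc
    exact mul_ne_zero (Complex.ofReal_ne_zero.2 (sub_ne_zero.2 hY1)) hgd hbc.symm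
  apply AccumulatesAtOne.of_conj P
  rcases H with H | ⟨k, s, hs, hs0, hs1, hsY⟩
  · exact accumulatesAtOne_of_pow_ne hfmem hgmem hf' hu hv H ha hb
  · exact accumulatesAtOne_of_jorgensen (Subgroup.pow_mem _ hfmem k) hgmem (hfk k)
      (by rw [norm_pow, hu, one_pow]) (by rw [norm_pow, hv, one_pow]) hs hs0 hs1 hbc
      (sub_ne_zero.2 hY1) (by linarith) (by simpa using hsY)

/-- An exponent inverse to the numerator turns a rotation by 2πr into one by 2π/den, the smallest
angle in the cyclic group it generates. -/
theorem exists_nat_mul_modEq_one (r : ℚ) : ∃ k : ℕ, ∃ z : ℤ, (k : ℤ) * r.num = 1 + z * r.den := by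
  have hc : IsCoprime r.num (r.den : ℤ) := Rat.isCoprime_num_den r
  obtain ⟨a, b, hab⟩ := hc
  have hd : (0 : ℤ) < r.den := by exact_mod_cast r.den_pos
  refine ⟨(a % r.den).toNat, -b - a / r.den * r.num, ?_⟩
  rw [Int.toNat_of_nonneg (Int.emod_nonneg _ hd.ne')]
  have := Int.emod_add_mul_ediv a r.den
  linear_combination hab + r.num * this

open Real in
theorem two_mul_one_sub_cos_lt_one {n : ℕ} (hn : 6 < n) : 2 - 2 * cos (2 * π / n) < 1 := by
  have hn' : (6 : ℝ) < n := by exact_mod_cast hn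
  have h1 : cos (π / 3) < cos (2 * π / n) := by
    apply cos_lt_cos_of_nonneg_of_le_pi (by positivity) (by linarith [pi_pos])
    rw [div_lt_div_iff₀ (by linarith) (by norm_num)]
    nlinarith [pi_pos]
  rw [cos_pi_div_three] at h1
  linarith

open Real in
-- Here β is the rotation angle of `f` and α encodes Y = 1/(2 - 2 cos α). If β is not a rational
-- multiple of 2π, then `f` has infinite order projectively. Otherwise a power rotates by 2π/den
-- with s = 2 - 2 cos(2π/den); then den > 6 gives s < 1, and 2π/den < α gives sY < 1. The exclusion
-- α ≠ π/3 means Y ≠ 1.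
theorem accumulatesAtOne_of_angle {Γ : Subgroup (GL (Fin 2) ℂ)} {f g : GL (Fin 2) ℂ}
    (hfΓ : f ∈ Γ) (hgΓ : g ∈ Γ) {u v : ℂ} (hf0 : f.1 1 0 ≠ 0) (htr : f.1 0 0 + f.1 1 1 = u + v)
    (hdet : f.1.det = u * v) (huv : u ≠ v) (hv : ‖v‖ = 1) {α β : ℝ}
    (huβ : u = v * Complex.exp (β * Complex.I)) (hα0 : 0 < α) (hαπ : α ≤ π) (hα3 : α ≠ π / 3)
    (hY : ((f.1 * g.1).trace - v * g.1.trace) * (u * g.1.trace - (f.1 * g.1).trace) *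
      (2 - 2 * cos α) = (u - v) ^ 2 * g.1.det)
    (H : ∀ r : ℚ, β = 2 * π * r → 6 < r.den ∧ 2 * π / r.den < α) : AccumulatesAtOne Γ := by
  have hv0 : v ≠ 0 := by rintro rfl; simp at hv
  have hu : ‖u‖ = 1 := by rw [huβ, norm_mul, hv, Complex.norm_exp_ofReal_mul_I, one_mul]
  have hcos : 0 < 2 - 2 * cos α := by
    have := cos_lt_cos_of_nonneg_of_le_pi le_rfl hαπ hα0
    rw [cos_zero] at this
    linarith
  rw [show (2 - 2 * (cos α : ℂ)) = ((2 - 2 * cos α : ℝ) : ℂ) by push_cast; rfl] at hY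
  refine accumulatesAtOne_of_elliptic hfΓ hgΓ hf0 htr hdet huv hu hv (Y := (2 - 2 * cos α)⁻¹)
    ?_ (inv_pos.2 hcos) ?_ ?_
  · have hcosC := Complex.ofReal_ne_zero.2 hcos.ne'
    apply mul_right_cancel₀ hcosC
    rw [hY, Complex.ofReal_inv]
    linear_combination (-((u - v) ^ 2 * g.1.det)) * inv_mul_cancel₀ hcosC
  · intro h
    rw [inv_eq_one] at h
    have h1 : cos α = cos (π / 3) := by rw [cos_pi_div_three]; linarith
    exact hα3 (injOn_cos ⟨hα0.le, hαπ⟩ ⟨by positivity, by linarith [pi_pos]⟩ h1)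
  · by_cases hr : ∃ r : ℚ, β = 2 * π * r
    · right
      obtain ⟨r, hr⟩ := hr
      obtain ⟨hden, hlt⟩ := H r hr
      obtain ⟨k, z, hk⟩ := exists_nat_mul_modEq_one r
      have hd : (6 : ℝ) < r.den := by exact_mod_cast hden
      refine ⟨k, 2 - 2 * cos (2 * π / r.den), ?_, ?_, two_mul_one_sub_cos_lt_one hden, ?_⟩
      · have hkβ : (k : ℝ) * β = 2 * π / r.den + z * (2 * π) := by
          have h1 : (k : ℝ) * r.num = 1 + z * r.den := by exact_mod_cast hk
          have h2 : (r : ℝ) = r.num / r.den := by exact_mod_cast (Rat.num_div_den r).symm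
          rw [hr, h2]
          field_simp
          linear_combination h1
        have huk : u ^ k = v ^ k * Complex.exp ((2 * π / r.den : ℝ) * Complex.I) := by
          rw [huβ, mul_pow, ← Complex.exp_nat_mul, ← mul_assoc, ← Complex.ofReal_natCast,
            ← Complex.ofReal_mul, hkβ]
          push_cast
          rw [add_mul, Complex.exp_add, mul_assoc (z : ℂ), Complex.exp_int_mul_two_pi_mul_I,
            mul_one]
        have h2 : Complex.exp (-((2 * π / r.den : ℝ) * Complex.I)) *
            Complex.exp ((2 * π / r.den : ℝ) * Complex.I) = 1 := by
          rw [← Complex.exp_add, neg_add_cancel, Complex.exp_zero]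
        rw [huk, Complex.ofReal_sub, Complex.ofReal_mul, Complex.ofReal_cos]
        have h3 := Complex.two_cos ((2 * π / r.den : ℝ) : ℂ)
        rw [neg_mul] at h3
        push_cast at h2 h3 ⊢
        rw [h3]
        linear_combination (-v ^ (2 * k)) * h2
      · have := cos_lt_cos_of_nonneg_of_le_pi (x := 0) (y := 2 * π / r.den) le_rfl
          (hlt.le.trans hαπ) (by positivity)
        rw [cos_zero] at this
        linarith
      · rw [← div_eq_mul_inv, div_lt_one hcos]
        have := cos_lt_cos_of_nonneg_of_le_pi (by positivity) hαπ hlt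
        linarith
    · left
      intro k hk h
      apply hr
      rw [huβ, mul_pow] at h
      have h1 : Complex.exp (k * (β * Complex.I)) = 1 := by
        rw [Complex.exp_nat_mul]
        exact mul_left_cancel₀ (pow_ne_zero k hv0) (h.trans (mul_one _).symm)
      obtain ⟨n, hn⟩ := Complex.exp_eq_one_iff.1 h1
      have h2 : (k : ℂ) * β = n * (2 * π) := by
        apply mul_right_cancel₀ Complex.I_ne_zero
        linear_combination hn
      have h3 : (k : ℝ) * β = n * (2 * π) := by exact_mod_cast h2
      refine ⟨n / k, ?_⟩
      have hk' : (k : ℝ) ≠ 0 := by exact_mod_cast hk.ne'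
      push_cast
      field_simp
      linear_combination h3

/-- Among the fractions below 1/2 with numerator greater than 1, only 2/5 has denominator at most 6.
This is the origin of the exceptional angle |θ| = π/5. -/
theorem six_lt_den {r : ℚ} (h0 : 0 < r) (h2 : r < 1 / 2) (h1 : r.num ≠ 1) (h5 : r ≠ 2 / 5) :
    6 < r.den ∧ 1 < r.num := by
  have hn : 0 < r.num := Rat.num_pos.2 h0
  have hlt : 2 * r.num < r.den := by
    have := Rat.num_div_den r
    rw [← this, div_lt_div_iff₀ (by exact_mod_cast r.den_pos) two_pos] at h2
    have h3 : r.num * 2 < 1 * (r.den : ℤ) := by exact_mod_cast h2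
    omega
  refine ⟨?_, by omega⟩
  by_contra! hd
  have hcop := r.reduced
  have hnum : r.num = 2 := by omega
  have hden : r.den = 5 ∨ r.den = 6 := by omega
  rcases hden with h | h
  · apply h5
    rw [← Rat.num_div_den r, hnum, h]
    norm_num
  · rw [hnum, h] at hcop
    revert hcop
    decide

open Real in
theorem two_pi_div_den_lt {r : ℚ} {k : ℤ} (hk : k < r.num) : k * π / r.den < π * r := by
  have h1 : (r : ℝ) = r.num / r.den := by exact_mod_cast (Rat.num_div_den r).symm
  have h2 : (k : ℝ) < r.num := by exact_mod_cast hk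
  have hd : (0 : ℝ) < r.den := by exact_mod_cast r.den_pos
  rw [h1, ← mul_div_assoc, div_lt_div_iff_of_pos_right hd]
  nlinarith [pi_pos]

open Real in
-- Take `f`, `g` to be the two generators; the eigenvalues -1 and t give α = β = π - |θ|. If this is
-- 2πr, numerator 1 is the main list and r = 2/5 is |θ| = π/5; every other r satisfies the angle
-- criterion.
theorem accumulatesAtOne_burauGroup_unit {θ : ℝ} {t : ℂ} (ht : t = Complex.exp (θ * Complex.I))
    (ht0 : t ≠ 0) (hθ0 : 0 < |θ|) (hθπ : |θ| < π) (hθ3 : |θ| ≠ 2 * π / 3)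
    (hm : ¬ ∃ m : ℕ, 0 < m ∧ |θ| = π - 2 * π / m) (h5 : |θ| ≠ π / 5) :
    AccumulatesAtOne (burauGroup ht0) := by
  have H : ∀ r : ℚ, π - |θ| = 2 * π * r → 6 < r.den ∧ 2 * π / r.den < π - |θ| := by
    intro r hr
    have hr0 : 0 < r := by
      have : (0 : ℝ) < r := by
        by_contra! h
        nlinarith [pi_pos]
      exact_mod_cast this
    have hr2 : r < 1 / 2 := by
      have : (r : ℝ) < (1 / 2 : ℚ) := by
        push_cast
        by_contra! h
        nlinarith [pi_pos]
      exact_mod_cast this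
    have h1 : (r : ℝ) = r.num / r.den := by exact_mod_cast (Rat.num_div_den r).symm
    obtain ⟨hd, hn⟩ := six_lt_den hr0 hr2 (fun h => hm ⟨r.den, r.den_pos, by
      rw [h1, h] at hr
      push_cast at hr
      linear_combination -hr⟩) (fun h => h5 (by
      rw [h] at hr
      push_cast at hr
      linear_combination -hr))
    refine ⟨hd, ?_⟩
    have h2 := two_pi_div_den_lt hn
    rw [hr, mul_div_assoc, mul_assoc]
    push_cast at h2
    rw [one_mul] at h2
    linarith
  have hcos : (2 - 2 * (cos (π - |θ|) : ℂ)) * t = (1 + t) ^ 2 := by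
    have h1 : (2 * cos θ : ℂ) = t + Complex.exp (-θ * Complex.I) := by
      rw [ht, Complex.ofReal_cos, Complex.two_cos]
    have h2 : Complex.exp (-θ * Complex.I) * t = 1 := by
      rw [ht, ← Complex.exp_add, neg_mul, neg_add_cancel, Complex.exp_zero]
    rw [cos_pi_sub, cos_abs, Complex.ofReal_neg]
    linear_combination t * h1 + h2
  have htn : ‖t‖ = 1 := by rw [ht, Complex.norm_exp_ofReal_mul_I]
  have ht1 : t ≠ -1 := by
    intro h
    rw [h] at hcos
    have h1 : (2 - 2 * (cos (π - |θ|) : ℂ)) = ((2 - 2 * cos (π - |θ|) : ℝ) : ℂ) := by push_cast; rfl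
    have h2 := cos_lt_cos_of_nonneg_of_le_pi (x := 0) (y := π - |θ|) le_rfl (by linarith)
      (by linarith)
    rw [cos_zero] at h2
    rw [h1] at hcos
    have h3 : (2 - 2 * cos (π - |θ|)) = 0 := by
      apply Complex.ofReal_injective
      rw [Complex.ofReal_zero]
      linear_combination -hcos
    linarith
  have hexp : Complex.exp (π * Complex.I) = -1 := Complex.exp_pi_mul_I
  have h1 := burau_mem ht0 1
  have h0 := burau_mem ht0 0
  have hα3 : π - |θ| ≠ π / 3 := fun h => hθ3 (by linarith)
  -- The sign of θ decides the order of the eigenvalues for which u/v has argument π - |θ|.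
  rcases le_or_gt 0 θ with hθ | hθ
  · refine accumulatesAtOne_of_angle h1 h0 (u := -1) (v := t) (α := π - |θ|) (β := π - |θ|)
      (by simp [burau_one_val]) (by simp [burau_one_val]) (by simp [burau_one_val, det_fin_two])
      (fun h => ht1 h.symm) htn ?_ (by linarith) (by linarith) hα3 ?_ H
    · rw [ht, ← Complex.exp_add, abs_of_nonneg hθ, ← hexp]
      congr 1
      push_cast
      ring
    · generalize cos (π - |θ|) = c at hcos ⊢
      simp [burau_one_val, burau_zero_val, det_fin_two, trace_fin_two]
      linear_combination (-t) * hcos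
  · refine accumulatesAtOne_of_angle h1 h0 (u := t) (v := -1) (α := π - |θ|) (β := π - |θ|)
      (by simp [burau_one_val]) (by simp [burau_one_val]; ring)
      (by simp [burau_one_val, det_fin_two])
      ht1 (by simp) ?_ (by linarith) (by linarith) hα3 ?_ H
    · rw [ht, ← hexp, ← Complex.exp_add, abs_of_neg hθ]
      have : Complex.exp (θ * Complex.I) = Complex.exp (θ * Complex.I + 2 * π * Complex.I) := by
        rw [Complex.exp_add, Complex.exp_two_pi_mul_I, mul_one]
      rw [this]
      congr 1
      push_cast
      ring
    · generalize cos (π - |θ|) = c at hcos ⊢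
      simp [burau_one_val, burau_zero_val, det_fin_two, trace_fin_two]
      linear_combination (-t) * hcos

open Real in
-- The element f = σ₁σ₂⁻¹ has determinant 1 and trace 1 - t - t⁻¹ = -2 cos α, so it is elliptic of
-- angle 2α; `g` is σ₁σ₂. If α is π·num/den, numerators 1 and 2 give the excluded m = 2·den and m =
-- den. From 3 on, 2π/den < α, and α < π/3 makes den > 3·num.
theorem accumulatesAtOne_burauGroup_real {t : ℝ} (ht : 0 < t) (ht3 : t + t⁻¹ < 3)
    (hm : ¬ ∃ m : ℕ, 0 < m ∧ t + t⁻¹ = 1 + 2 * cos (2 * π / m)) :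
    AccumulatesAtOne (burauGroup ht.ne') := by
  have htt : t * t⁻¹ = 1 := mul_inv_cancel₀ ht.ne'
  have ht1 : t ≠ 1 := by
    rintro rfl
    refine hm ⟨6, by norm_num, ?_⟩
    rw [show 2 * π / (6 : ℕ) = π / 3 by push_cast; ring, cos_pi_div_three]
    norm_num
  have ht2 : 2 < t + t⁻¹ := by
    have h1 : 0 < (t - 1) ^ 2 := by
      have := sub_ne_zero.2 ht1
      positivity
    have h2 : 0 < (t - 1) ^ 2 * t⁻¹ := mul_pos h1 (inv_pos.2 ht)
    nlinarith
  set α := arccos ((t + t⁻¹ - 1) / 2) with hα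
  have hcos : cos α = (t + t⁻¹ - 1) / 2 := cos_arccos (by linarith) (by linarith)
  have hα0 : 0 < α := arccos_pos.2 (by linarith)
  have hα3 : α < π / 3 := by
    rw [← arccos_cos (by positivity) (by linarith [pi_pos] : π / 3 ≤ π), cos_pi_div_three, hα]
    exact arccos_lt_arccos (by norm_num) (by linarith) (by linarith)
  have hm' : ∀ m : ℕ, 0 < m → α ≠ 2 * π / m := by
    intro m h0 h
    refine hm ⟨m, h0, ?_⟩
    rw [← h, hcos]
    ring
  have H : ∀ r : ℚ, 2 * α = 2 * π * r → 6 < r.den ∧ 2 * π / r.den < α := by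
    intro r hr
    have h1 : (r : ℝ) = r.num / r.den := by exact_mod_cast (Rat.num_div_den r).symm
    have hd : (0 : ℝ) < r.den := by exact_mod_cast r.den_pos
    have hr0 : 0 < r.num := by
      have : (0 : ℝ) < r := by
        by_contra! h
        nlinarith [pi_pos]
      exact Rat.num_pos.2 (by exact_mod_cast this)
    have hr3 : 3 * r.num < r.den := by
      have h2 : (r : ℝ) < 1 / 3 := by
        by_contra! h
        nlinarith [pi_pos]
      rw [h1, div_lt_div_iff₀ hd (by norm_num)] at h2
      have h3 : r.num * 3 < 1 * (r.den : ℤ) := by exact_mod_cast h2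
      omega
    have hn1 : r.num ≠ 1 := by
      intro h
      refine hm' (2 * r.den) (by have := r.den_pos; omega) ?_
      rw [h1, h] at hr
      push_cast at hr ⊢
      field_simp at hr ⊢
      linarith
    have hn2 : r.num ≠ 2 := by
      intro h
      refine hm' r.den r.den_pos ?_
      rw [h1, h] at hr
      push_cast at hr ⊢
      field_simp at hr ⊢
      linarith
    refine ⟨by omega, ?_⟩
    have := two_pi_div_den_lt (r := r) (k := 2) (by omega)
    push_cast at this
    linarith
  have htC : (t : ℂ) ≠ 0 := Complex.ofReal_ne_zero.2 ht.ne'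
  set c : ℂ := (cos α : ℂ) with hc
  have hcosC : 2 * c = t + (t : ℂ)⁻¹ - 1 := by
    rw [hc, hcos]
    push_cast
    ring
  set w := Complex.exp (α * Complex.I) with hw
  have hwn : ‖w‖ = 1 := Complex.norm_exp_ofReal_mul_I α
  have hw0 : w ≠ 0 := by rw [hw]; exact Complex.exp_ne_zero _
  have hwc : w + w⁻¹ = 2 * c := by
    rw [hc, hw, ← Complex.exp_neg, Complex.ofReal_cos, Complex.two_cos, neg_mul]
  have hww : w * w⁻¹ = 1 := mul_inv_cancel₀ hw0
  have hw1 : w ≠ w⁻¹ := by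
    intro h
    rw [← h] at hwc
    rw [← h] at hww
    have h2 : c ^ 2 = 1 := by linear_combination hww - (w + c) * (1 / 2) * hwc
    have h3 : cos α ^ 2 = 1 := by rw [hc] at h2; exact_mod_cast h2
    nlinarith
  have hf : (burau ht.ne' 0 * (burau ht.ne' 1)⁻¹).1 = !![1 - t, -1; t⁻¹, -t⁻¹] := by
    rw [Units.val_mul, coe_units_inv, burau_zero_val, burau_one_val, Matrix.inv_def,
      Ring.inverse_eq_inv, adjugate_fin_two_of, det_fin_two_of]
    ext i j
    fin_cases i <;> fin_cases j <;> simp <;> field_simp <;> ring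
  apply AccumulatesAtOne.of_complex
  have hfΓ := Subgroup.mem_map_of_mem (GeneralLinearGroup.map Complex.ofRealHom)
    (Subgroup.mul_mem _ (burau_mem ht.ne' 0) (Subgroup.inv_mem _ (burau_mem ht.ne' 1)))
  have hgΓ := Subgroup.mem_map_of_mem (GeneralLinearGroup.map Complex.ofRealHom)
    (Subgroup.mul_mem _ (burau_mem ht.ne' 0) (burau_mem ht.ne' 1))
  have hfv : (GeneralLinearGroup.map Complex.ofRealHom
      (burau ht.ne' 0 * (burau ht.ne' 1)⁻¹)).1 = !![1 - (t : ℂ), -1; (t : ℂ)⁻¹, -(t : ℂ)⁻¹] := by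
    change (burau ht.ne' 0 * (burau ht.ne' 1)⁻¹).1.map Complex.ofRealHom = _
    rw [hf]
    ext i j
    fin_cases i <;> fin_cases j <;> simp
  have hgv : (GeneralLinearGroup.map Complex.ofRealHom
      (burau ht.ne' 0 * burau ht.ne' 1)).1 = !![0, -(t : ℂ) ^ 2; 1, -(t : ℂ)] := by
    change (burau ht.ne' 0 * burau ht.ne' 1).1.map Complex.ofRealHom = _
    rw [burau_zero_mul_one_val]
    ext i j
    fin_cases i <;> fin_cases j <;> simp
  refine accumulatesAtOne_of_angle hfΓ hgΓ (u := -w) (v := -w⁻¹) (α := α) (β := 2 * α)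
    ?_ ?_ ?_ (fun h => hw1 (neg_injective h)) (by rw [norm_neg, norm_inv, hwn, inv_one]) ?_ hα0
    (by linarith [pi_pos]) hα3.ne ?_ H
  · rw [hfv]
    simpa using htC
  · rw [hfv]
    simp
    linear_combination hcosC + hwc
  · rw [hfv, det_fin_two_of]
    field_simp
    ring
  · have : Complex.exp ((2 * α : ℝ) * Complex.I) = w * w := by
      rw [hw, ← Complex.exp_add]
      congr 1
      push_cast
      ring
    rw [this]
    linear_combination w * hww
  · rw [hfv, hgv]
    simp only [det_fin_two_of, trace_fin_two, Matrix.mul_apply, Fin.sum_univ_two, of_apply,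
      cons_val', cons_val_zero, cons_val_one, cons_val_fin_one]
    rw [← hc, show (1 - (t : ℂ)) * 0 + -1 * 1 + ((t : ℂ)⁻¹ * -(t : ℂ) ^ 2 + -(t : ℂ)⁻¹ * -(t : ℂ)) =
      -(t : ℂ) by field_simp; ring]
    linear_combination (-(t : ℂ) ^ 2) * ((2 - 2 * c - 4) * hww + (2 + w + w⁻¹) * hwc)

/-! ### Discreteness at the listed parameters. -/

theorem cos_ne_neg_half {θ : ℝ} (hθπ : |θ| < Real.pi) (hθ3 : |θ| ≠ 2 * Real.pi / 3) :
    1 + 2 * Real.cos θ ≠ 0 := by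
  intro h
  have h1 : Real.cos (2 * Real.pi / 3) = -(1 / 2) := by
    rw [show 2 * Real.pi / 3 = Real.pi - Real.pi / 3 by ring, Real.cos_pi_sub,
      Real.cos_pi_div_three]
  refine hθ3 (Real.injOn_cos ⟨abs_nonneg θ, hθπ.le⟩
    ⟨by positivity, by linarith [Real.pi_pos]⟩ ?_)
  rw [Real.cos_abs, h1]
  linarith

section Circle

variable {θ : ℝ} {t : ℂ}

theorem sq_add_one_of_exp (ht : t = Complex.exp (θ * Complex.I)) :
    t ^ 2 + 1 = 2 * (Real.cos θ : ℂ) * t := by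
  have h2 : Complex.exp (-θ * Complex.I) * t = 1 := by
    rw [ht, ← Complex.exp_add, neg_mul, neg_add_cancel, Complex.exp_zero]
  rw [Complex.ofReal_cos, Complex.two_cos, add_mul, h2, ← ht, sq]

theorem sq_add_add_one_ne_zero_of_exp (ht : t = Complex.exp (θ * Complex.I))
    (hθπ : |θ| < Real.pi) (hθ3 : |θ| ≠ 2 * Real.pi / 3) : t ^ 2 + t + 1 ≠ 0 := by
  have ht0 : t ≠ 0 := by rw [ht]; exact Complex.exp_ne_zero _
  have h : t ^ 2 + t + 1 = ((1 + 2 * Real.cos θ : ℝ) : ℂ) * t := by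
    rw [Complex.ofReal_add, Complex.ofReal_mul, Complex.ofReal_one, Complex.ofReal_ofNat]
    linear_combination sq_add_one_of_exp ht
  rw [h]
  exact mul_ne_zero (Complex.ofReal_ne_zero.2 (cos_ne_neg_half hθπ hθ3)) ht0

theorem cos_ne_one {θ : ℝ} (h0 : 0 < |θ|) (hπ : |θ| < Real.pi) : Real.cos θ < 1 := by
  rw [← Real.cos_abs, ← Real.cos_zero]
  exact Real.cos_lt_cos_of_nonneg_of_le_pi le_rfl hπ.le h0

theorem neg_one_lt_cos {θ : ℝ} (hπ : |θ| < Real.pi) : -1 < Real.cos θ := by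
  rw [← Real.cos_abs, ← Real.cos_pi]
  exact Real.cos_lt_cos_of_nonneg_of_le_pi (abs_nonneg θ) le_rfl hπ

theorem sub_one_ne_zero_of_exp (ht : t = Complex.exp (θ * Complex.I)) (h0 : 0 < |θ|)
    (hπ : |θ| < Real.pi) : t - 1 ≠ 0 := by
  intro h
  have h1 := sq_add_one_of_exp ht
  rw [sub_eq_zero.1 h] at h1
  have h2 : (2 : ℝ) = 2 * Real.cos θ := by
    apply Complex.ofReal_injective
    push_cast at h1 ⊢
    linear_combination h1
  linarith [cos_ne_one h0 hπ]

theorem one_add_ne_zero_of_exp (ht : t = Complex.exp (θ * Complex.I)) (hπ : |θ| < Real.pi) :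
    1 + t ≠ 0 := by
  intro h
  have h1 := sq_add_one_of_exp ht
  rw [eq_neg_of_add_eq_zero_right h] at h1
  have h2 : (2 : ℝ) = -2 * Real.cos θ := by
    apply Complex.ofReal_injective
    push_cast at h1 ⊢
    linear_combination h1
  linarith [neg_one_lt_cos hπ]

theorem actsDiscretely_burauGroup_unit (ht : t = Complex.exp (θ * Complex.I)) (ht0 : t ≠ 0)
    (hθ0 : 0 < |θ|) (hθπ : |θ| < Real.pi) (hθ3 : |θ| ≠ 2 * Real.pi / 3)
    (H : (∃ m : ℕ, 0 < m ∧ |θ| = Real.pi - 2 * Real.pi / m) ∨ |θ| = Real.pi / 5) :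
    ActsDiscretely (burauGroup ht0) := by
  -- On the circle 2 - t - t⁻¹ = 2 - 2 cos θ, which is (2 cos(π/m))² for |θ| = π - 2π/m and (2
  -- cos(2π/5))² for |θ| = π/5.
  obtain ⟨q, hq, hiso⟩ : ∃ q : ℝ, q ^ 2 = 2 - 2 * Real.cos θ ∧ IsolatedOne (triangleGroup q) := by
    rcases H with ⟨m, hm, h⟩ | h
    · refine ⟨2 * Real.cos (Real.pi / m), ?_, isolatedOne_triangleGroup (m := m) (Or.inr ⟨?_, rfl⟩)⟩
      · rw [← Real.cos_abs θ, h, Real.cos_pi_sub, mul_div_assoc, Real.cos_two_mul]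
        ring
      · by_contra! hlt
        have hm' : (0 : ℝ) < m := by exact_mod_cast hm
        have h2 : (m : ℝ) ≤ 2 := by exact_mod_cast (by omega : m ≤ 2)
        have : Real.pi ≤ 2 * Real.pi / m := by
          rw [le_div_iff₀ hm']
          nlinarith [Real.pi_pos]
        linarith
    · refine ⟨2 * Real.cos (2 * Real.pi / 5), ?_, isolatedOne_triangleGroup_pentagram⟩
      rw [← Real.cos_abs θ, h]
      have h1 := Real.cos_two_mul (2 * Real.pi / 5)
      rw [show 2 * (2 * Real.pi / 5) = Real.pi - Real.pi / 5 by ring, Real.cos_pi_sub] at h1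
      linarith
  refine actsDiscretely_burauGroup_elliptic ht0 (sub_one_ne_zero_of_exp ht hθ0 hθπ)
    (sq_add_add_one_ne_zero_of_exp ht hθπ hθ3) (q := q) ?_ hiso
  change t * (q : ℂ) ^ 2 = _
  rw [← Complex.ofReal_pow, hq]
  push_cast
  have := sq_add_one_of_exp ht
  push_cast at this
  linear_combination this

end Circle

/-- Both t < 0 and t + t⁻¹ ≥ 3 make the relevant q² at least 4, so the Coxeter entry is infinite.
Among small m, the value 1 means t + t⁻¹ = 3 and the value 2 is impossible for t > 0. -/
theorem actsDiscretely_burauGroup_real {t : ℝ} (ht : t ≠ 0) (h1 : t ≠ -1)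
    (H : t < 0 ∨ 3 ≤ t + t⁻¹ ∨ ∃ m : ℕ, 0 < m ∧ t + t⁻¹ = 1 + 2 * Real.cos (2 * Real.pi / m)) :
    ActsDiscretely (burauGroup ht) := by
  have htt : t * t⁻¹ = 1 := mul_inv_cancel₀ ht
  rcases lt_or_gt_of_ne ht with hneg | hpos
  · have h2 : 0 ≤ (t + 1) ^ 2 * -t⁻¹ :=
      mul_nonneg (sq_nonneg _) (neg_pos.2 (inv_lt_zero.2 hneg)).le
    have hq : 0 ≤ 2 - t - t⁻¹ := by nlinarith
    have hq4 : (2 : ℝ) ^ 2 ≤ 2 - t - t⁻¹ := by nlinarith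
    refine actsDiscretely_burauGroup_elliptic ht (by linarith) (by nlinarith [sq_nonneg (t + 1)])
      (q := √(2 - t - t⁻¹)) ?_ (isolatedOne_triangleGroup (m := 0)
        (Or.inl ⟨rfl, Real.le_sqrt_of_sq_le hq4⟩))
    change t * (√(2 - t - t⁻¹)) ^ 2 = _
    rw [Real.sq_sqrt hq]
    linear_combination -htt
  · have key : ∀ {q : ℝ} {m : ℕ}, t ≠ 1 → q ^ 2 = t + t⁻¹ + 1 →
        ((m = 0 ∧ 2 ≤ q) ∨ (3 ≤ m ∧ q = 2 * Real.cos (Real.pi / m))) →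
        ActsDiscretely (burauGroup ht) := fun {q m} ht1 hq h =>
      actsDiscretely_burauGroup_reflective hpos (sub_ne_zero.2 ht1)
        (by rw [hq]; linear_combination htt) (isolatedOne_triangleGroup h)
    have h3 : 3 ≤ t + t⁻¹ → ActsDiscretely (burauGroup ht) := by
      intro h3
      refine key (q := √(t + t⁻¹ + 1)) (m := 0) ?_ (Real.sq_sqrt (by linarith))
        (Or.inl ⟨rfl, Real.le_sqrt_of_sq_le (by linarith)⟩)
      rintro rfl
      norm_num at h3
    rcases H with h | h | ⟨m, hm, h⟩
    · linarith
    · exact h3 h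
    · by_cases ht1 : t = 1
      · subst ht1
        exact actsDiscretely_burauGroup_one
      · by_cases hm3 : 3 ≤ m
        · refine key (m := m) ht1 ?_ (Or.inr ⟨hm3, rfl⟩)
          rw [h, mul_div_assoc, Real.cos_two_mul]
          ring
        · have h2 : 0 < (t - 1) ^ 2 * t⁻¹ :=
            mul_pos (by have := sub_ne_zero.2 ht1; positivity) (inv_pos.2 hpos)
          have hm12 : m = 1 ∨ m = 2 := by omega
          rcases hm12 with rfl | rfl
          · apply h3
            rw [h]
            norm_num
          · norm_num at h
            nlinarith

theorem discreteTopology_burauGroup_real_iff {t : ℝ} (ht : t ≠ 0) (h1 : t ≠ -1) {V : Type}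
    [AddCommGroup V] [Module ℝ V] (b : Module.Basis (Fin 2) ℝ V) :
    DiscreteTopology ((burauGroup ht).map (matrixToPGL b)) ↔
      t < 0 ∨ 3 ≤ t + t⁻¹ ∨ ∃ m : ℕ, 0 < m ∧ t + t⁻¹ = 1 + 2 * Real.cos (2 * Real.pi / m) := by
  refine ⟨fun h => ?_, fun h => discreteTopology_of_actsDiscretely b
    (actsDiscretely_burauGroup_real ht h1 h)⟩
  by_contra! hn
  exact not_discreteTopology_of_accumulatesAtOne b
    (accumulatesAtOne_burauGroup_real (lt_of_le_of_ne hn.1 ht.symm) hn.2.1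
      (by push Not; exact hn.2.2)) h

/-! ### The Hermitian form, its isometries and compactness. -/

/-- The matrix of the sesquilinear form of a two-dimensional skein space. -/
def hermGram (t : ℂ) : Matrix (Fin 2) (Fin 2) ℂ :=
  !![(1 + t) ^ 2, -(1 + t) * t; -(1 + t), (1 + t) ^ 2]

/-- The unimodular isometries of the sesquilinear form. -/
def unitaryMatrices (t : ℂ) : Set (Matrix (Fin 2) (Fin 2) ℂ) :=
  {M | M.det = 1 ∧ Mᴴ * hermGram t * M = hermGram t}

theorem det_of_mem_unitaryMatrices {t : ℂ} {M : Matrix (Fin 2) (Fin 2) ℂ}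
    (h : M ∈ unitaryMatrices t) : M.det = 1 := h.1

namespace BurauModel

variable {n c : ℕ} {t : ℂ} (m : BurauModel n c)

theorem skeinForm_eq (ht : t ≠ 0) (x y : W ℂ n c) :
    skeinForm n c t x y = star (x ∘ m.e) ⬝ᵥ (hermGram t *ᵥ (y ∘ m.e)) := by
  have hg : ∀ i j, gram n c t (m.e i) (m.e j) = gram2 t i j := fun i j =>
    congrFun (congrFun (m.gram_eq t) i) j
  rw [skeinForm, ← m.e.sum_comp]
  simp_rw [← m.e.sum_comp (fun q => _ * gram n c t _ q * y q), hg, m.parity]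
  simp [Fin.sum_univ_two, dotProduct, Matrix.mulVec, hermGram, gram2]
  field_simp

theorem reducedForm_mkQ (hrad : radical n c t = ⊥) (x y : W ℂ n c) :
    reducedForm n c t ((radical n c t).mkQ x) ((radical n c t).mkQ y) = skeinForm n c t x y := by
  have hinj : Function.Injective (radical n c t).mkQ := by
    rw [← LinearMap.ker_eq_bot, Submodule.ker_mkQ, hrad]
  have h : ∀ x, Function.surjInv (radical n c t).mkQ_surjective ((radical n c t).mkQ x) = x :=
    fun x => hinj (Function.surjInv_eq _ _)
  rw [reducedForm, h, h]

theorem glEquiv_apply_mkQ (hrad : radical n c t = ⊥) (g : GL (Fin 2) ℂ) (w : W ℂ n c) :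
    (glEquiv (skeinBasis m.e hrad) g : Module.End ℂ (X n c t)) ((radical n c t).mkQ w) =
      (radical n c t).mkQ ((g.1 *ᵥ (w ∘ m.e)) ∘ m.e.symm) := by
  have h := toLin_skeinBasis_mkQ m.e hrad (g.1.submatrix m.e.symm m.e.symm) w
  rw [submatrix_submatrix, Equiv.symm_comp_self, submatrix_id_id] at h
  rw [glEquiv_val, h, toLin'_apply]
  congr 1
  rw [submatrix_mulVec_equiv]
  rfl

theorem form_comp_iff (g : Matrix (Fin 2) (Fin 2) ℂ) (H : Matrix (Fin 2) (Fin 2) ℂ) :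
    (∀ v w : Fin 2 → ℂ, star (g *ᵥ v) ⬝ᵥ (H *ᵥ (g *ᵥ w)) = star v ⬝ᵥ (H *ᵥ w)) ↔
      gᴴ * H * g = H := by
  have h : ∀ v w : Fin 2 → ℂ, star (g *ᵥ v) ⬝ᵥ (H *ᵥ (g *ᵥ w)) =
      star v ⬝ᵥ ((gᴴ * H * g) *ᵥ w) := by
    intro v w
    rw [star_mulVec, ← dotProduct_mulVec, mulVec_mulVec, mulVec_mulVec, mul_assoc]
  simp_rw [h]
  constructor
  · intro H'
    ext i j
    have := H' (Pi.single i 1) (Pi.single j 1)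
    have hs : star (Pi.single i (1 : ℂ)) = (Pi.single i (1 : ℂ) : Fin 2 → ℂ) := by
      rw [← Pi.single_star, star_one]
    simpa [hs] using this
  · intro H' v w
    rw [H']

theorem glEquiv_mem_SU_iff (ht : t ≠ 0) (hrad : radical n c t = ⊥) (g : GL (Fin 2) ℂ) :
    glEquiv (skeinBasis m.e hrad) g ∈ SU n c t ↔ g.1 ∈ unitaryMatrices t := by
  refine and_congr ?_ ?_
  · rw [glEquiv_val, LinearMap.det_toLin]
  · rw [← form_comp_iff]
    have hc : ∀ v : Fin 2 → ℂ, (v ∘ m.e.symm) ∘ m.e = v := fun v => by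
      rw [Function.comp_assoc, Equiv.symm_comp_self, Function.comp_id]
    constructor
    · intro h v w
      have h1 := h ((radical n c t).mkQ (v ∘ m.e.symm)) ((radical n c t).mkQ (w ∘ m.e.symm))
      rwa [m.glEquiv_apply_mkQ, m.glEquiv_apply_mkQ, reducedForm_mkQ hrad, reducedForm_mkQ hrad,
        m.skeinForm_eq ht, m.skeinForm_eq ht, hc, hc, hc, hc] at h1
    · intro h x y
      obtain ⟨x, rfl⟩ := (radical n c t).mkQ_surjective x
      obtain ⟨y, rfl⟩ := (radical n c t).mkQ_surjective y
      rw [m.glEquiv_apply_mkQ, m.glEquiv_apply_mkQ, reducedForm_mkQ hrad, reducedForm_mkQ hrad,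
        m.skeinForm_eq ht, m.skeinForm_eq ht, hc, hc, h]

theorem mem_PSU_iff (ht : t ≠ 0) (hrad : radical n c t = ⊥) (x : PGL ℂ (X n c t)) :
    x ∈ PSU n c t ↔ ∃ g : GL (Fin 2) ℂ, g.1 ∈ unitaryMatrices t ∧
      matrixToPGL (skeinBasis m.e hrad) g = x := by
  constructor
  · rintro ⟨g, hg, rfl⟩
    obtain ⟨g, rfl⟩ := (glEquiv (skeinBasis m.e hrad)).surjective g
    exact ⟨g, (m.glEquiv_mem_SU_iff ht hrad g).1 hg, rfl⟩
  · rintro ⟨g, hg, rfl⟩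
    exact ⟨_, (m.glEquiv_mem_SU_iff ht hrad g).2 hg, rfl⟩

end BurauModel

section Circle

variable {θ : ℝ} {t : ℂ}

theorem conj_of_exp (ht : t = Complex.exp (θ * Complex.I)) :
    t * (starRingEnd ℂ) t = 1 := by
  rw [Complex.mul_conj, Complex.normSq_eq_norm_sq, ht, Complex.norm_exp_ofReal_mul_I]
  simp

/-- The columns of an isometry are bounded if the form is definite. -/
theorem sq_norm_le_of_form {h : ℝ} {v w : ℂ} (ht : t * (starRingEnd ℂ) t = 1)
    (hh : 1 < h) (hht : (2 + t + (starRingEnd ℂ) t : ℂ) = h)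
    (hQ : (h * ((starRingEnd ℂ) v * v) - (1 + t) * ((starRingEnd ℂ) v * w) -
      (1 + (starRingEnd ℂ) t) * ((starRingEnd ℂ) w * v) + h * ((starRingEnd ℂ) w * w) : ℂ) = h) :
    (h - 1) * ‖v‖ ^ 2 ≤ h ∧ (h - 1) * ‖w‖ ^ 2 ≤ h := by
  have key : ∀ z : ℂ, (starRingEnd ℂ) z * z = ((‖z‖ ^ 2 : ℝ) : ℂ) := fun z => by
    rw [mul_comm, Complex.mul_conj, Complex.normSq_eq_norm_sq]
  -- Complete the square in `v`, using |1 + t|² = h; the next identity does the same in `w`. The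
  -- leftover coefficient h² - h is the determinant of the form.
  have e1 : h * h = ‖h * v - (1 + t) * w‖ ^ 2 + (h * h - h) * ‖w‖ ^ 2 := by
    apply Complex.ofReal_injective
    rw [Complex.ofReal_add, ← key, Complex.ofReal_mul (h * h - h), ← key]
    simp only [map_sub, map_mul, map_add, map_one, Complex.conj_ofReal]
    push_cast
    linear_combination (-h : ℂ) * hQ - (starRingEnd ℂ) w * w * (ht + hht)
  have e2 : h * h = ‖h * w - (1 + (starRingEnd ℂ) t) * v‖ ^ 2 + (h * h - h) * ‖v‖ ^ 2 := by
    apply Complex.ofReal_injective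
    rw [Complex.ofReal_add, ← key, Complex.ofReal_mul (h * h - h), ← key]
    simp only [map_sub, map_mul, map_add, map_one, Complex.conj_ofReal, Complex.conj_conj]
    push_cast
    linear_combination (-h : ℂ) * hQ - (starRingEnd ℂ) v * v * (ht + hht)
  constructor
  · nlinarith [sq_nonneg ‖h * w - (1 + (starRingEnd ℂ) t) * v‖]
  · nlinarith [sq_nonneg ‖h * v - (1 + t) * w‖]

theorem isClosed_unitaryMatrices (t : ℂ) : IsClosed (unitaryMatrices t) :=
  (isClosed_eq continuous_id.matrix_det continuous_const).inter
    (isClosed_eq ((continuous_id.matrix_conjTranspose.matrix_mul continuous_const).matrix_mul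
      continuous_id) continuous_const)

/-- Divided by t, the form is Hermitian with both diagonal entries h = 2 + 2 cos θ and determinant
h² - h. For |θ| < 2π/3 this is definite, so the columns of an isometry are bounded. -/
theorem isCompact_unitaryMatrices (ht : t = Complex.exp (θ * Complex.I))
    (hθ : |θ| < 2 * Real.pi / 3) : IsCompact (unitaryMatrices t) := by
  have htc := conj_of_exp ht
  have ht0 : t ≠ 0 := by rw [ht]; exact Complex.exp_ne_zero _
  set h := 2 + 2 * Real.cos θ with hh
  have hh1 : 1 < h := by
    have h1 : Real.cos (2 * Real.pi / 3) = -(1 / 2) := by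
      rw [show 2 * Real.pi / 3 = Real.pi - Real.pi / 3 by ring, Real.cos_pi_sub,
        Real.cos_pi_div_three]
    have h2 := Real.cos_lt_cos_of_nonneg_of_le_pi (abs_nonneg θ)
      (by linarith [Real.pi_pos] : 2 * Real.pi / 3 ≤ Real.pi) hθ
    rw [Real.cos_abs, h1] at h2
    linarith
  have hht : (2 + t + (starRingEnd ℂ) t : ℂ) = h := by
    apply mul_left_cancel₀ ht0
    rw [hh, Complex.ofReal_add, Complex.ofReal_mul, Complex.ofReal_ofNat]
    linear_combination sq_add_one_of_exp ht + htc
  have hcol : ∀ M ∈ unitaryMatrices t, ∀ j, (h - 1) * ‖M 0 j‖ ^ 2 ≤ h ∧ (h - 1) * ‖M 1 j‖ ^ 2 ≤ h := by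
    rintro M ⟨-, hM⟩ j
    apply sq_norm_le_of_form htc hh1 hht
    have h1 := congrFun (congrFun hM j) j
    have h2 : hermGram t j j = (1 + t) ^ 2 := by fin_cases j <;> rfl
    rw [h2] at h1
    apply mul_left_cancel₀ ht0
    simp only [Matrix.mul_apply, Fin.sum_univ_two, hermGram, conjTranspose_apply, of_apply,
      cons_val', cons_val_zero, cons_val_one, cons_val_fin_one, RCLike.star_def] at h1
    linear_combination h1 + (-(t * ((starRingEnd ℂ) (M 0 j) * M 0 j +
      (starRingEnd ℂ) (M 1 j) * M 1 j - 1))) * hht + ((starRingEnd ℂ) (M 0 j) * M 0 j +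
      (starRingEnd ℂ) (M 1 j) * M 1 j - 1 - (starRingEnd ℂ) (M 1 j) * M 0 j) * htc
  set R := √(h / (h - 1)) with hR
  have hsub : unitaryMatrices t ⊆ Set.pi Set.univ fun _ : Fin 2 => Set.pi Set.univ fun _ : Fin 2 =>
      Metric.closedBall (0 : ℂ) R := by
    intro M hM i _ j _
    have hb : ∀ z : ℂ, (h - 1) * ‖z‖ ^ 2 ≤ h → z ∈ Metric.closedBall (0 : ℂ) R := by
      intro z hz
      rw [mem_closedBall_zero_iff, hR]
      apply Real.le_sqrt_of_sq_le
      rw [le_div_iff₀ (by linarith)]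
      linarith
    fin_cases i
    · exact hb _ (hcol M hM j).1
    · exact hb _ (hcol M hM j).2
  exact (isCompact_univ_pi fun _ => isCompact_univ_pi fun _ => isCompact_closedBall _ _).of_isClosed_subset
    (isClosed_unitaryMatrices t) hsub

theorem isCompact_PSU {n c : ℕ} (m : BurauModel n c) (ht : t = Complex.exp (θ * Complex.I))
    (hθ : |θ| < 2 * Real.pi / 3) (hrad : radical n c t = ⊥) :
    IsCompact (PSU n c t : Set (PGL ℂ (X n c t))) := by
  have ht0 : t ≠ 0 := by rw [ht]; exact Complex.exp_ne_zero _
  -- Pass through the special linear group, which carries the topology of matrix entries, so that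
  -- the topology of units need not be handled.
  have h1 : IsCompact {S : SpecialLinearGroup (Fin 2) ℂ | S.1 ∈ unitaryMatrices t} := by
    have hind : Topology.IsInducing fun S : SpecialLinearGroup (Fin 2) ℂ => S.1 := ⟨rfl⟩
    rw [hind.isCompact_iff]
    convert isCompact_unitaryMatrices ht hθ
    ext M
    constructor
    · rintro ⟨S, hS, rfl⟩
      exact hS
    · intro hM
      exact ⟨⟨M, det_of_mem_unitaryMatrices hM⟩, hM, rfl⟩
  have h2 := h1.image ((continuous_matrixToPGL (skeinBasis m.e hrad)).comp
    (SpecialLinearGroup.continuous_toGL (n := Fin 2) (R := ℂ)))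
  convert h2
  ext x
  rw [SetLike.mem_coe, m.mem_PSU_iff ht0 hrad]
  constructor
  · rintro ⟨g, hg, rfl⟩
    obtain ⟨S, hS⟩ : ∃ S : SpecialLinearGroup (Fin 2) ℂ, SpecialLinearGroup.toGL S = g :=
      ⟨⟨g.1, det_of_mem_unitaryMatrices hg⟩, Units.ext rfl⟩
    refine ⟨S, ?_, by rw [Function.comp_apply, hS]⟩
    rw [← hS] at hg
    exact hg
  · rintro ⟨S, hS, rfl⟩
    have hval : (SpecialLinearGroup.toGL S).1 = S.1 := rfl
    refine ⟨SpecialLinearGroup.toGL S, ?_, ?_⟩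
    · rw [hval]
      exact hS
    · rw [Function.comp_apply]

theorem burau_isometry (ht : t = Complex.exp (θ * Complex.I)) (ht0 : t ≠ 0) (i : Fin 2) :
    (burau ht0 i).1ᴴ * hermGram t * (burau ht0 i).1 = hermGram t := by
  have htc := conj_of_exp ht
  have : (starRingEnd ℂ) t = t⁻¹ := eq_inv_of_mul_eq_one_right htc
  fin_cases i
  · ext i j
    fin_cases i <;> fin_cases j <;>
      simp [burau_zero_val, hermGram, Matrix.mul_apply, Fin.sum_univ_two, this] <;>
      field_simp <;> ring
  · ext i j
    fin_cases i <;> fin_cases j <;>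
      simp [burau_one_val, hermGram, Matrix.mul_apply, Fin.sum_univ_two, this, ht0] <;>
      field_simp <;> ring

theorem map_burauGroup_le_PSU {n c : ℕ} (m : BurauModel n c)
    (ht : t = Complex.exp (θ * Complex.I)) (ht0 : t ≠ 0) (hrad : radical n c t = ⊥) :
    (burauGroup ht0).map (matrixToPGL (skeinBasis m.e hrad)) ≤ PSU n c t := by
  rw [Subgroup.map_le_iff_le_comap, burauGroup, Subgroup.closure_le]
  rintro _ ⟨i, rfl⟩
  rw [SetLike.mem_coe, Subgroup.mem_comap, m.mem_PSU_iff ht0 hrad]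
  -- A generator has determinant -t. Scaling by a square root `a` of (-t)⁻¹ gives determinant 1
  -- without changing the class in PGL, and |a| = 1 keeps it an isometry.
  obtain ⟨a, ha⟩ := IsAlgClosed.exists_pow_nat_eq (-t)⁻¹ two_pos
  have htn : ‖t‖ = 1 := by rw [ht, Complex.norm_exp_ofReal_mul_I]
  have ha0 : a ≠ 0 := by
    rintro rfl
    rw [zero_pow two_ne_zero] at ha
    exact inv_ne_zero (neg_ne_zero.2 ht0) ha.symm
  have han : star a * a = 1 := by
    have h1 : ‖a‖ ^ 2 = 1 := by rw [← norm_pow, ha, norm_inv, norm_neg, htn, inv_one]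
    rw [mul_comm, Complex.star_def, Complex.mul_conj, Complex.normSq_eq_norm_sq, h1,
      Complex.ofReal_one]
  have hdet : (burau ht0 i).1.det = -t := by
    fin_cases i
    · simp [burau_zero_val, det_fin_two]
    · simp [burau_one_val, det_fin_two]
  let z : GL (Fin 2) ℂ := GeneralLinearGroup.scalar (Fin 2) (Units.mk0 a ha0)
  have hz : z ∈ Subgroup.center (GL (Fin 2) ℂ) :=
    GeneralLinearGroup.mem_center_iff_val_mem_range_scalar.2 ⟨a, rfl⟩
  have hval : (burau ht0 i * z).1 = a • (burau ht0 i).1 := by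
    rw [Units.val_mul, smul_eq_mul_diagonal]
    rfl
  refine ⟨burau ht0 i * z, ⟨?_, ?_⟩, ?_⟩
  · rw [hval, det_smul, hdet, Fintype.card_fin, ha, inv_mul_cancel₀ (neg_ne_zero.2 ht0)]
  · rw [hval, conjTranspose_smul, smul_mul_assoc, smul_mul_smul_comm, han, one_smul,
      burau_isometry ht ht0]
  · rw [map_mul, (matrixToPGL_eq_one_iff _ z).2 hz, mul_one]

/-- By Cayley–Hamilton the traces satisfy a second-order recursion, whose increments are at least T
- 2 when T > 2. -/
theorem trace_pow_ge {N : Matrix (Fin 2) (Fin 2) ℂ} (hdet : N.det = 1) {T : ℝ} (htr : N.trace = T)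
    (hT : 2 < T) (k : ℕ) : ∃ x : ℝ, (N ^ k).trace = x ∧ 2 + k * (T - 2) ≤ x := by
  have hCH : N ^ 2 = (T : ℂ) • N - 1 := by
    have h := aeval_self_charpoly N
    rw [charpoly_fin_two, htr, hdet] at h
    simp only [map_sub, map_add, map_mul, map_pow, Polynomial.aeval_X, Polynomial.aeval_C,
      map_one] at h
    rw [Algebra.algebraMap_eq_smul_one, smul_mul_assoc, one_mul] at h
    rw [eq_sub_iff_add_eq, ← sub_eq_zero, ← h]
    abel
  have hrec : ∀ k, (N ^ (k + 2)).trace = T * (N ^ (k + 1)).trace - (N ^ k).trace := by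
    intro k
    rw [pow_add, hCH, mul_sub, mul_one, trace_sub, mul_smul_comm, ← pow_succ, trace_smul,
      smul_eq_mul]
  suffices h : ∃ x y : ℝ, (N ^ k).trace = x ∧ (N ^ (k + 1)).trace = y ∧ 2 + k * (T - 2) ≤ x ∧
      x + (T - 2) ≤ y by
    obtain ⟨x, y, h1, -, h2, -⟩ := h
    exact ⟨x, h1, h2⟩
  induction k with
  | zero => exact ⟨2, T, by simp, by simp [htr], by simp, by linarith⟩
  | succ k ih =>
    obtain ⟨x, y, hx, hy, h1, h2⟩ := ih
    refine ⟨y, T * y - x, hy, ?_, ?_, ?_⟩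
    · rw [add_assoc, hrec, hx, hy]
      push_cast
      rfl
    · push_cast
      linarith
    · have h3 : (0 : ℝ) ≤ k * (T - 2) := mul_nonneg (Nat.cast_nonneg k) (by linarith)
      nlinarith

/-- The quantity |tr|²/|det| descends to PGL and is bounded on compact sets, by the open cover `V`.
It is unbounded on the powers of σ₁σ₂⁻¹, whose determinant is 1 and whose trace 1 - 2 cos θ exceeds
2. -/
theorem not_isCompact_PSU {n c : ℕ} (m : BurauModel n c) (ht : t = Complex.exp (θ * Complex.I))
    (ht0 : t ≠ 0) (hθ : 2 * Real.pi / 3 < |θ|) (hθπ : |θ| < Real.pi) (hrad : radical n c t = ⊥) :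
    ¬ IsCompact (PSU n c t : Set (PGL ℂ (X n c t))) := by
  intro hK
  let b := skeinBasis m.e hrad
  let V : ℕ → Set (PGL ℂ (X n c t)) := fun N =>
    matrixToPGL b '' {g | ‖g.1.trace‖ ^ 2 < N * ‖g.1.det‖}
  have hVopen : ∀ N, IsOpen (V N) := by
    intro N
    apply isOpenMap_matrixToPGL
    exact isOpen_lt (Units.continuous_val.matrix_trace.norm.pow 2)
      (continuous_const.mul Units.continuous_val.matrix_det.norm)
  have hVmono : Monotone V := by
    intro N N' h
    apply Set.image_mono
    intro g hg
    refine lt_of_lt_of_le (b := N * ‖g.1.det‖) hg ?_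
    have : (N : ℝ) ≤ N' := by exact_mod_cast h
    exact mul_le_mul_of_nonneg_right this (norm_nonneg _)
  have hVcover : (PSU n c t : Set (PGL ℂ (X n c t))) ⊆ ⋃ N, V N := by
    intro x _
    obtain ⟨g, rfl⟩ := matrixToPGL_surjective b x
    have hd : 0 < ‖g.1.det‖ := norm_pos_iff.2 g.det_ne_zero
    obtain ⟨N, hN⟩ := exists_nat_gt (‖g.1.trace‖ ^ 2 / ‖g.1.det‖)
    exact Set.mem_iUnion.2 ⟨N, g, (div_lt_iff₀ hd).1 hN, rfl⟩
  obtain ⟨N, hN⟩ := hK.elim_directed_cover V hVopen hVcover hVmono.directed_le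
  have hγ : (burau ht0 0 * (burau ht0 1)⁻¹).1 = !![1 - t, -1; t⁻¹, -t⁻¹] := by
    rw [Units.val_mul, coe_units_inv, burau_zero_val, burau_one_val, Matrix.inv_def,
      Ring.inverse_eq_inv, adjugate_fin_two_of, det_fin_two_of]
    ext i j
    fin_cases i <;> fin_cases j <;> simp <;> field_simp <;> ring
  have hT : 2 < 1 - 2 * Real.cos θ := by
    have h1 : Real.cos (2 * Real.pi / 3) = -(1 / 2) := by
      rw [show 2 * Real.pi / 3 = Real.pi - Real.pi / 3 by ring, Real.cos_pi_sub,
        Real.cos_pi_div_three]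
    have h2 := Real.cos_lt_cos_of_nonneg_of_le_pi (by positivity) hθπ.le hθ
    rw [Real.cos_abs, h1] at h2
    linarith
  have htr : (burau ht0 0 * (burau ht0 1)⁻¹).1.trace = ((1 - 2 * Real.cos θ : ℝ) : ℂ) := by
    rw [hγ, trace_fin_two]
    change 1 - t + -t⁻¹ = _
    apply mul_left_cancel₀ ht0
    rw [Complex.ofReal_sub, Complex.ofReal_mul, Complex.ofReal_one, Complex.ofReal_ofNat]
    linear_combination -sq_add_one_of_exp ht - mul_inv_cancel₀ ht0
  have hdet : (burau ht0 0 * (burau ht0 1)⁻¹).1.det = 1 := by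
    rw [hγ, det_fin_two_of]
    field_simp
    ring
  obtain ⟨k, hk⟩ := exists_nat_gt (N / (1 - 2 * Real.cos θ - 2))
  rw [div_lt_iff₀ (by linarith)] at hk
  obtain ⟨x, hx, hle⟩ := trace_pow_ge hdet htr hT k
  set γ := burau ht0 0 * (burau ht0 1)⁻¹ with hγdef
  have hmem : matrixToPGL b (γ ^ k) ∈ PSU n c t := by
    apply map_burauGroup_le_PSU m ht ht0 hrad
    exact ⟨γ ^ k, Subgroup.pow_mem _ (Subgroup.mul_mem _ (burau_mem ht0 0)
      (Subgroup.inv_mem _ (burau_mem ht0 1))) _, rfl⟩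
  obtain ⟨g, hg, hge⟩ := hN hmem
  have hz : (γ ^ k)⁻¹ * g ∈ Subgroup.center (GL (Fin 2) ℂ) := by
    rw [← matrixToPGL_eq_one_iff b, map_mul, map_inv, hge, inv_mul_cancel]
  obtain ⟨a, ha⟩ := GeneralLinearGroup.mem_center_iff_val_mem_range_scalar.1 hz
  have hga : g.1 = a • γ.1 ^ k := by
    rw [smul_eq_mul_diagonal, ← Units.val_pow_eq_pow_val]
    have : g = γ ^ k * ((γ ^ k)⁻¹ * g) := by group
    rw [this, Units.val_mul, ← ha]
    rfl
  have ha0 : 0 < ‖a‖ := by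
    rw [norm_pos_iff]
    rintro rfl
    apply g.det_ne_zero
    rw [hga, zero_smul]
    simp
  replace hg : ‖g.1.trace‖ ^ 2 < N * ‖g.1.det‖ := hg
  rw [hga, trace_smul, det_smul, det_pow, hdet, one_pow, mul_one, hx, smul_eq_mul,
    norm_mul, norm_pow, Fintype.card_fin, mul_pow, Complex.norm_real, Real.norm_eq_abs, sq_abs,
    mul_comm] at hg
  have h1 := lt_of_mul_lt_mul_right hg (by positivity)
  nlinarith

end Circle

theorem discreteTopology_subgroupOf_iff {G : Type} [Group G] [TopologicalSpace G]
    {H K : Subgroup G} (h : H ≤ K) : DiscreteTopology (H.subgroupOf K) ↔ DiscreteTopology H := by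
  let e : H.subgroupOf K ≃ₜ H :=
    { toFun := fun x => ⟨x.1.1, x.2⟩
      invFun := fun x => ⟨⟨x.1, h x.2⟩, x.2⟩
      left_inv := fun _ => rfl
      right_inv := fun _ => rfl
      continuous_toFun := by fun_prop
      continuous_invFun := by fun_prop }
  exact ⟨fun _ => e.symm.isEmbedding.discreteTopology, fun _ => e.isEmbedding.discreteTopology⟩

/-! ### Arithmetic of 2 cos(2π/7) and an angle of infinite order. -/

section Heptagon

/-- For x = 2π/7 one has cos 4x = cos 3x; the factor cos x - 1 is divided out. -/
theorem cos_two_pi_div_seven : (2 * Real.cos (2 * Real.pi / 7)) ^ 3 +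
    (2 * Real.cos (2 * Real.pi / 7)) ^ 2 - 2 * (2 * Real.cos (2 * Real.pi / 7)) - 1 = 0 := by
  set x := 2 * Real.pi / 7 with hx
  have h3 := Real.cos_three_mul x
  have h4 : Real.cos (2 * (2 * x)) = Real.cos (3 * x) := by
    rw [show 2 * (2 * x) = 2 * Real.pi - 3 * x by rw [hx]; ring, Real.cos_two_pi_sub]
  rw [Real.cos_two_mul, Real.cos_two_mul, h3] at h4
  have h1 : Real.cos x < 1 := by
    rw [← Real.cos_zero]
    exact Real.cos_lt_cos_of_nonneg_of_le_pi le_rfl (by rw [hx]; linarith [Real.pi_pos])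
      (by rw [hx]; positivity)
  have h2 : (Real.cos x - 1) * ((2 * Real.cos x) ^ 3 +
    (2 * Real.cos x) ^ 2 - 2 * (2 * Real.cos x) - 1) = 0 := by linear_combination h4
  exact (mul_eq_zero.1 h2).resolve_left (by linarith)

/-- A rational root would give a coprime solution of the homogenised equation, but modulo 2 this has
only the trivial zero. -/
theorem irreducible_cubic :
    Irreducible (Polynomial.X ^ 3 - 3 * Polynomial.X ^ 2 - 4 * Polynomial.X - 1 :
      Polynomial ℚ) := by
  have hm : (Polynomial.X ^ 3 - 3 * Polynomial.X ^ 2 - 4 * Polynomial.X - 1 :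
      Polynomial ℚ).Monic := by monicity!
  have hd : (Polynomial.X ^ 3 - 3 * Polynomial.X ^ 2 - 4 * Polynomial.X - 1 :
      Polynomial ℚ).natDegree = 3 := by compute_degree!
  rw [hm.irreducible_iff_roots_eq_zero_of_degree_le_three (by rw [hd]; norm_num) hd.le]
  rw [Multiset.eq_zero_iff_forall_notMem]
  intro r hr
  rw [Polynomial.mem_roots hm.ne_zero, Polynomial.IsRoot.def] at hr
  simp only [Polynomial.eval_sub, Polynomial.eval_pow, Polynomial.eval_X, Polynomial.eval_mul,
    Polynomial.eval_one, Polynomial.eval_ofNat] at hr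
  have hb : (r.den : ℚ) ≠ 0 := by exact_mod_cast r.den_nz
  have h1 : (r.num ^ 3 - 3 * r.num ^ 2 * r.den - 4 * r.num * r.den ^ 2 - r.den ^ 3 : ℤ) = 0 := by
    have h2 : (r.num ^ 3 - 3 * r.num ^ 2 * r.den - 4 * r.num * r.den ^ 2 - r.den ^ 3 : ℚ) = 0 := by
      rw [← Rat.num_div_den r] at hr
      field_simp at hr
      linear_combination hr
    exact_mod_cast h2
  have key : ∀ a b : ZMod 2, a ^ 3 - 3 * a ^ 2 * b - 4 * a * b ^ 2 - b ^ 3 = 0 → a = 0 ∧ b = 0 := by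
    decide
  have h2 := congrArg (fun z : ℤ => (z : ZMod 2)) h1
  push_cast at h2
  obtain ⟨ha, hb⟩ := key _ _ h2
  have ha' := (ZMod.intCast_zmod_eq_zero_iff_dvd _ 2).1 ha
  have hb' := (ZMod.natCast_eq_zero_iff _ 2).1 hb
  have h3 := Nat.dvd_gcd (Int.natCast_dvd.1 ha') hb'
  rw [r.reduced.gcd_eq_one] at h3
  omega

/-- The cubic is the minimal polynomial of 2 cos φ and has another root x in [4, 5]. If cos kφ = 1,
then T_k(X/2) - 1 vanishes at x too, whereas the Chebyshev polynomial exceeds 1 beyond 1. -/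
theorem cos_nat_mul_ne_one {φ : ℝ}
    (h : (2 * Real.cos φ) ^ 3 - 3 * (2 * Real.cos φ) ^ 2 - 4 * (2 * Real.cos φ) - 1 = 0) {k : ℕ}
    (hk : 0 < k) : Real.cos (k * φ) ≠ 1 := by
  intro hc
  obtain ⟨x, hx, hx0⟩ : ∃ x ∈ Set.Icc (4 : ℝ) 5, x ^ 3 - 3 * x ^ 2 - 4 * x - 1 = 0 := by
    have hcont : ContinuousOn (fun x : ℝ => x ^ 3 - 3 * x ^ 2 - 4 * x - 1) (Set.Icc 4 5) := by
      fun_prop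
    exact intermediate_value_Icc (by norm_num) hcont ⟨by norm_num, by norm_num⟩
  set P : Polynomial ℚ := Polynomial.X ^ 3 - 3 * Polynomial.X ^ 2 - 4 * Polynomial.X - 1 with hP
  set p : Polynomial ℚ := (Polynomial.Chebyshev.T ℚ k).comp
    (Polynomial.C (1 / 2) * Polynomial.X) - 1 with hp
  have hPx : ∀ y : ℝ, Polynomial.aeval y P = y ^ 3 - 3 * y ^ 2 - 4 * y - 1 := by
    intro y
    simp [hP, map_ofNat]
  have hpx : ∀ y : ℝ, Polynomial.aeval y p = (Polynomial.Chebyshev.T ℝ k).eval (y / 2) - 1 := by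
    intro y
    rw [hp, map_sub, map_one, Polynomial.aeval_comp, Polynomial.Chebyshev.aeval_T]
    congr 2
    simp
    ring
  have hdvd : P ∣ p := by
    have hmin : P = minpoly ℚ (2 * Real.cos φ) :=
      minpoly.eq_of_irreducible_of_monic irreducible_cubic (by rw [hPx]; exact h) (by
        rw [hP]; monicity!)
    rw [hmin]
    apply minpoly.dvd
    rw [hpx, mul_div_cancel_left₀ _ two_ne_zero, Polynomial.Chebyshev.T_real_cos, sub_eq_zero]
    exact_mod_cast hc
  obtain ⟨r, hr⟩ := hdvd
  have h1 := hpx x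
  rw [hr, map_mul, hPx, hx0, zero_mul] at h1
  have h2 := Polynomial.Chebyshev.one_lt_eval_T_real (n := k) (by exact_mod_cast hk.ne')
    (x := x / 2) (by linarith [hx.1])
  linarith

end Heptagon

/-! ### Rotations in three dimensions and their powers. -/

section ThreeByThree

/-- The sum of the principal minors of order two. -/
def minorSum (M : Matrix (Fin 3) (Fin 3) ℝ) : ℝ :=
  M 0 0 * M 1 1 - M 0 1 * M 1 0 + (M 0 0 * M 2 2 - M 0 2 * M 2 0) +
    (M 1 1 * M 2 2 - M 1 2 * M 2 1)

variable {M : Matrix (Fin 3) (Fin 3) ℝ} {φ : ℝ}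

theorem trace_sq_fin_three (M : Matrix (Fin 3) (Fin 3) ℝ) :
    (M ^ 2).trace = M.trace ^ 2 - 2 * minorSum M := by
  simp only [trace_fin_three, sq, Matrix.mul_apply, Fin.sum_univ_three, minorSum]
  ring

theorem pow_three_fin_three (M : Matrix (Fin 3) (Fin 3) ℝ) :
    M ^ 3 = M.trace • M ^ 2 - minorSum M • M + M.det • 1 := by
  have h3 : M ^ 3 = M * (M * M) := by rw [pow_succ', sq]
  rw [h3, sq]
  ext i j
  fin_cases i <;> fin_cases j <;>
    simp [Matrix.mul_apply, Fin.sum_univ_three, det_fin_three, trace_fin_three, minorSum] <;> ring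

theorem pow_three_of_rotation (hdet : M.det = 1) (htr : M.trace = 1 + 2 * Real.cos φ)
    (hmin : minorSum M = 1 + 2 * Real.cos φ) :
    M ^ 3 = (1 + 2 * Real.cos φ) • M ^ 2 - (1 + 2 * Real.cos φ) • M + 1 := by
  rw [pow_three_fin_three, hdet, htr, hmin, one_smul]

theorem trace_pow_of_rotation (hdet : M.det = 1) (htr : M.trace = 1 + 2 * Real.cos φ)
    (hmin : minorSum M = 1 + 2 * Real.cos φ) (k : ℕ) :
    (M ^ k).trace = 1 + 2 * Real.cos (k * φ) := by
  suffices h : (M ^ k).trace = 1 + 2 * Real.cos (k * φ) ∧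
      (M ^ (k + 1)).trace = 1 + 2 * Real.cos ((k + 1 : ℕ) * φ) ∧
      (M ^ (k + 2)).trace = 1 + 2 * Real.cos ((k + 2 : ℕ) * φ) from h.1
  induction k with
  | zero =>
    refine ⟨by norm_num [trace_one], by simpa using htr, ?_⟩
    rw [zero_add, trace_sq_fin_three, htr, hmin]
    push_cast
    rw [Real.cos_two_mul]
    ring
  | succ k ih =>
    obtain ⟨h0, h1, h2⟩ := ih
    refine ⟨h1, h2, ?_⟩
    have h3 : (M ^ (k + 1 + 2)).trace = (1 + 2 * Real.cos φ) * (M ^ (k + 2)).trace -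
        (1 + 2 * Real.cos φ) * (M ^ (k + 1)).trace + (M ^ k).trace := by
      rw [show k + 1 + 2 = k + 3 by ring, pow_add, pow_three_of_rotation hdet htr hmin, mul_add,
        mul_sub, mul_smul_comm, mul_smul_comm, ← pow_add, ← pow_succ, mul_one, trace_add,
        trace_sub, trace_smul, trace_smul, smul_eq_mul, smul_eq_mul]
    have e3 := Real.cos_add_cos ((k + 3 : ℕ) * φ) ((k + 1 : ℕ) * φ)
    have e2 := Real.cos_add_cos ((k + 2 : ℕ) * φ) ((k : ℕ) * φ)
    rw [show (((k + 3 : ℕ) : ℝ) * φ + (k + 1 : ℕ) * φ) / 2 = (k + 2 : ℕ) * φ by push_cast; ring,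
      show (((k + 3 : ℕ) : ℝ) * φ - (k + 1 : ℕ) * φ) / 2 = φ by push_cast; ring] at e3
    rw [show (((k + 2 : ℕ) : ℝ) * φ + (k : ℕ) * φ) / 2 = (k + 1 : ℕ) * φ by push_cast; ring,
      show (((k + 2 : ℕ) : ℝ) * φ - (k : ℕ) * φ) / 2 = φ by push_cast; ring] at e2
    rw [h3, h0, h1, h2, show k + 1 + 2 = k + 3 by ring]
    linear_combination -2 * e3 + 2 * e2

/-- Choose powers with kφ tending to 0 modulo 2π. The coefficients sin(kφ)/sin φ and sin((k -
1)φ)/sin φ in the remainder formula tend to 0 and -1, so the powers tend to 1 without any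
diagonalisation. A real scalar of determinant 1 has trace 3, while the trace here is 1 + 2 cos kφ.
-/
theorem accumulatesAtOne_of_rotation {Γ : Subgroup (GL (Fin 3) ℝ)} {g : GL (Fin 3) ℝ}
    (hg : g ∈ Γ) (hdet : g.1.det = 1) (htr : g.1.trace = 1 + 2 * Real.cos φ)
    (hmin : minorSum g.1 = 1 + 2 * Real.cos φ) (hφ : Real.sin φ ≠ 0)
    (hne : ∀ k : ℕ, 0 < k → Real.cos (k * φ) ≠ 1) : AccumulatesAtOne Γ := by
  have hz : ‖Complex.exp (φ * Complex.I)‖ = 1 := Complex.norm_exp_ofReal_mul_I φ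
  choose k hk hkn using fun n : ℕ => exists_pow_near_one hz
    (ε := 1 / ((n : ℝ) + 1)) (by positivity)
  have hlim : Tendsto (fun n => Complex.exp (φ * Complex.I) ^ k n) atTop (𝓝 1) := by
    rw [tendsto_iff_norm_sub_tendsto_zero]
    exact squeeze_zero (fun n => norm_nonneg _) (fun n => (hkn n).le)
      tendsto_one_div_add_atTop_nhds_zero_nat
  have hval : ∀ n, Complex.exp (φ * Complex.I) ^ k n =
      Complex.exp ((k n * φ : ℝ) * Complex.I) := by
    intro n
    rw [← Complex.exp_nat_mul]
    congr 1
    push_cast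
    ring
  have hcos : Tendsto (fun n => Real.cos (k n * φ)) atTop (𝓝 1) := by
    have := (Complex.continuous_re.tendsto _).comp hlim
    refine this.congr fun n => ?_
    rw [Function.comp_apply, hval, Complex.exp_ofReal_mul_I_re]
  have hsin : Tendsto (fun n => Real.sin (k n * φ)) atTop (𝓝 0) := by
    have := (Complex.continuous_im.tendsto _).comp hlim
    refine this.congr fun n => ?_
    rw [Function.comp_apply, hval, Complex.exp_ofReal_mul_I_im]
  have hcosφ : 2 * Real.cos φ - 2 ≠ 0 := by
    intro h
    have := Real.sin_sq_add_cos_sq φ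
    rw [show Real.cos φ = 1 by linarith] at this
    exact hφ (pow_eq_zero_iff two_ne_zero |>.1 (by linarith))
  choose l hl using fun n => Nat.exists_eq_succ_of_ne_zero (hk n).ne'
  have hu : Tendsto (fun n => quantumInt (2 * Real.cos φ) (l n + 1)) atTop (𝓝 0) := by
    have := hsin.div_const (Real.sin φ)
    rw [zero_div] at this
    refine this.congr fun n => ?_
    rw [← quantumInt_two_cos, mul_div_cancel_right₀ _ hφ, hl]
  have hu' : Tendsto (fun n => quantumInt (2 * Real.cos φ) (l n)) atTop (𝓝 (-1)) := by
    have := ((hsin.mul_const (Real.cos φ)).sub (hcos.mul_const (Real.sin φ))).div_const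
      (Real.sin φ)
    rw [zero_mul, one_mul, zero_sub, neg_div, div_self hφ] at this
    refine this.congr fun n => ?_
    rw [← Real.sin_sub, show (k n : ℝ) * φ - φ = l n * φ by rw [hl]; push_cast; ring,
      ← quantumInt_two_cos, mul_div_cancel_right₀ _ hφ]
  have hT : (g.1 - 1) * (g.1 ^ 2 - (2 * Real.cos φ) • g.1 + 1) = 0 := by
    have h3 := pow_three_of_rotation hdet htr hmin
    rw [add_smul, add_smul, one_smul, one_smul] at h3
    have h4 : (g.1 - 1) * (g.1 ^ 2 - (2 * Real.cos φ) • g.1 + 1) = g.1 ^ 3 -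
        (2 * Real.cos φ) • g.1 ^ 2 + g.1 - g.1 ^ 2 + (2 * Real.cos φ) • g.1 - 1 := by
      rw [sub_mul, mul_add, mul_sub, mul_smul_comm, ← pow_succ', ← sq, mul_one, one_mul]
      abel
    rw [h4, h3]
    abel
  have hpow : ∀ n, g.1 ^ k n = 1 + (2 * Real.cos φ - 2)⁻¹ •
      ((quantumInt (2 * Real.cos φ) (l n + 1) • g.1 -
        (quantumInt (2 * Real.cos φ) (l n) + 1) • 1) *
      ((g.1 - 1) * (g.1 + 1 - (2 * Real.cos φ) • 1))) := by
    intro n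
    rw [← smul_pow_succ_sub_one hT, smul_smul, inv_mul_cancel₀ hcosφ, one_smul, hl]
    abel
  have hdetk : ∀ n, (g ^ k n).1.det = 1 := by
    intro n
    rw [Units.val_pow_eq_pow_val, det_pow, hdet, one_pow]
  refine ⟨fun n => g ^ k n, fun n => ⟨Γ.pow_mem hg _, hdetk n, fun hc => ?_⟩, ?_⟩
  · obtain ⟨a, ha⟩ := GeneralLinearGroup.mem_center_iff_val_mem_range_scalar.1 hc
    have h1 := hdetk n
    have h2 := trace_pow_of_rotation hdet htr hmin (k n)
    rw [← Units.val_pow_eq_pow_val, ← ha] at h2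
    rw [← ha] at h1
    simp at h1
    have ha1 : a = 1 := by
      have : (a - 1) * ((a + 1 / 2) ^ 2 + 3 / 4) = 0 := by linear_combination h1
      rcases mul_eq_zero.1 this with h | h
      · linarith
      · nlinarith [sq_nonneg (a + 1 / 2)]
    apply hne (k n) (hk n)
    rw [ha1] at h2
    simp at h2
    linarith
  · simp_rw [Units.val_pow_eq_pow_val, hpow]
    have h1 := ((hu.smul_const g.1).sub ((hu'.add_const 1).smul_const
      (1 : Matrix (Fin 3) (Fin 3) ℝ))).mul_const ((g.1 - 1) * (g.1 + 1 - (2 * Real.cos φ) • 1))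
    have h2 := (h1.const_smul (2 * Real.cos φ - 2)⁻¹).const_add 1
    simpa using h2

end ThreeByThree

/-! ### Four strands with two strands at the clasp. -/

section FourStrands

variable {t : ℝ}

/-- The matrices of the braid generators on the three-dimensional skein space. -/
def braid42 (ht : t ≠ 0) : Fin 3 → GL (Fin 3) ℝ :=
  ![GeneralLinearGroup.mkOfDetNeZero !![t, -t, 0; 0, -1, 0; 0, 0, -1] (by simpa [det_fin_three]),
    GeneralLinearGroup.mkOfDetNeZero !![-1, 0, 0; -1, t, -1; 0, 0, -1]
      (by simpa [det_fin_three]),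
    GeneralLinearGroup.mkOfDetNeZero !![-1, 0, 0; 0, -1, 0; 0, -t, t]
      (by simpa [det_fin_three])]

theorem braid42_zero_val (ht : t ≠ 0) :
    (braid42 ht 0).1 = !![t, -t, 0; 0, -1, 0; 0, 0, -1] := rfl

theorem braid42_one_val (ht : t ≠ 0) :
    (braid42 ht 1).1 = !![-1, 0, 0; -1, t, -1; 0, 0, -1] := rfl

theorem braid42_two_val (ht : t ≠ 0) :
    (braid42 ht 2).1 = !![-1, 0, 0; 0, -1, 0; 0, -t, t] := rfl

theorem braid42_val (ht : t ≠ 0) (i : Fin 3) : (braid42 ht i).1 = -(1 + cupCap3 t i) := by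
  fin_cases i
  · ext j k; fin_cases j <;> fin_cases k <;> simp [braid42_zero_val, cupCap3]
  · ext j k; fin_cases j <;> fin_cases k <;> simp [braid42_one_val, cupCap3]
  · ext j k; fin_cases j <;> fin_cases k <;> simp [braid42_two_val, cupCap3]

theorem braid42_braid (ht : t ≠ 0) (i j : Fin 3) (h : i.val + 1 = j.val) :
    braid42 ht i * braid42 ht j * braid42 ht i = braid42 ht j * braid42 ht i * braid42 ht j := by
  have hij : (i = 0 ∧ j = 1) ∨ (i = 1 ∧ j = 2) := by omega
  rcases hij with ⟨rfl, rfl⟩ | ⟨rfl, rfl⟩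
  · apply Units.ext
    simp only [Units.val_mul, braid42_zero_val, braid42_one_val]
    ext j k; fin_cases j <;> fin_cases k <;> simp
  · apply Units.ext
    simp only [Units.val_mul, braid42_one_val, braid42_two_val]
    ext j k; fin_cases j <;> fin_cases k <;> simp

theorem braid42_comm (ht : t ≠ 0) (i j : Fin 3) (h : i.val + 2 ≤ j.val) :
    braid42 ht i * braid42 ht j = braid42 ht j * braid42 ht i := by
  have hij : i = 0 ∧ j = 2 := by omega
  obtain ⟨rfl, rfl⟩ := hij
  apply Units.ext
  simp only [Units.val_mul, braid42_zero_val, braid42_two_val]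
  ext j k; fin_cases j <;> fin_cases k <;> simp

theorem inv_val_of_mul_eq_one {ι : Type} [Fintype ι] [DecidableEq ι] {g : GL ι ℝ}
    {M : Matrix ι ι ℝ} (h : g.1 * M = 1) : g⁻¹.1 = M := by
  rw [← mul_one g⁻¹.1, ← h, ← mul_assoc, Units.inv_mul, one_mul]

theorem braid42_zero_inv_val (ht : t ≠ 0) :
    (braid42 ht 0)⁻¹.1 = !![t⁻¹, -1, 0; 0, -1, 0; 0, 0, -1] := by
  apply inv_val_of_mul_eq_one
  rw [braid42_zero_val]
  ext j k; fin_cases j <;> fin_cases k <;> simp [ht]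

theorem braid42_one_inv_val (ht : t ≠ 0) :
    (braid42 ht 1)⁻¹.1 = !![-1, 0, 0; -t⁻¹, t⁻¹, -t⁻¹; 0, 0, -1] := by
  apply inv_val_of_mul_eq_one
  rw [braid42_one_val]
  ext j k; fin_cases j <;> fin_cases k <;> simp [ht]

/-- A braid that acts as a rotation of infinite order for the special parameter. -/
def rotationBraid (ht : t ≠ 0) : GL (Fin 3) ℝ :=
  braid42 ht 0 * (braid42 ht 0 * braid42 ht 0) *
    ((braid42 ht 1)⁻¹ * (braid42 ht 0)⁻¹ * braid42 ht 2) * ((braid42 ht 1)⁻¹ * (braid42 ht 1)⁻¹)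

theorem rotationBraid_mem (ht : t ≠ 0) :
    rotationBraid ht ∈ Subgroup.closure (Set.range (braid42 ht)) := by
  have h : ∀ i, braid42 ht i ∈ Subgroup.closure (Set.range (braid42 ht)) := fun i =>
    Subgroup.subset_closure ⟨i, rfl⟩
  exact mul_mem (mul_mem (mul_mem (h 0) (mul_mem (h 0) (h 0)))
    (mul_mem (mul_mem (inv_mem (h 1)) (inv_mem (h 0))) (h 2)))
    (mul_mem (inv_mem (h 1)) (inv_mem (h 1)))

theorem rotationBraid_val (ht : t ≠ 0) : (rotationBraid ht).1 =
    !![t ^ 2 - 2 * t + 3 - 2 * t⁻¹, t⁻¹ - 1, -t ^ 3 + t ^ 2 - 2 * t + 2 - t⁻¹;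
      t⁻¹ - 2 * t⁻¹ ^ 2, t⁻¹ ^ 2, -1 + t⁻¹ - t⁻¹ ^ 2;
      1 - t⁻¹, t⁻¹, -t + 1 - t⁻¹] := by
  have hA : (braid42 ht 0 * (braid42 ht 0 * braid42 ht 0)).1 =
      !![t ^ 3, -t ^ 3 + t ^ 2 - t, 0; 0, -1, 0; 0, 0, -1] := by
    simp only [Units.val_mul, braid42_zero_val]
    ext j k; fin_cases j <;> fin_cases k <;> simp <;> ring
  have hB : ((braid42 ht 1)⁻¹ * (braid42 ht 0)⁻¹ * braid42 ht 2).1 =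
      !![t⁻¹, -1, 0; t⁻¹ ^ 2, -1, 1; 0, -t, t] := by
    simp only [Units.val_mul, braid42_zero_inv_val, braid42_one_inv_val, braid42_two_val]
    ext j k; fin_cases j <;> fin_cases k <;> simp [ht] <;> ring
  have hC : ((braid42 ht 1)⁻¹ * (braid42 ht 1)⁻¹).1 =
      !![1, 0, 0; t⁻¹ - t⁻¹ ^ 2, t⁻¹ ^ 2, -t⁻¹ ^ 2 + t⁻¹; 0, 0, 1] := by
    simp only [Units.val_mul, braid42_one_inv_val]
    ext j k; fin_cases j <;> fin_cases k <;> simp <;> ring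
  rw [rotationBraid, Units.val_mul, Units.val_mul, hA, hB, hC]
  ext j k
  fin_cases j <;> fin_cases k <;> simp <;> field_simp <;> ring

/-- With c = t + t⁻¹ - 1 = 2 cos(2π/7), the chosen braid has determinant 1, and both its trace and
its second coefficient are c² - c. So it is a rotation with 2 cos φ = c² - c - 1. -/
theorem accumulatesAtOne_braid42 (ht : t ≠ 0)
    (h7 : t + t⁻¹ = 1 + 2 * Real.cos (2 * Real.pi / 7)) :
    AccumulatesAtOne (Subgroup.closure (Set.range (braid42 ht))) := by
  set c := 2 * Real.cos (2 * Real.pi / 7) with hc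
  have hcubic : c ^ 3 + c ^ 2 - 2 * c - 1 = 0 := cos_two_pi_div_seven
  have hc1 : 1 < c := by
    have := Real.cos_lt_cos_of_nonneg_of_le_pi (x := 2 * Real.pi / 7) (y := Real.pi / 3)
      (by positivity) (by linarith [Real.pi_pos]) (by linarith [Real.pi_pos])
    rw [Real.cos_pi_div_three] at this
    linarith
  have hc2 : c ≤ 2 := by linarith [Real.cos_le_one (2 * Real.pi / 7)]
  set φ := Real.arccos ((c ^ 2 - c - 1) / 2) with hφ
  have hcos : 2 * Real.cos φ = c ^ 2 - c - 1 := by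
    rw [hφ, Real.cos_arccos (by nlinarith) (by nlinarith)]
    ring
  have hs : c = t + t⁻¹ - 1 := by linarith
  have htt : t * t⁻¹ = 1 := mul_inv_cancel₀ ht
  refine accumulatesAtOne_of_rotation (φ := φ) (rotationBraid_mem ht) ?_ ?_ ?_ ?_ ?_
  · rw [rotationBraid_val, det_fin_three]
    simp
    field_simp
    ring
  · rw [rotationBraid_val, trace_fin_three, hcos, hs]
    simp
    field_simp
    ring
  · rw [rotationBraid_val, minorSum, hcos, hs]
    simp
    field_simp
    ring
  · intro h
    have h1 := Real.sin_sq_add_cos_sq φ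
    rw [h] at h1
    have h2 : (2 * Real.cos φ) ^ 2 = 4 := by linarith
    rw [hcos] at h2
    nlinarith
  · intro k hk
    apply cos_nat_mul_ne_one _ hk
    rw [hcos]
    -- The multiplier is the quotient of the cubic in c² - c - 1 by the minimal polynomial of c.
    linear_combination (1 + 3 * c - 4 * c ^ 2 + c ^ 3) * hcubic

theorem radical_eq_bot_42 (ht : 0 < t) : radical 4 2 t = ⊥ := by
  apply radical_eq_bot matching42
  rw [gram_matching42, gram3, det_smul, det_fin_three]
  have h : (0 : ℝ) < (1 + t + t ^ 2) ^ Fintype.card (Fin 3) * ((1 + t) * t * (1 + t ^ 2)) := by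
    positivity
  refine ne_of_lt ?_
  simp at h ⊢
  linarith

theorem exists_rep_42_not_discrete
    (h7 : t + t⁻¹ = 1 + 2 * Real.cos (2 * Real.pi / 7)) :
    ∃ ρ : BraidGroup 4 →* LinearMap.GeneralLinearGroup ℝ (X 4 2 t), IsJonesRep ρ ∧
      ¬ DiscreteTopology (projImage ρ) := by
  have hpos : 0 < t := by
    by_contra! h
    have h1 : 0 < Real.cos (2 * Real.pi / 7) := Real.cos_pos_of_mem_Ioo
      ⟨by linarith [Real.pi_pos], by linarith [Real.pi_pos]⟩
    linarith [inv_nonpos.2 h]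
  have hrad := radical_eq_bot_42 hpos
  obtain ⟨ρ, hρ, him⟩ := exists_isJonesRep matching42 hrad (braid42 hpos.ne')
    (fun i => by
      rw [braid42_val, ← cupCap_matching42]
      ext j k
      simp [Matrix.one_apply])
    (braid42_braid hpos.ne') (braid42_comm hpos.ne')
  refine ⟨ρ, hρ, ?_⟩
  rw [him]
  exact not_discreteTopology_of_accumulatesAtOne _ (accumulatesAtOne_braid42 hpos.ne' h7)

end FourStrands

/-! ### Assembly of the four items. -/

section Circle

variable {θ : ℝ} {t : ℂ} {n c : ℕ}

theorem exists_rep_unit (m : BurauModel n c) (ht : t = Complex.exp (θ * Complex.I)) (ht0 : t ≠ 0)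
    (h0 : 0 < |θ|) (hπ : |θ| < Real.pi) (h3 : |θ| ≠ 2 * Real.pi / 3)
    (hrad : radical n c t = ⊥) :
    ∃ ρ : BraidGroup n →* LinearMap.GeneralLinearGroup ℂ (X n c t), IsJonesRep ρ ∧
      projImage ρ ≤ PSU n c t ∧ (DiscreteTopology ((projImage ρ).subgroupOf (PSU n c t)) ↔
        (∃ m : ℕ, 0 < m ∧ |θ| = Real.pi - 2 * Real.pi / m) ∨ |θ| = Real.pi / 5) := by
  obtain ⟨ρ, hρ, him⟩ := m.exists_rep ht0 hrad
  have hle : projImage ρ ≤ PSU n c t := by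
    rw [him]
    exact map_burauGroup_le_PSU m ht ht0 hrad
  refine ⟨ρ, hρ, hle, ?_⟩
  rw [discreteTopology_subgroupOf_iff hle, him]
  constructor
  · intro hd
    by_contra hn
    rw [not_or] at hn
    exact not_discreteTopology_of_accumulatesAtOne _
      (accumulatesAtOne_burauGroup_unit ht ht0 h0 hπ h3 hn.1 hn.2) hd
  · exact fun h => discreteTopology_of_actsDiscretely _
      (actsDiscretely_burauGroup_unit ht ht0 h0 hπ h3 h)

end Circle

end JonesBraid

end

open JonesBraid in
theorem theorem4 :
    -- real parameter
    (∀ t : ℝ, t ≠ 0 → t ≠ -1 → ∀ n c : ℕ, (n = 3 ∧ c = 1) ∨ (n = 4 ∧ c = 0) →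
      Module.finrank ℝ (X n c t) = 2 ∧
      ∃ ρ : BraidGroup n →* LinearMap.GeneralLinearGroup ℝ (X n c t), IsJonesRep ρ ∧
        (DiscreteTopology (projImage ρ) ↔
          t < 0 ∨ 3 ≤ t + t⁻¹ ∨
            ∃ m : ℕ, 0 < m ∧ t + t⁻¹ = 1 + 2 * Real.cos (2 * Real.pi / m))) ∧
    -- parameter on the unit circle, compact case
    (∀ θ : ℝ, 0 < |θ| → |θ| < 2 * Real.pi / 3 → ∀ t : ℂ, t = Complex.exp (θ * Complex.I) →
      ∀ n c : ℕ, (n = 3 ∧ c = 1) ∨ (n = 4 ∧ c = 0) →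
      Module.finrank ℂ (X n c t) = 2 ∧ IsCompact (PSU n c t : Set (PGL ℂ (X n c t))) ∧
      ∃ ρ : BraidGroup n →* LinearMap.GeneralLinearGroup ℂ (X n c t), IsJonesRep ρ ∧
        projImage ρ ≤ PSU n c t ∧
        (DiscreteTopology ((projImage ρ).subgroupOf (PSU n c t)) ↔
          (∃ m : ℕ, 0 < m ∧ |θ| = Real.pi - 2 * Real.pi / m) ∨ |θ| = Real.pi / 5)) ∧
    -- parameter on the unit circle, non-compact case
    (∀ θ : ℝ, 2 * Real.pi / 3 < |θ| → |θ| < Real.pi → ∀ t : ℂ, t = Complex.exp (θ * Complex.I) →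
      ∀ n c : ℕ, (n = 3 ∧ c = 1) ∨ (n = 4 ∧ c = 0) →
      Module.finrank ℂ (X n c t) = 2 ∧ ¬ IsCompact (PSU n c t : Set (PGL ℂ (X n c t))) ∧
      ∃ ρ : BraidGroup n →* LinearMap.GeneralLinearGroup ℂ (X n c t), IsJonesRep ρ ∧
        projImage ρ ≤ PSU n c t ∧
        (DiscreteTopology ((projImage ρ).subgroupOf (PSU n c t)) ↔
          ∃ m : ℕ, 0 < m ∧ |θ| = Real.pi - 2 * Real.pi / m)) ∧
    -- the special real parameter
    (∀ t : ℝ, t + t⁻¹ = 1 + 2 * Real.cos (2 * Real.pi / 7) →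
      ∃ ρ : BraidGroup 4 →* LinearMap.GeneralLinearGroup ℝ (X 4 2 t), IsJonesRep ρ ∧
        ¬ DiscreteTopology (projImage ρ)) := by
  refine ⟨?_, ?_, ?_, fun t h => exists_rep_42_not_discrete h⟩
  · intro t ht h1 n c hnc
    obtain ⟨m⟩ := nonempty_burauModel hnc
    have hrad := m.radical_eq_bot ht (fun h => h1 (by linarith))
      (by nlinarith [sq_nonneg (t + 1 / 2)])
    obtain ⟨ρ, hρ, him⟩ := m.exists_rep ht hrad
    refine ⟨m.finrank_eq hrad, ρ, hρ, ?_⟩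
    rw [him]
    exact discreteTopology_burauGroup_real_iff ht h1 _
  · intro θ h0 h3 t ht n c hnc
    obtain ⟨m⟩ := nonempty_burauModel hnc
    have ht0 : t ≠ 0 := by rw [ht]; exact Complex.exp_ne_zero _
    have hπ : |θ| < Real.pi := by linarith [Real.pi_pos]
    have hrad := m.radical_eq_bot ht0 (one_add_ne_zero_of_exp ht hπ)
      (sq_add_add_one_ne_zero_of_exp ht hπ h3.ne)
    exact ⟨m.finrank_eq hrad, isCompact_PSU m ht h3 hrad,
      exists_rep_unit m ht ht0 h0 hπ h3.ne hrad⟩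
  · intro θ h3 hπ t ht n c hnc
    obtain ⟨m⟩ := nonempty_burauModel hnc
    have ht0 : t ≠ 0 := by rw [ht]; exact Complex.exp_ne_zero _
    have h0 : 0 < |θ| := by linarith [Real.pi_pos]
    have hrad := m.radical_eq_bot ht0 (one_add_ne_zero_of_exp ht hπ)
      (sq_add_add_one_ne_zero_of_exp ht hπ h3.ne')
    obtain ⟨ρ, hρ, hle, hiff⟩ := exists_rep_unit m ht ht0 h0 hπ h3.ne' hrad
    refine ⟨m.finrank_eq hrad, not_isCompact_PSU m ht ht0 h3 hπ hrad, ρ, hρ, hle, ?_⟩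
    -- The exceptional angle π/5 lies below 2π/3 and cannot occur here.
    rw [hiff, or_iff_left]
    intro h
    linarith [Real.pi_pos]
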